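/- **Setting.** Let $-\infty\le t_0<t_1\le\infty$, $0\le r_0<r_1\le\infty$, $B=(t_0,t_1)\times(r_0,r_1)$ with coordinates $(t,r)$, and $X=B\times S^2$; write $d\sigma^2$ for the metric of the unit sphere $S^2$. A *spherically symmetric space-time* is $X$ with a smooth Lorentzian metric $\bar g$ of signature $(-,+,+,+)$ such that $SO(3)$, acting on the factor $S^2$, acts by isometries, the orbit through a point with coordinates $(t,r)$ is a round sphere of radius $r$ (i.e. $\bar g$ restricts to $r^2d\sigma^2$ on it), $\partial_t\perp\partial_r$, and $\partial_t$ is time-like. The stress-energy tensor $T$ is given by Einstein's equation $\mathrm{Ric}-\tfrac12 S\,\bar g=8\pi T$. A *Birkhoff frame* is an orthonormal frame $(a_0,a_1,b_2,b_3)$ with $a_0$ time-like and a multiple of $\partial_t$, and $a_1$ a multiple of $\partial_r$; its dual coframe is $\theta^0,\theta^1,\psi^2,\psi^3$, and $\theta_0=-\theta^0$, $\theta_1=\theta^1$, $\psi_\nu=\psi^\nu$ are the forms with lowered index. The space-time is *static* if it has a smooth time-like irrotational (i.e. hypersurface-orthogonal) Killing vector field. For functions $\mu_0,\mu_1$ on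 $(r_0,r_1)$, $c\in\mathbb R$ and $r_*\in(r_0,r_1)$ consider $$\int_{r_*}^r 4\pi x^2\mu_0(x)\,dx<\frac{r+c}{2}\quad\text{for all } r\in(r_0,r_1),\tag{1}$$ $$h(r)=\frac{r+c}{r}-\frac2r\int_{r_*}^r4\pi x^2\mu_0(x)\,dx,\tag{2}$$ $$p(r)=\exp\left[\int_{r_*}^r\frac{4\pi x^2(\mu_0(x)+\mu_1(x))}{x+c-2\int_{r_*}^x4\pi y^2\mu_0(y)\,dy}\,dx\right],\tag{3}$$ $$\lambda=\tfrac14(3\mu_1-\mu_0)+\tfrac r2(\mu_1)_r+\frac{(\mu_0+\mu_1)(1+8\pi r^2\mu_1)}{4h},\tag{4}$$ $$\bar g=-p^2h\,d\tau^2+h^{-1}dr^2+r^2d\sigma^2.\tag{5}$$ **Theorem 2.** (a) Let $X$ be a spherically symmetric space-time with $T=-\mu_0\,\theta_0\theta^0+\mu_1\,\theta_1\theta^1+\lambda\,(\psi_2\psi^2+\psi_3\psi^3)$ with respect to Birkhoff coframes, where $\mu_0,\mu_1,\lambda$ are functions on $X$ and $\mu_1=\mu_1(r)$ depends only on $r$.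 Then $\mu_0=\mu_0(r)$, the functions $\mu_0,\mu_1$ are smooth functions of $r$, and there are $c\in\mathbb R$ and $r_*\in(r_0,r_1)$ such that (1) and the generalized Tolman–Oppenheimer–Volkoff equation (4) hold, and there is a time coordinate $\tau=\tau(t)$ (smooth, $d\tau/dt>0$) in which $\bar g$ has the form (5), with $h$ and $p$ given by (2) and (3). (b) Conversely, let $\mu_0,\mu_1$ be smooth functions on $(r_0,r_1)$, let $c\in\mathbb R$ and $r_*\in(r_0,r_1)$ be such that (1) holds, let $\lambda$ be given by (4), and let $X$ carry the metric (5) with $h,p$ given by (2), (3) and a time coordinate $\tau=\tau(t)$ as in (a). Then $X$ is a spherically symmetric space-time, it is static, and $T=-\mu_0\,\theta_0\theta^0+\mu_1\,\theta_1\theta^1+\lambda\,(\psi_2\psi^2+\psi_3\psi^3)$ with respect to Birkhoff coframes. (c) Every static spherically symmetric space-time arises in this way: there are smooth $\mu_0,\mu_1$ on $(r_0,r_1)$, a function $\lambda$ of $r$, a $c\in\mathbb R$, an $r_*\in(r_0,r_1)$ and a time coordinate $\tau=\tau(t)$ such that (1) and (4) hold, $\bar g$ is given by (5) with (2), (3),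 and $T$ has the form stated in (b). -/

import Mathlib

open scoped Manifold ContDiff Topology
open Bundle Set

set_option maxSynthPendingDepth 3

noncomputable section

namespace GR

/-! ### Curvature of a semi-Riemannian metric in a coordinate domain -/

section Coordinates

variable {E : Type*} [NormedAddCommGroup E] [NormedSpace ℝ E]

/-- Christoffel symbols of the first kind of a metric `G` in coordinates, as a bilinear map with
values in covectors:
`(u, v) ↦ (w ↦ (1/2) (∂_u G(v, w) + ∂_v G(u, w) - ∂_w G(u, v)))`. -/
def christoffelLower (G : E → E →L[ℝ] E →L[ℝ] ℝ) (y : E) : E →L[ℝ] E →L[ℝ] E →L[ℝ] ℝ :=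
  (1 / 2 : ℝ) • (fderiv ℝ G y + (fderiv ℝ G y).flip
    - ((ContinuousLinearMap.flipₗᵢ ℝ E E ℝ).toContinuousLinearEquiv :
        (E →L[ℝ] E →L[ℝ] ℝ) →L[ℝ] (E →L[ℝ] E →L[ℝ] ℝ)).comp (fderiv ℝ G y).flip)

theorem christoffelLower_apply (G : E → E →L[ℝ] E →L[ℝ] ℝ) (y u v w : E) :
    christoffelLower G y u v w =
      (1 / 2) * (fderiv ℝ G y u v w + fderiv ℝ G y v u w - fderiv ℝ G y w u v) := by
  simp [christoffelLower]

/-- The Christoffel symbols `Γ(u, v)`: the covector index of the symbols of the first kind is raised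
with the inverse of `G`. -/
def christoffel (G : E → E →L[ℝ] E →L[ℝ] ℝ) (y : E) : E →L[ℝ] E →L[ℝ] E :=
  (ContinuousLinearMap.compL ℝ E (E →L[ℝ] ℝ) E (G y).inverse).comp (christoffelLower G y)

theorem christoffel_apply (G : E → E →L[ℝ] E →L[ℝ] ℝ) (y u v : E) :
    christoffel G y u v = (G y).inverse (christoffelLower G y u v) := rfl

/-- The curvature `R(u, v) w = ∇_u ∇_v w - ∇_v ∇_u w` in coordinates, as a linear map of `u`. -/
def curvature (G : E → E →L[ℝ] E →L[ℝ] ℝ) (y v w : E) : E →L[ℝ] E :=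
  ((fderiv ℝ (christoffel G) y).flip v).flip w - (fderiv ℝ (christoffel G) y v).flip w
    + (christoffel G y).flip (christoffel G y v w)
    - (christoffel G y v).comp ((christoffel G y).flip w)

theorem curvature_apply (G : E → E →L[ℝ] E →L[ℝ] ℝ) (y u v w : E) :
    curvature G y v w u =
      fderiv ℝ (christoffel G) y u v w - fderiv ℝ (christoffel G) y v u w
        + christoffel G y u (christoffel G y v w) - christoffel G y v (christoffel G y u w) :=
  rfl

/-- The Ricci tensor in coordinates: `Ric(v, w)` is the trace of `u ↦ R(u, v) w`. -/
def ricciCoord (G : E → E →L[ℝ] E →L[ℝ] ℝ) (y : E) : E →ₗ[ℝ] E →ₗ[ℝ] ℝ :=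
  LinearMap.mk₂ ℝ (fun v w => LinearMap.trace ℝ E (curvature G y v w : E →ₗ[ℝ] E))
    (fun v v' w => by
      rw [← map_add]; congr 1; ext u; simp [curvature_apply]; abel)
    (fun a v w => by
      rw [← map_smul]; congr 1; ext u; simp [curvature_apply, smul_sub, smul_add])
    (fun v w w' => by
      rw [← map_add]; congr 1; ext u; simp [curvature_apply]; abel)
    (fun a v w => by
      rw [← map_smul]; congr 1; ext u; simp [curvature_apply, smul_sub, smul_add])

end Coordinates

/-! ### Tensor fields on a manifold -/

section Manifold

variable {E : Type*} [NormedAddCommGroup E] [NormedSpace ℝ E]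
  {H : Type*} [TopologicalSpace H] (I : ModelWithCorners ℝ E H)
  {M : Type*} [TopologicalSpace M] [ChartedSpace H M]

/-- A field of bilinear forms on the tangent spaces of a manifold. -/
abbrev BilinField (M : Type*) [TopologicalSpace M] [ChartedSpace H M] : Type _ :=
  (x : M) → TangentSpace I x →L[ℝ] TangentSpace I x →L[ℝ] ℝ

variable {I}

/-- The field `g` read in the preferred chart at `x₀`. -/
def chartMetric (g : BilinField I M) (x₀ : M) (y : E) : E →L[ℝ] E →L[ℝ] ℝ :=
  ContinuousLinearMap.bilinearComp (E := E) (F := E) (E' := E) (F' := E)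
    (g ((extChartAt I x₀).symm y))
    (mfderiv 𝓘(ℝ, E) I (extChartAt I x₀).symm y)
    (mfderiv 𝓘(ℝ, E) I (extChartAt I x₀).symm y)

/-- The vector field `K` read in the preferred chart at `x₀`. -/
def chartField (K : (x : M) → TangentSpace I x) (x₀ : M) (y : E) : E :=
  VectorField.mpullback 𝓘(ℝ, E) I (extChartAt I x₀).symm K y

/-- The Ricci tensor of the metric `g`, computed at `x` in the preferred chart at `x`; this chart
identifies the tangent space at `x` with the model space. -/
def ricci (g : BilinField I M) (x : M) : TangentSpace I x →ₗ[ℝ] TangentSpace I x →ₗ[ℝ] ℝ :=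
  ricciCoord (E := E) (chartMetric g x) (extChartAt I x x)

/-- The scalar curvature: the trace of the Ricci tensor with respect to `g`. -/
def scalarCurvature [FiniteDimensional ℝ E] (g : BilinField I M) (x : M) : ℝ :=
  LinearMap.trace ℝ E
    (((show E →L[ℝ] E →L[ℝ] ℝ from g x).inverse : (E →L[ℝ] ℝ) →ₗ[ℝ] E) ∘ₗ
      (LinearMap.toContinuousLinearMap : (E →ₗ[ℝ] ℝ) ≃ₗ[ℝ] (E →L[ℝ] ℝ)).toLinearMap ∘ₗ
      (show E →ₗ[ℝ] E →ₗ[ℝ] ℝ from ricci g x))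

/-- The stress-energy tensor, determined by Einstein's equation
`Ric - (1/2) S g = 8 π T`. -/
def stressEnergy [FiniteDimensional ℝ E] (g : BilinField I M) (x : M)
    (v w : TangentSpace I x) : ℝ :=
  (8 * Real.pi)⁻¹ * (ricci g x v w - (1 / 2) * scalarCurvature g x * g x v w)

/-- `g` is a smooth field of bilinear forms on the set `s`. -/
def SmoothMetricOn [IsManifold I ∞ M] (g : BilinField I M) (s : Set M) : Prop :=
  ContMDiffOn I (I.prod 𝓘(ℝ, E →L[ℝ] E →L[ℝ] ℝ)) ∞
    (fun x ↦ TotalSpace.mk' (E →L[ℝ] E →L[ℝ] ℝ)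
      (E := fun x : M ↦ TangentSpace I x →L[ℝ] TangentSpace I x →L[ℝ] ℝ) x (g x)) s

/-- The Killing equation `L_K g = 0` at the point `x`. -/
def IsKillingAt (g : BilinField I M) (K : (x : M) → TangentSpace I x) (x : M) : Prop :=
  ∀ v w : E,
    fderiv ℝ (chartMetric g x) (extChartAt I x x) (chartField K x (extChartAt I x x)) v w
      + chartMetric g x (extChartAt I x x)
          (fderiv ℝ (chartField K x) (extChartAt I x x) v) w
      + chartMetric g x (extChartAt I x x) v
          (fderiv ℝ (chartField K x) (extChartAt I x x) w) = 0

/-- The vector field `K` is irrotational at `x`: the exterior derivative of the 1-form `g(K, ·)`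
vanishes on the orthogonal complement of `K`. -/
def IsIrrotationalAt (g : BilinField I M) (K : (x : M) → TangentSpace I x) (x : M) : Prop :=
  ∀ v w : TangentSpace I x, g x (K x) v = 0 → g x (K x) w = 0 →
    fderiv ℝ (fun y => chartMetric g x y (chartField K x y)) (extChartAt I x x) v w
      = fderiv ℝ (fun y => chartMetric g x y (chartField K x y)) (extChartAt I x x) w v

/-- The space-time `(s, g)` is static: it has a smooth, time-like, irrotational Killing vector
field. -/
def IsStaticOn [IsManifold I ∞ M] (g : BilinField I M) (s : Set M) : Prop :=
  ∃ K : (x : M) → TangentSpace I x,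
    ContMDiffOn I I.tangent ∞ (fun x => (⟨x, K x⟩ : TangentBundle I M)) s ∧
    ∀ x ∈ s, g x (K x) (K x) < 0 ∧ IsKillingAt g K x ∧ IsIrrotationalAt g K x

/-- The signs of an orthonormal frame of a Lorentzian metric, the time-like vector first. -/
def lorentzSign (i : Fin 4) : ℝ := if i = 0 then -1 else 1

/-- `a` is an orthonormal frame of the tangent space at `x`, with `a 0` time-like. -/
def IsOrthonormalFrame (g : BilinField I M) (x : M)
    (a : Module.Basis (Fin 4) ℝ (TangentSpace I x)) : Prop :=
  ∀ i j, g x (a i) (a j) = if i = j then lorentzSign i else 0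

/-- The bilinear form `g x` is a Lorentzian scalar product of signature `(-, +, +, +)`. -/
def IsLorentzianAt (g : BilinField I M) (x : M) : Prop :=
  (∀ v w, g x v w = g x w v) ∧ ∃ a, IsOrthonormalFrame g x a

end Manifold

/-! ### Spherically symmetric space-times -/

/-- Euclidean 3-space. -/
abbrev E3 : Type := EuclideanSpace ℝ (Fin 3)

/-- The unit 2-sphere. -/
abbrev S2 : Type := Metric.sphere (0 : E3) 1

/-- The product of the plane of the coordinates `(t, r)` with the unit 2-sphere. -/
abbrev Event : Type := (ℝ × ℝ) × S2

/-- The model of the manifold `Event`. -/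
abbrev modelX : ModelWithCorners ℝ ((ℝ × ℝ) × EuclideanSpace ℝ (Fin 2))
    (ModelProd (ℝ × ℝ) (EuclideanSpace ℝ (Fin 2))) :=
  𝓘(ℝ, ℝ × ℝ).prod (𝓡 2)

/-- Tangent vectors at an event. -/
abbrev TX (x : Event) : Type := TangentSpace modelX x

/-- The real numbers strictly between two extended real numbers. -/
def between (a b : EReal) : Set ℝ := {s | a < (s : EReal) ∧ (s : EReal) < b}

/-- The manifold `X = B × S²`, where `B` is the rectangle `(t₀, t₁) × (r₀, r₁)` of the coordinates
`(t, r)`. -/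
def region (t₀ t₁ r₀ r₁ : EReal) : Set Event :=
  {x | x.1.1 ∈ between t₀ t₁ ∧ x.1.2 ∈ between r₀ r₁}

/-- The coordinate function `t`. -/
def tCoord (x : Event) : ℝ := x.1.1

/-- The coordinate function `r`. -/
def rCoord (x : Event) : ℝ := x.1.2

/-- The differential of a real function on `Event`. -/
def differential (f : Event → ℝ) (x : Event) (v : TX x) : ℝ :=
  NormedSpace.fromTangentSpace (𝕜 := ℝ) (f x) (mfderiv modelX 𝓘(ℝ, ℝ) f x v)

/-- The coordinate vector field `∂/∂t`. -/
def partialT (x : Event) : TX x := (((1, 0), 0) : (ℝ × ℝ) × EuclideanSpace ℝ (Fin 2))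

/-- The coordinate vector field `∂/∂r`. -/
def partialR (x : Event) : TX x := (((0, 1), 0) : (ℝ × ℝ) × EuclideanSpace ℝ (Fin 2))

/-- The projection of `Event` to the sphere, followed by the inclusion in Euclidean space. -/
def sphereProj (x : Event) : E3 := (x.2 : E3)

/-- The pullback to `Event` of the metric `dσ²` of the unit sphere. -/
def roundMetric (x : Event) (v w : TX x) : ℝ :=
  inner ℝ
    (NormedSpace.fromTangentSpace (𝕜 := ℝ) (sphereProj x) (mfderiv modelX 𝓘(ℝ, E3) sphereProj x v))
    (NormedSpace.fromTangentSpace (𝕜 := ℝ) (sphereProj x) (mfderiv modelX 𝓘(ℝ, E3) sphereProj x w))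

/-- The action of a linear isometry of Euclidean 3-space on the second factor of `Event`. -/
def rotate (A : E3 ≃ₗᵢ[ℝ] E3) (x : Event) : Event :=
  (x.1, ⟨A x.2, by simp⟩)

/-- The region `X` with the metric `g` is a spherically symmetric space-time with adapted
coordinates `(t, r)`. -/
structure IsSphericallySymmetric (t₀ t₁ r₀ r₁ : EReal) (g : BilinField modelX Event) : Prop where
  /-- The metric is smooth. -/
  smooth : SmoothMetricOn g (region t₀ t₁ r₀ r₁)
  /-- The metric is Lorentzian. -/
  lorentzian : ∀ x ∈ region t₀ t₁ r₀ r₁, IsLorentzianAt g x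
  /-- The rotations act by isometries. -/
  rotation_invariant : ∀ A : E3 ≃ₗᵢ[ℝ] E3,
    LinearMap.det (A.toLinearEquiv : E3 →ₗ[ℝ] E3) = 1 →
    ∀ x ∈ region t₀ t₁ r₀ r₁, ∀ v w : TX x,
      g (rotate A x) (mfderiv modelX modelX (rotate A) x v) (mfderiv modelX modelX (rotate A) x w)
        = g x v w
  /-- The orbit through `x` is a round sphere of radius `r`, hence of curvature `1 / r ^ 2`. -/
  orbit_metric : ∀ x ∈ region t₀ t₁ r₀ r₁, ∀ v w : TX x,
    differential tCoord x v = 0 → differential rCoord x v = 0 →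
    differential tCoord x w = 0 → differential rCoord x w = 0 →
    g x v w = rCoord x ^ 2 * roundMetric x v w
  /-- The coordinate directions `t` and `r` are orthogonal. -/
  orthogonal : ∀ x ∈ region t₀ t₁ r₀ r₁, g x (partialT x) (partialR x) = 0
  /-- The coordinate `t` is a time coordinate. -/
  timelike : ∀ x ∈ region t₀ t₁ r₀ r₁, g x (partialT x) (partialT x) < 0

/-- A Birkhoff frame at `x`: an orthonormal frame whose time-like vector is a multiple of `∂/∂t`
and whose first space-like vector is a multiple of `∂/∂r`. The dual coframe is `a.coord`. -/
def IsBirkhoffFrame (g : BilinField modelX Event) (x : Event)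
    (a : Module.Basis (Fin 4) ℝ (TX x)) : Prop :=
  IsOrthonormalFrame g x a ∧ (∃ k : ℝ, a 0 = k • partialT x) ∧ (∃ k : ℝ, a 1 = k • partialR x)

/-- At every event of the region the stress-energy tensor is, in a Birkhoff coframe
`θ⁰, θ¹, ψ², ψ³`, equal to `-μ₀ θ₀ θ⁰ + μ₁ θ₁ θ¹ + lam (ψ₂ ψ² + ψ₃ ψ³)`; here the index of the
coframe is lowered with the metric, so that `θ_i = g(a i, ·)`. -/
def HasDiagonalStress (t₀ t₁ r₀ r₁ : EReal) (g : BilinField modelX Event)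
    (μ₀ μ₁ lam : Event → ℝ) : Prop :=
  ∀ x ∈ region t₀ t₁ r₀ r₁, ∃ a : Module.Basis (Fin 4) ℝ (TX x), IsBirkhoffFrame g x a ∧
    ∀ v w : TX x, stressEnergy g x v w =
      -μ₀ x * (g x (a 0) v * a.coord 0 w) + μ₁ x * (g x (a 1) v * a.coord 1 w)
        + lam x * (g x (a 2) v * a.coord 2 w + g x (a 3) v * a.coord 3 w)

/-! ### The static metrics -/

/-- The integral `∫_{r_*}^r 4 π x² μ₀(x) dx`. -/
def massIntegral (μ₀ : ℝ → ℝ) (rs r : ℝ) : ℝ :=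
  ∫ x in rs..r, 4 * Real.pi * x ^ 2 * μ₀ x

/-- The function `h`. -/
def hFun (μ₀ : ℝ → ℝ) (c rs r : ℝ) : ℝ :=
  (r + c) / r - (2 / r) * massIntegral μ₀ rs r

/-- The function `p`. -/
def pFun (μ₀ μ₁ : ℝ → ℝ) (c rs r : ℝ) : ℝ :=
  Real.exp (∫ x in rs..r,
    4 * Real.pi * x ^ 2 * (μ₀ x + μ₁ x) / (x + c - 2 * massIntegral μ₀ rs x))

/-- The right-hand side of the generalized Tolman-Oppenheimer-Volkoff equation. -/
def tovRHS (μ₀ μ₁ : ℝ → ℝ) (c rs r : ℝ) : ℝ :=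
  (1 / 4) * (3 * μ₁ r - μ₀ r) + (r / 2) * deriv μ₁ r
    + (μ₀ r + μ₁ r) * (1 + 8 * Real.pi * r ^ 2 * μ₁ r) / (4 * hFun μ₀ c rs r)

/-- The inequality `∫_{r_*}^r 4 π x² μ₀(x) dx < (r + c) / 2` on `(r₀, r₁)`. -/
def MassBound (r₀ r₁ : EReal) (μ₀ : ℝ → ℝ) (c rs : ℝ) : Prop :=
  ∀ r ∈ between r₀ r₁, massIntegral μ₀ rs r < (r + c) / 2

/-- There is a time coordinate `τ = τ(t)` such that
`g = -p² h dτ² + h⁻¹ dr² + r² dσ²` on the region. -/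
def HasStaticForm (t₀ t₁ r₀ r₁ : EReal) (g : BilinField modelX Event)
    (h p : ℝ → ℝ) : Prop :=
  ∃ τ : ℝ → ℝ, ContDiffOn ℝ ∞ τ (between t₀ t₁) ∧ (∀ t ∈ between t₀ t₁, 0 < deriv τ t) ∧
    ∀ x ∈ region t₀ t₁ r₀ r₁, ∀ v w : TX x,
      g x v w =
        -(p (rCoord x) ^ 2 * h (rCoord x)) *
            (differential (fun z => τ (tCoord z)) x v * differential (fun z => τ (tCoord z)) x w)
          + (h (rCoord x))⁻¹ * (differential rCoord x v * differential rCoord x w)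
          + rCoord x ^ 2 * roundMetric x v w

end GR

end

noncomputable section

namespace GR

/-! Half-turns supply all the symmetry that is needed. A half-turn carrying one point of the sphere
to another makes the metric coefficients on the (t, r)-plane independent of the point. The half-turn
about the point itself is the identity on the (t, r)-plane and -1 on the tangent plane of the
sphere, so mixed terms vanish. With ∂_t ⊥ ∂_r this gives g = -e^{2a} dt² + e^{2b} dr² + r² dσ² with
a, b functions of (t, r) (`IsSphericallySymmetric.exists_diagonalForm`). The Einstein tensor of this
metric is computed at the centre of a stereographic chart. Comparison with a Birkhoff frame
(`HasDiagonalForm.hasDiagonalStress_iff`) turns the shape of T into the equation b_t = 0, which is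
the vanishing of the (t, r)-component 2 b_t / r, and one scalar equation for each of μ₀, μ₁, λ.

For (a), b is a function β(r). The μ₁-equation determines a_r from b and μ₁, so a_r depends on r
alone and a = α(r) + ψ(t); the summand ψ is absorbed into τ. The rest is calculus for
`IsStaticProfile`. The density equation says (r - r e^{-2β})' = 8π r² μ₀, so h = e^{-2β}, with c
fixed by the value at r_*. The sum of the density and pressure equations identifies α' + β' with the
integrand of p. The angular equation becomes (4) once the derivative of the pressure equation is
used to match α''.

For (b), these equations are solved backwards (`exists_staticProfile`), and ∂_τ is the required
Killing field.

For (c), the Killing field K need be neither rotation-invariant nor a multiple of ∂_t. It is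
integrated over a great circle (`HasDiagonalForm.static_of_killing`). Along the circle, the
derivative of the tangential component of K is -K^r / r, so K^r has integral zero at every (t, r).
The integral A of K^t has no zero, because K is time-like. The integrated Killing equations then
read b_t A = 0, A_r = 0 and A_t = -a_t A, whence b_t = 0 and a_{tr} = 0. The radial pressure
therefore depends on r only, and (a) applies. -/

/-! ### Stereographic charts of the sphere -/

/-- The Euclidean plane, the model space of the sphere. -/
abbrev E2 : Type := EuclideanSpace ℝ (Fin 2)

/-- The model space of `Event`. -/
abbrev EX : Type := (ℝ × ℝ) × E2

theorem fact_finrank_E3 : Fact (Module.finrank ℝ E3 = 2 + 1) := ⟨by simp⟩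

/-- The isometric identification of the model plane with the orthogonal complement of `p` that is
used by the stereographic chart at `p`. -/
def sphereFrame (p : S2) : E2 →ₗᵢ[ℝ] E3 :=
  haveI := fact_finrank_E3
  (ℝ ∙ ((-p : S2) : E3))ᗮ.subtypeₗᵢ.comp
    (OrthonormalBasis.fromOrthogonalSpanSingleton 2
      (ne_zero_of_mem_unit_sphere (-p))).repr.symm.toLinearIsometry

theorem inner_sphereFrame (p : S2) (u : E2) : inner ℝ (p : E3) (sphereFrame p u) = 0 := by
  have := fact_finrank_E3
  have h := ((OrthonormalBasis.fromOrthogonalSpanSingleton 2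
      (ne_zero_of_mem_unit_sphere (-p))).repr.symm u).2
  rw [Submodule.mem_orthogonal_singleton_iff_inner_right] at h
  have h' : inner ℝ ((-p : S2) : E3) (sphereFrame p u) = 0 := h
  simpa using h'

theorem sphereFrame_surj (p : S2) (w : E3) (hw : inner ℝ (p : E3) w = 0) :
    ∃ u, sphereFrame p u = w := by
  have := fact_finrank_E3
  have h : w ∈ (ℝ ∙ ((-p : S2) : E3))ᗮ := by
    rw [Submodule.mem_orthogonal_singleton_iff_inner_right]; simpa using hw
  let e := (OrthonormalBasis.fromOrthogonalSpanSingleton (𝕜 := ℝ) 2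
      (ne_zero_of_mem_unit_sphere (-p))).repr
  refine ⟨e ⟨w, h⟩, ?_⟩
  change ((e.symm (e ⟨w, h⟩) : (ℝ ∙ ((-p : S2) : E3))ᗮ) : E3) = w
  rw [e.symm_apply_apply]

theorem target_extChartAt_sphere (p : S2) : (extChartAt (𝓡 2) p).target = univ := by
  have := fact_finrank_E3
  have : (chartAt E2 p).target = univ := stereographic'_target (-p)
  simp [this]

/-- The inverse stereographic chart, with values in Euclidean space. -/
def stereoInv (p : S2) (u : E2) : E3 :=
  (‖u‖ ^ 2 + 4)⁻¹ • ((4 : ℝ) • sphereFrame p u - (‖u‖ ^ 2 - 4) • (p : E3))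

/-- The preferred chart at `p` projects from the antipode `-p`, so `p` itself sits at the origin of
the plane. -/
theorem coe_extChartAt_symm (p : S2) (u : E2) :
    (((extChartAt (𝓡 2) p).symm u : S2) : E3) = stereoInv p u := by
  have := fact_finrank_E3
  have h : (((extChartAt (𝓡 2) p).symm u : S2) : E3) = ((stereographic' 2 (-p)).symm u : S2) := by
    simp [extChartAt, chartAt, ChartedSpace.chartAt]
  rw [h, stereographic'_symm_apply]
  have h2 : ‖sphereFrame p u‖ = ‖u‖ := (sphereFrame p).norm_map u
  have h3 : ∀ w : E3, sphereFrame p u = w →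
      (‖w‖ ^ 2 + 4)⁻¹ • (4 : ℝ) • w + (‖w‖ ^ 2 + 4)⁻¹ • (‖w‖ ^ 2 - 4) • ((-p : S2) : E3)
        = stereoInv p u := by
    rintro w rfl
    rw [h2, stereoInv]
    simp only [coe_neg_sphere, smul_sub, smul_neg]
    abel
  exact h3 _ rfl

theorem extChartAt_sphere_self (p : S2) : extChartAt (𝓡 2) p p = 0 := by
  have h : (extChartAt (𝓡 2) p).symm (0 : E2) = p := by
    apply Subtype.ext
    rw [coe_extChartAt_symm, stereoInv]
    simp
  conv_lhs => rw [← h]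
  have := (extChartAt (𝓡 2) p).right_inv (x := 0) (by rw [target_extChartAt_sphere]; trivial)
  convert this using 1
  rw [h]

theorem contDiff_stereoInv (p : S2) : ContDiff ℝ ∞ (stereoInv p) := by
  unfold stereoInv
  have h₀ : ContDiff ℝ ∞ fun w : E2 => ‖w‖ ^ 2 := contDiff_norm_sq ℝ
  refine ((h₀.add contDiff_const).inv fun x => by positivity).smul ?_
  exact ((sphereFrame p).contDiff.const_smul (4 : ℝ)).sub
    ((h₀.sub contDiff_const).smul contDiff_const)

/-- The conformal factor of the stereographic chart. -/
def conformalFactor (u : E2) : ℝ := 16 / (‖u‖ ^ 2 + 4) ^ 2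

theorem fderiv_stereoInv (p : S2) (u v : E2) :
    fderiv ℝ (stereoInv p) u v = (‖u‖ ^ 2 + 4)⁻¹ •
        ((4 : ℝ) • sphereFrame p v - (2 * inner ℝ u v) • (p : E3))
      - ((2 * inner ℝ u v) / (‖u‖ ^ 2 + 4) ^ 2) •
        ((4 : ℝ) • sphereFrame p u - (‖u‖ ^ 2 - 4) • (p : E3)) := by
  have h0 : HasFDerivAt (fun w : E2 => ‖w‖ ^ 2) _ u := (hasStrictFDerivAt_norm_sq u).hasFDerivAt
  have hne : ‖u‖ ^ 2 + 4 ≠ 0 := by positivity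
  have h1 := (hasDerivAt_inv hne).comp_hasFDerivAt u (h0.add_const 4)
  have h2 : HasFDerivAt (fun w : E2 => (4 : ℝ) • sphereFrame p w - (‖w‖ ^ 2 - 4) • (p : E3)) _ u :=
    (((sphereFrame p).toContinuousLinearMap.hasFDerivAt).const_smul (4 : ℝ)).sub
      ((h0.sub_const 4).smul_const (p : E3))
  have h3 := (h1.smul h2).fderiv
  have h4 : fderiv ℝ (stereoInv p) u = _ := h3
  rw [h4]
  simp
  module

theorem inner_fderiv_stereoInv (p : S2) (u v w : E2) :
    inner ℝ (fderiv ℝ (stereoInv p) u v) (fderiv ℝ (stereoInv p) u w)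
      = conformalFactor u * inner ℝ v w := by
  have hp : inner ℝ (p : E3) (p : E3) = 1 := by simp
  have hf : ∀ a b, inner ℝ (sphereFrame p a) (sphereFrame p b) = inner ℝ a b :=
    (sphereFrame p).inner_map_map
  have hne : ‖u‖ ^ 2 + 4 ≠ 0 := by positivity
  rw [fderiv_stereoInv, fderiv_stereoInv, conformalFactor]
  have hpf : ∀ a, inner ℝ (sphereFrame p a) (p : E3) = 0 := fun a => by
    rw [real_inner_comm, inner_sphereFrame]
  simp only [inner_sub_left, inner_sub_right, inner_smul_left, inner_smul_right, hf, hp, hpf,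
    inner_sphereFrame, real_inner_self_eq_norm_sq, real_inner_comm u v]
  simp
  field_simp
  ring

theorem fderiv_stereoInv_zero (p : S2) (v : E2) :
    fderiv ℝ (stereoInv p) 0 v = sphereFrame p v := by
  rw [fderiv_stereoInv]
  simp [smul_smul]

theorem mdifferentiable_coe_sphere :
    MDifferentiable (𝓡 2) 𝓘(ℝ, E3) ((↑) : S2 → E3) := by
  have := fact_finrank_E3
  exact (contMDiff_coe_sphere (m := 1)).mdifferentiable (by simp)

/-- A tangent vector at `p` is stored as its coordinates in the chart centred at `p`. The conformal
factor is 1 at the centre, so these coordinates are isometric to the tangent plane in Euclidean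
space. Every later computation on the sphere goes through this identification. -/
theorem mfderiv_coe_sphere_apply (p : S2) (v : E2) :
    (mfderiv (𝓡 2) 𝓘(ℝ, E3) ((↑) : S2 → E3) p v : E3) = sphereFrame p v := by
  rw [(mdifferentiable_coe_sphere p).mfderiv]
  have h : writtenInExtChartAt (𝓡 2) 𝓘(ℝ, E3) p ((↑) : S2 → E3) = stereoInv p := by
    ext1 u
    simp only [writtenInExtChartAt, extChartAt_model_space_eq_id, PartialEquiv.refl_coe,
      Function.comp_apply, id]
    exact coe_extChartAt_symm p u
  rw [h, extChartAt_sphere_self]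
  simp only [modelWithCornersSelf_coe, range_id, fderivWithin_univ]
  exact fderiv_stereoInv_zero p v

/-! ### Charts and tangent vectors of the product manifold -/

theorem contMDiff_sphereProj : ContMDiff modelX 𝓘(ℝ, E3) ∞ sphereProj := by
  have := fact_finrank_E3
  exact (contMDiff_coe_sphere (m := ∞)).comp contMDiff_snd

theorem contMDiff_fst_event : ContMDiff modelX 𝓘(ℝ, ℝ × ℝ) ∞ (Prod.fst : Event → ℝ × ℝ) :=
  contMDiff_fst

theorem mfderiv_sphereProj_apply (x : Event) (v : EX) :
    (mfderiv modelX 𝓘(ℝ, E3) sphereProj x v : E3) = sphereFrame x.2 v.2 := by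
  have h : mfderiv modelX 𝓘(ℝ, E3) sphereProj x =
      (mfderiv (𝓡 2) 𝓘(ℝ, E3) ((↑) : S2 → E3) x.2).comp (mfderiv modelX (𝓡 2) Prod.snd x) :=
    mfderiv_comp x (mdifferentiable_coe_sphere x.2) mdifferentiableAt_snd
  rw [h, mfderiv_snd]
  exact mfderiv_coe_sphere_apply x.2 v.2

theorem mfderiv_fst_apply (x : Event) (v : EX) :
    (mfderiv modelX 𝓘(ℝ, ℝ × ℝ) (Prod.fst : Event → ℝ × ℝ) x v : ℝ × ℝ) = v.1 := by
  rw [mfderiv_fst]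
  rfl

theorem differential_comp_fst {f : ℝ × ℝ → ℝ} (x : Event) (v : EX)
    (hf : DifferentiableAt ℝ f x.1) :
    differential (fun z => f z.1) x v = fderiv ℝ f x.1 v.1 := by
  have h : mfderiv modelX 𝓘(ℝ, ℝ) (fun z : Event => f z.1) x =
      (mfderiv 𝓘(ℝ, ℝ × ℝ) 𝓘(ℝ, ℝ) f x.1).comp (mfderiv modelX 𝓘(ℝ, ℝ × ℝ) Prod.fst x) :=
    mfderiv_comp x hf.mdifferentiableAt mdifferentiableAt_fst
  have h2 : differential (fun z => f z.1) x v =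
      (mfderiv modelX 𝓘(ℝ, ℝ) (fun z : Event => f z.1) x v : ℝ) := rfl
  rw [h2, h, mfderiv_fst, mfderiv_eq_fderiv]
  rfl

theorem differential_tCoord (x : Event) (v : EX) : differential tCoord x v = v.1.1 := by
  have := differential_comp_fst (f := Prod.fst) x v differentiableAt_fst
  rw [fderiv_fst] at this
  exact this

theorem differential_rCoord (x : Event) (v : EX) : differential rCoord x v = v.1.2 := by
  have := differential_comp_fst (f := Prod.snd) x v differentiableAt_snd
  rw [fderiv_snd] at this
  exact this

theorem differential_comp_tCoord {τ : ℝ → ℝ} (x : Event) (v : EX)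
    (hτ : DifferentiableAt ℝ τ x.1.1) :
    differential (fun z => τ (tCoord z)) x v = deriv τ x.1.1 * v.1.1 := by
  have h := differential_comp_fst (f := fun q => τ q.1) x v
    (hτ.comp (f := Prod.fst) x.1 differentiableAt_fst)
  refine h.trans ?_
  have h2 : fderiv ℝ (fun q : ℝ × ℝ => τ q.1) x.1 = _ :=
    (hτ.hasDerivAt.comp_hasFDerivAt (f := Prod.fst) x.1 hasFDerivAt_fst).fderiv
  rw [h2]
  simp

theorem roundMetric_apply (x : Event) (v w : EX) : roundMetric x v w = inner ℝ v.2 w.2 := by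
  have h := (sphereFrame x.2).inner_map_map v.2 w.2
  rw [← mfderiv_sphereProj_apply x v, ← mfderiv_sphereProj_apply x w] at h
  exact h

theorem extChartAt_event_symm (x : Event) (y : EX) :
    (extChartAt modelX x).symm y = (y.1, (extChartAt (𝓡 2) x.2).symm y.2) := by
  rw [extChartAt_prod]
  rfl

theorem extChartAt_event_self (x : Event) : extChartAt modelX x x = ((x.1, 0) : EX) := by
  rw [extChartAt_prod]
  have := extChartAt_sphere_self x.2
  exact Prod.ext rfl this

theorem target_extChartAt_event (x : Event) : (extChartAt modelX x).target = univ := by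
  rw [extChartAt_prod]
  rw [PartialEquiv.prod_target, target_extChartAt_sphere, extChartAt_model_space_eq_id]
  simp only [PartialEquiv.refl_target, univ_prod_univ]

theorem contMDiff_extChartAt_event_symm (x : Event) :
    ContMDiff 𝓘(ℝ, EX) modelX ∞ (extChartAt modelX x).symm := by
  have := contMDiffOn_extChartAt_symm (I := modelX) (n := ∞) x
  rwa [target_extChartAt_event, contMDiffOn_univ] at this

/-- The differential of the inverse of the preferred chart at `x`. -/
def chartInvDeriv (x : Event) (y : EX) : EX →L[ℝ] EX :=
  mfderiv 𝓘(ℝ, EX) modelX (extChartAt modelX x).symm y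

theorem mdifferentiable_extChartAt_event_symm (x : Event) :
    MDifferentiable 𝓘(ℝ, EX) modelX (extChartAt modelX x).symm :=
  (contMDiff_extChartAt_event_symm x).mdifferentiable (by simp)

theorem chartInvDeriv_fst (x : Event) (y v : EX) : (chartInvDeriv x y v).1 = v.1 := by
  have h : mfderiv 𝓘(ℝ, EX) 𝓘(ℝ, ℝ × ℝ) (Prod.fst ∘ (extChartAt modelX x).symm) y =
      (mfderiv modelX 𝓘(ℝ, ℝ × ℝ) Prod.fst ((extChartAt modelX x).symm y)).comp
        (mfderiv 𝓘(ℝ, EX) modelX (extChartAt modelX x).symm y) :=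
    mfderiv_comp y mdifferentiableAt_fst (mdifferentiable_extChartAt_event_symm x y)
  have h2 : (Prod.fst ∘ (extChartAt modelX x).symm) = (Prod.fst : EX → ℝ × ℝ) := by
    ext1 y; exact congrArg Prod.fst (extChartAt_event_symm x y)
  rw [h2, mfderiv_eq_fderiv, fderiv_fst, mfderiv_fst] at h
  exact (congrArg (fun L : EX →L[ℝ] ℝ × ℝ => L v) h).symm

/-- Vectors at the image point are stored in the chart centred there, not in the chart at `x`.
Pushing both sides into Euclidean 3-space replaces the transition map by the explicit `stereoInv`.
-/
theorem sphereFrame_chartInvDeriv (x : Event) (y v : EX) :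
    sphereFrame ((extChartAt modelX x).symm y).2 (chartInvDeriv x y v).2
      = fderiv ℝ (stereoInv x.2) y.2 v.2 := by
  rw [← mfderiv_sphereProj_apply]
  have h : mfderiv 𝓘(ℝ, EX) 𝓘(ℝ, E3) (sphereProj ∘ (extChartAt modelX x).symm) y =
      (mfderiv modelX 𝓘(ℝ, E3) sphereProj ((extChartAt modelX x).symm y)).comp
        (mfderiv 𝓘(ℝ, EX) modelX (extChartAt modelX x).symm y) :=
    mfderiv_comp y (contMDiff_sphereProj.mdifferentiable (by simp) _)
      (mdifferentiable_extChartAt_event_symm x y)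
  have h2 : (sphereProj ∘ (extChartAt modelX x).symm) = fun y : EX => stereoInv x.2 y.2 := by
    ext1 y
    simp only [sphereProj, Function.comp_apply, extChartAt_event_symm]
    exact coe_extChartAt_symm x.2 y.2
  have h3 : fderiv ℝ (fun y : EX => stereoInv x.2 y.2) y
      = (fderiv ℝ (stereoInv x.2) y.2).comp (ContinuousLinearMap.snd ℝ (ℝ × ℝ) E2) :=
    (((contDiff_stereoInv x.2).differentiable (by simp) y.2).hasFDerivAt.comp y
      hasFDerivAt_snd).fderiv
  rw [h2, mfderiv_eq_fderiv, h3] at h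
  exact (congrArg (fun L : EX →L[ℝ] E3 => L v) h).symm

theorem inner_chartInvDeriv (x : Event) (y v w : EX) :
    inner ℝ (chartInvDeriv x y v).2 (chartInvDeriv x y w).2
      = conformalFactor y.2 * inner ℝ v.2 w.2 := by
  rw [← (sphereFrame ((extChartAt modelX x).symm y).2).inner_map_map, sphereFrame_chartInvDeriv,
    sphereFrame_chartInvDeriv, inner_fderiv_stereoInv]

theorem chartInvDeriv_self (x : Event) (v : EX) :
    chartInvDeriv x (extChartAt modelX x x) v = v := by
  refine Prod.ext (chartInvDeriv_fst x _ v) ?_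
  apply (sphereFrame x.2).injective
  have h := sphereFrame_chartInvDeriv x (extChartAt modelX x x) v
  rw [extChartAt_to_inv] at h
  rw [h, extChartAt_event_self]
  exact fderiv_stereoInv_zero x.2 v.2

theorem chartMetric_apply (g : BilinField modelX Event) (x : Event) (y v w : EX) :
    chartMetric g x y v w
      = g ((extChartAt modelX x).symm y) (chartInvDeriv x y v) (chartInvDeriv x y w) := rfl

theorem conformalFactor_pos (u : E2) : 0 < conformalFactor u := by
  unfold conformalFactor; positivity

theorem conformalFactor_zero : conformalFactor 0 = 1 := by
  norm_num [conformalFactor]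

/-- Conformality with a positive factor on the sphere and the identity on the base leave no kernel;
in finite dimension this suffices. -/
theorem chartInvDeriv_isInvertible (x : Event) (y : EX) : (chartInvDeriv x y).IsInvertible := by
  have hinj : Function.Injective (chartInvDeriv x y) := by
    rw [injective_iff_map_eq_zero]
    intro v hv
    have h1 := chartInvDeriv_fst x y v
    have h2 := inner_chartInvDeriv x y v v
    rw [hv] at h1 h2
    refine Prod.ext (by simpa using h1.symm) ?_
    have h3 := (conformalFactor_pos y.2).ne'
    simpa [h3] using h2
  exact ⟨(LinearEquiv.ofInjectiveEndo (chartInvDeriv x y : EX →ₗ[ℝ] EX)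
    hinj).toContinuousLinearEquiv, ContinuousLinearMap.ext fun _ => rfl⟩

theorem chartInvDeriv_chartField (K : (x : Event) → TX x) (x : Event) (y : EX) :
    chartInvDeriv x y (chartField K x y) = K ((extChartAt modelX x).symm y) := by
  have h : chartField K x y = (chartInvDeriv x y).inverse (K ((extChartAt modelX x).symm y)) := rfl
  rw [h]
  obtain ⟨e, he⟩ := chartInvDeriv_isInvertible x y
  rw [← he, ContinuousLinearMap.inverse_equiv]
  exact e.apply_symm_apply _

theorem isOpen_between (a b : EReal) : IsOpen (between a b) :=
  isOpen_Ioo.preimage continuous_coe_real_ereal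

theorem isOpen_region (t₀ t₁ r₀ r₁ : EReal) : IsOpen (region t₀ t₁ r₀ r₁) :=
  ((isOpen_between t₀ t₁).preimage (continuous_fst.comp continuous_fst)).inter
    ((isOpen_between r₀ r₁).preimage (continuous_snd.comp continuous_fst))

/-! ### Smoothness of sections, read in charts -/

theorem smoothMetricOn_of_chartMetric {g : BilinField modelX Event} {s : Set Event}
    (hg : ∀ x ∈ s, ContDiffAt ℝ ∞ (chartMetric g x) (extChartAt modelX x x)) :
    SmoothMetricOn g s := by
  intro x₀ hx₀
  apply ContMDiffAt.contMDiffWithinAt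
  rw [contMDiffAt_hom_bundle]
  refine ⟨contMDiffAt_id, ?_⟩
  have h1 : ContMDiffAt modelX 𝓘(ℝ, EX →L[ℝ] EX →L[ℝ] ℝ) ∞
      (fun x => chartMetric g x₀ (extChartAt modelX x₀ x)) x₀ :=
    (hg x₀ hx₀).contMDiffAt.comp x₀ contMDiffAt_extChartAt
  refine h1.congr_of_eventuallyEq ?_
  filter_upwards [extChartAt_source_mem_nhds (I := modelX) x₀] with x hx
  have hx0 : x ∈ (chartAt (ModelProd (ℝ × ℝ) (EuclideanSpace ℝ (Fin 2))) x₀).source := by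
    rwa [extChartAt_source] at hx
  have hx' : x ∈ (trivializationAt EX (TangentSpace modelX) x₀).baseSet := by
    rwa [TangentBundle.trivializationAt_baseSet]
  have h2 : (extChartAt modelX x₀).symm (extChartAt modelX x₀ x) = x :=
    (extChartAt modelX x₀).left_inv hx
  -- The tangent bundle trivialization at `x₀` is inverted by the differential of the inverse chart,
  -- so the bundle coordinates of `g` are `chartMetric g x₀`.
  have h3 : ∀ v : EX, ((trivializationAt EX (TangentSpace modelX) x₀).symm x v : EX) =
      chartInvDeriv x₀ (extChartAt modelX x₀ x) v := by
    intro v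
    have h := TangentBundle.symmL_trivializationAt (I := modelX) hx0
    have hr : range modelX = univ := modelX.range_eq_univ
    rw [hr, mfderivWithin_univ] at h
    rw [← Trivialization.symmL_apply (R := ℝ) (hb := hx')]
    exact congrArg (fun L : EX →L[ℝ] EX => L v) h
  have key : ∀ v w : EX, (ContinuousLinearMap.inCoordinates EX (TangentSpace modelX)
      (EX →L[ℝ] ℝ) (fun x => TangentSpace modelX x →L[ℝ] ℝ) x₀ x x₀ x (g x)) v w =
      chartMetric g x₀ (extChartAt modelX x₀ x) v w := by
    intro v w
    rw [inCoordinates_apply_eq₂ (E₃ := fun _ => ℝ) hx' hx' (by simp)]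
    have h4 : ∀ x' : Event, x' = x → ∀ a b : EX, g x a b = g x' a b := by rintro _ rfl a b; rfl
    have h5 := h4 _ h2 ((trivializationAt EX (TangentSpace modelX) x₀).symm x v)
      ((trivializationAt EX (TangentSpace modelX) x₀).symm x w)
    rw [h3, h3] at h5
    rw [chartMetric_apply]
    refine Eq.trans ?_ h5
    rw [h3, h3]
    exact LinearMap.congr_fun (Bundle.Trivial.linearMapAt_trivialization ℝ Event ℝ x) _
  exact ContinuousLinearMap.ext fun v => ContinuousLinearMap.ext fun w => key v w

/-- The vectors `(e, 0)` along the slice with fixed sphere point are the push-forward of a constant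
field on the plane, hence a smooth section; no frame on the sphere is needed. -/
theorem contDiffOn_slice {g : BilinField modelX Event} {t₀ t₁ r₀ r₁ : EReal}
    (hg : SmoothMetricOn g (region t₀ t₁ r₀ r₁)) (p : S2) (e : ℝ × ℝ) :
    ContDiffOn ℝ ∞ (fun q : ℝ × ℝ => g (q, p) ((e, 0) : EX) ((e, 0) : EX))
      (between t₀ t₁ ×ˢ between r₀ r₁) := by
  let j : ℝ × ℝ → Event := fun q => (q, p)
  have hj : ContMDiff 𝓘(ℝ, ℝ × ℝ) modelX ∞ j := contMDiff_id.prodMk contMDiff_const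
  have hsec : ContMDiff 𝓘(ℝ, ℝ × ℝ) (𝓘(ℝ, ℝ × ℝ).tangent) ∞
      (fun q : ℝ × ℝ => (⟨q, e⟩ : TangentBundle 𝓘(ℝ, ℝ × ℝ) (ℝ × ℝ))) :=
    contMDiff_vectorSpace_iff_contDiff.2 contDiff_const
  have hv : ContMDiff 𝓘(ℝ, ℝ × ℝ) (modelX.tangent) ∞
      (fun q : ℝ × ℝ => (⟨j q, ((e, 0) : EX)⟩ : TangentBundle modelX Event)) := by
    have h := (hj.contMDiff_tangentMap (m := ∞) (by simp)).comp hsec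
    convert h using 1
    ext1 q
    have : mfderiv 𝓘(ℝ, ℝ × ℝ) modelX j q = _ := mfderiv_prod_left
    simp only [Function.comp_apply, tangentMap, this]
    rfl
  have hs : ∀ q ∈ between t₀ t₁ ×ˢ between r₀ r₁, j q ∈ region t₀ t₁ r₀ r₁ := fun q hq => hq
  have h := ContMDiffOn.clm_bundle_apply₂ (F₁ := EX) (F₂ := EX) (F₃ := ℝ)
    (E₁ := (TangentSpace modelX : Event → Type _)) (E₂ := (TangentSpace modelX : Event → Type _))
    (E₃ := Bundle.Trivial Event ℝ) (b := j)
    (ContMDiffOn.comp hg hj.contMDiffOn hs) hv.contMDiffOn hv.contMDiffOn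
  intro q hq
  have h1 := h q hq
  rw [contMDiffWithinAt_totalSpace] at h1
  exact h1.2.contDiffWithinAt

theorem contDiffAt_chartField {K : (x : Event) → TX x} {s : Set Event} (hs : IsOpen s)
    (hK : ContMDiffOn modelX modelX.tangent ∞ (fun x => (⟨x, K x⟩ : TangentBundle modelX Event)) s)
    {x : Event} (hx : x ∈ s) :
    ContDiffAt ℝ ∞ (chartField K x) (extChartAt modelX x x) := by
  have h1 : ContMDiffAt modelX modelX.tangent ∞
      (fun x => (⟨x, K x⟩ : TangentBundle modelX Event))
      ((extChartAt modelX x).symm (extChartAt modelX x x)) := by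
    rw [extChartAt_to_inv]
    exact hK.contMDiffAt (hs.mem_nhds hx)
  have h2 := ContMDiffAt.mpullback_vectorField_preimage (m := ∞) (n := ∞) h1
    (contMDiff_extChartAt_event_symm x _) (chartInvDeriv_isInvertible x _) (by simp)
  exact contMDiffAt_vectorSpace_iff_contDiffAt.1 h2

theorem contMDiffOn_mfderiv_apply {F : Type*} [NormedAddCommGroup F] [NormedSpace ℝ F]
    {f : Event → F} (hf : ContMDiff modelX 𝓘(ℝ, F) ∞ f) {K : (x : Event) → TX x} {s : Set Event}
    (hK : ContMDiffOn modelX modelX.tangent ∞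
      (fun x => (⟨x, K x⟩ : TangentBundle modelX Event)) s) :
    ContMDiffOn modelX 𝓘(ℝ, F) ∞ (fun x => (mfderiv modelX 𝓘(ℝ, F) f x (K x) : F)) s :=
  (contMDiff_snd_tangentBundle_modelSpace F 𝓘(ℝ, F)).comp_contMDiffOn
    ((hf.contMDiff_tangentMap (m := ∞) (by simp)).comp_contMDiffOn hK)

/-! ### Rotations and half-turns -/

theorem contMDiff_rotate (A : E3 ≃ₗᵢ[ℝ] E3) : ContMDiff modelX modelX ∞ (rotate A) := by
  have := fact_finrank_E3
  have h : ContMDiff modelX 𝓘(ℝ, E3) ∞ (fun x : Event => A (x.2 : E3)) :=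
    (A.contDiff.contMDiff).comp contMDiff_sphereProj
  exact contMDiff_fst.prodMk (h.codRestrict_sphere (fun x => by simp))

/-- The differential of a rotation. -/
def rotateDeriv (A : E3 ≃ₗᵢ[ℝ] E3) (x : Event) : EX →L[ℝ] EX :=
  mfderiv modelX modelX (rotate A) x

theorem rotateDeriv_fst (A : E3 ≃ₗᵢ[ℝ] E3) (x : Event) (v : EX) :
    (rotateDeriv A x v).1 = v.1 := by
  have h : mfderiv modelX 𝓘(ℝ, ℝ × ℝ) (Prod.fst ∘ rotate A) x =
      (mfderiv modelX 𝓘(ℝ, ℝ × ℝ) Prod.fst (rotate A x)).comp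
        (mfderiv modelX modelX (rotate A) x) :=
    mfderiv_comp x mdifferentiableAt_fst ((contMDiff_rotate A).mdifferentiable (by simp) x)
  have h2 : (Prod.fst ∘ rotate A) = (Prod.fst : Event → ℝ × ℝ) := rfl
  rw [h2, mfderiv_fst, mfderiv_fst] at h
  exact (congrArg (fun L : EX →L[ℝ] ℝ × ℝ => L v) h).symm

theorem sphereFrame_rotateDeriv (A : E3 ≃ₗᵢ[ℝ] E3) (x : Event) (v : EX) :
    sphereFrame (rotate A x).2 (rotateDeriv A x v).2 = A (sphereFrame x.2 v.2) := by
  rw [← mfderiv_sphereProj_apply, ← mfderiv_sphereProj_apply]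
  have hA : MDifferentiableAt 𝓘(ℝ, E3) 𝓘(ℝ, E3) A (sphereProj x) :=
    A.contDiff.differentiable (n := 1) (by simp) |>.mdifferentiable _
  have h : mfderiv modelX 𝓘(ℝ, E3) (sphereProj ∘ rotate A) x =
      (mfderiv modelX 𝓘(ℝ, E3) sphereProj (rotate A x)).comp
        (mfderiv modelX modelX (rotate A) x) :=
    mfderiv_comp x (contMDiff_sphereProj.mdifferentiable (by simp) _)
      ((contMDiff_rotate A).mdifferentiable (by simp) x)
  have h' : mfderiv modelX 𝓘(ℝ, E3) (A ∘ sphereProj) x =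
      (mfderiv 𝓘(ℝ, E3) 𝓘(ℝ, E3) A (sphereProj x)).comp
        (mfderiv modelX 𝓘(ℝ, E3) sphereProj x) :=
    mfderiv_comp x hA (contMDiff_sphereProj.mdifferentiable (by simp) _)
  have h2 : (sphereProj ∘ rotate A) = A ∘ sphereProj := rfl
  have h3 : fderiv ℝ A (sphereProj x) = (A.toContinuousLinearEquiv : E3 →L[ℝ] E3) :=
    A.toContinuousLinearEquiv.fderiv
  rw [mfderiv_eq_fderiv, h3] at h'
  rw [h2, h'] at h
  exact (congrArg (fun L : EX →L[ℝ] E3 => L v) h).symm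

/-- Reflection in a line of 3-space negates a plane, so it is a half-turn and belongs to SO(3). -/
theorem det_reflection_singleton (m : E3) (hm : m ≠ 0) :
    LinearMap.det ((ℝ ∙ m).reflection.toLinearEquiv : E3 →ₗ[ℝ] E3) = 1 := by
  have h := (ℝ ∙ m).det_reflection
  have h2 : Module.finrank ℝ (ℝ ∙ m)ᗮ = 2 := by
    have := fact_finrank_E3
    exact Submodule.finrank_orthogonal_span_singleton hm
  rw [h2] at h
  simpa using h

/-- The axis is p + q, or any direction orthogonal to p when q = -p. Transitivity of the rotations
on the sphere is used only in this form. -/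
theorem exists_halfTurn (p q : S2) : ∃ m : E3, m ≠ 0 ∧ (ℝ ∙ m).reflection (p : E3) = q := by
  by_cases h : (p : E3) + q = 0
  · obtain ⟨u, hu⟩ := exists_ne (0 : E2)
    refine ⟨sphereFrame p u, fun h0 => hu ((sphereFrame p).injective (by simpa using h0)), ?_⟩
    rw [Submodule.reflection_mem_subspace_orthogonalComplement_eq_neg]
    · exact (eq_neg_of_add_eq_zero_right h).symm
    · rw [Submodule.mem_orthogonal_singleton_iff_inner_left]
      exact inner_sphereFrame p u
  · refine ⟨p + q, h, ?_⟩
    have h1 : (ℝ ∙ ((p : E3) + q)).reflection ((p : E3) + q) = p + q :=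
      Submodule.reflection_mem_subspace_eq_self (Submodule.mem_span_singleton_self _)
    have h2 : (ℝ ∙ ((p : E3) + q)).reflection ((p : E3) - q) = -(p - q) := by
      apply Submodule.reflection_mem_subspace_orthogonalComplement_eq_neg
      rw [Submodule.mem_orthogonal_singleton_iff_inner_right]
      rw [real_inner_add_sub_eq_zero_iff]
      simp
    rw [map_add] at h1
    rw [map_sub] at h2
    have h3 : (2 : ℝ) • (ℝ ∙ ((p : E3) + q)).reflection (p : E3) = (2 : ℝ) • (q : E3) := by
      rw [two_smul, two_smul]
      have h4 := congrArg₂ (· + ·) h1 h2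
      convert h4 using 1 <;> abel
    exact smul_right_injective E3 two_ne_zero h3

/-! ### The diagonal form of a spherically symmetric metric -/

/-- The metric at `x`, on the model space. -/
def metricAt (g : BilinField modelX Event) (x : Event) : EX →L[ℝ] EX →L[ℝ] ℝ := g x

/-- The metric `g` is `-e^{2a} dt² + e^{2b} dr² + r² dσ²` on the region, with functions `a`, `b` of
`(t, r)` that are smooth on the rectangle. -/
structure HasDiagonalForm (t₀ t₁ r₀ r₁ : EReal) (g : BilinField modelX Event)
    (a b : ℝ × ℝ → ℝ) : Prop where
  smooth_a : ContDiffOn ℝ ∞ a (between t₀ t₁ ×ˢ between r₀ r₁)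
  smooth_b : ContDiffOn ℝ ∞ b (between t₀ t₁ ×ˢ between r₀ r₁)
  apply_eq : ∀ x ∈ region t₀ t₁ r₀ r₁, ∀ v w : EX, metricAt g x v w =
    -Real.exp (2 * a x.1) * (v.1.1 * w.1.1) + Real.exp (2 * b x.1) * (v.1.2 * w.1.2)
      + x.1.2 ^ 2 * inner ℝ v.2 w.2

theorem isOpen_rectangle (t₀ t₁ r₀ r₁ : EReal) : IsOpen (between t₀ t₁ ×ˢ between r₀ r₁) :=
  (isOpen_between t₀ t₁).prod (isOpen_between r₀ r₁)

theorem IsOrthonormalFrame.apply_eq {g : BilinField modelX Event} {x : Event}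
    {a : Module.Basis (Fin 4) ℝ (TX x)} (ha : IsOrthonormalFrame g x a) (i : Fin 4) (w : TX x) :
    g x (a i) w = lorentzSign i * a.coord i w := by
  conv_lhs => rw [← a.sum_repr w]
  rw [map_sum]
  simp only [map_smul, ha i, smul_eq_mul, Module.Basis.coord_apply]
  simp [mul_comm]

theorem IsOrthonormalFrame.sum_eq {g : BilinField modelX Event} {x : Event}
    {a : Module.Basis (Fin 4) ℝ (TX x)} (ha : IsOrthonormalFrame g x a) (v w : TX x) :
    g x v w = -(a.coord 0 v * a.coord 0 w) + a.coord 1 v * a.coord 1 w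
      + a.coord 2 v * a.coord 2 w + a.coord 3 v * a.coord 3 w := by
  conv_lhs => rw [← a.sum_repr v]
  rw [map_sum, sum_apply]
  simp only [map_smul, smul_apply, ha.apply_eq, smul_eq_mul]
  simp [Fin.sum_univ_four, lorentzSign]

theorem bilin_expand (B : EX →L[ℝ] EX →L[ℝ] ℝ) (v w : EX) :
    B v w = v.1.1 * w.1.1 * B ((1, 0), 0) ((1, 0), 0) + v.1.1 * w.1.2 * B ((1, 0), 0) ((0, 1), 0)
      + v.1.2 * w.1.1 * B ((0, 1), 0) ((1, 0), 0) + v.1.2 * w.1.2 * B ((0, 1), 0) ((0, 1), 0)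
      + B (v.1, 0) (0, w.2) + B (0, v.2) (w.1, 0) + B (0, v.2) (0, w.2) := by
  have h : ∀ v : EX, v = (v.1, 0) + (0, v.2) := fun v => by simp
  have h' : ∀ d : ℝ × ℝ, ((d, 0) : EX) = d.1 • ((1, 0), 0) + d.2 • ((0, 1), 0) := fun v => by simp
  conv_lhs => rw [h v, h w]
  simp only [map_add, add_apply]
  have h2 : B (v.1, 0) (w.1, 0) = v.1.1 * w.1.1 * B ((1, 0), 0) ((1, 0), 0)
      + v.1.1 * w.1.2 * B ((1, 0), 0) ((0, 1), 0)
      + v.1.2 * w.1.1 * B ((0, 1), 0) ((1, 0), 0) + v.1.2 * w.1.2 * B ((0, 1), 0) ((0, 1), 0) := by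
    rw [h' v.1, h' w.1]
    simp only [map_add, map_smul, add_apply, smul_apply, smul_eq_mul]
    ring
  rw [h2]
  ring

namespace IsSphericallySymmetric

variable {t₀ t₁ r₀ r₁ : EReal} {g : BilinField modelX Event}

theorem metricAt_rotate (hg : IsSphericallySymmetric t₀ t₁ r₀ r₁ g) {m : E3} (hm : m ≠ 0)
    {x : Event} (hx : x ∈ region t₀ t₁ r₀ r₁) (v w : EX) :
    metricAt g (rotate (ℝ ∙ m).reflection x) (rotateDeriv (ℝ ∙ m).reflection x v)
      (rotateDeriv (ℝ ∙ m).reflection x w) = metricAt g x v w :=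
  hg.rotation_invariant (ℝ ∙ m).reflection (det_reflection_singleton m hm) x hx v w

theorem base_apply_eq (hg : IsSphericallySymmetric t₀ t₁ r₀ r₁ g) {q : ℝ × ℝ}
    (hq : q ∈ between t₀ t₁ ×ˢ between r₀ r₁) (p p' : S2) (d e : ℝ × ℝ) :
    metricAt g (q, p') (d, 0) (e, 0) = metricAt g (q, p) (d, 0) (e, 0) := by
  obtain ⟨m, hm, hpm⟩ := exists_halfTurn p p'
  have h := hg.metricAt_rotate hm (x := (q, p)) hq (d, 0) (e, 0)
  have h1 : rotate (ℝ ∙ m).reflection (q, p) = (q, p') := Prod.ext rfl (Subtype.ext hpm)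
  have h2 : ∀ c : ℝ × ℝ, rotateDeriv (ℝ ∙ m).reflection (q, p) (c, 0) = (c, 0) := by
    intro c
    refine Prod.ext (rotateDeriv_fst _ _ _) ?_
    apply (sphereFrame (rotate (ℝ ∙ m).reflection (q, p)).2).injective
    rw [sphereFrame_rotateDeriv]
    simp
  rwa [h2, h2, h1] at h

/-- The half-turn about the axis through `x.2` fixes `x`, fixes base vectors and negates sphere
vectors, so invariance makes the mixed term equal to its own negative. -/
theorem mixed_apply_eq_zero (hg : IsSphericallySymmetric t₀ t₁ r₀ r₁ g) {x : Event}
    (hx : x ∈ region t₀ t₁ r₀ r₁) (d : ℝ × ℝ) (u : E2) :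
    metricAt g x (d, 0) (0, u) = 0 := by
  have hne : (x.2 : E3) ≠ 0 := ne_zero_of_mem_unit_sphere x.2
  have h := hg.metricAt_rotate hne hx (d, 0) (0, u)
  set A := (ℝ ∙ (x.2 : E3)).reflection
  have hA : A (x.2 : E3) = x.2 :=
    Submodule.reflection_mem_subspace_eq_self (Submodule.mem_span_singleton_self _)
  have h1 : rotate A x = x := Prod.ext rfl (Subtype.ext hA)
  have h2 : rotateDeriv A x (d, 0) = (d, 0) := by
    refine Prod.ext (rotateDeriv_fst _ _ _) ?_
    apply (sphereFrame (rotate A x).2).injective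
    rw [sphereFrame_rotateDeriv]
    simp
  have h4 : rotateDeriv A x (0, u) = -(0, u) := by
    refine Prod.ext ((rotateDeriv_fst _ _ _).trans (by simp)) ?_
    apply (sphereFrame (rotate A x).2).injective
    rw [sphereFrame_rotateDeriv, h1]
    simp only [Prod.snd_neg, map_neg]
    apply Submodule.reflection_mem_subspace_orthogonalComplement_eq_neg
    rw [Submodule.mem_orthogonal_singleton_iff_inner_right]
    exact inner_sphereFrame x.2 u
  rw [h2, h4, h1, map_neg] at h
  linarith

/-- A non-zero vector orthogonal to a time-like one is space-like. Otherwise the Cauchy-Schwarz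
inequality for the spatial components in an orthonormal frame forces its time component to vanish,
and then all the others. -/
theorem radial_pos (hg : IsSphericallySymmetric t₀ t₁ r₀ r₁ g) {x : Event}
    (hx : x ∈ region t₀ t₁ r₀ r₁) : 0 < g x (partialR x) (partialR x) := by
  obtain ⟨-, a, ha⟩ := hg.lorentzian x hx
  have h1 := hg.timelike x hx
  have h2 := hg.orthogonal x hx
  have h3 : partialR x ≠ 0 := by
    intro h
    have h' : (((0, 1), 0) : EX) = 0 := h
    simp at h'
  rw [ha.sum_eq] at h1 h2 ⊢
  have h4 : ¬ ∀ i, a.coord i (partialR x) = 0 := fun h => h3 (a.forall_coord_eq_zero_iff.1 h)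
  simp only [Fin.forall_fin_succ, IsEmpty.forall_iff, and_true] at h4
  change ¬(a.coord 0 (partialR x) = 0 ∧ a.coord 1 (partialR x) = 0 ∧ a.coord 2 (partialR x) = 0 ∧
    a.coord 3 (partialR x) = 0) at h4
  generalize a.coord 0 (partialR x) = w0, a.coord 1 (partialR x) = w1,
    a.coord 2 (partialR x) = w2, a.coord 3 (partialR x) = w3 at *
  generalize a.coord 0 (partialT x) = v0, a.coord 1 (partialT x) = v1,
    a.coord 2 (partialT x) = v2, a.coord 3 (partialT x) = v3 at *
  by_contra hneg
  have e1 : v1 ^ 2 + v2 ^ 2 + v3 ^ 2 < v0 ^ 2 := by nlinarith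
  have e2 : v0 * w0 = v1 * w1 + v2 * w2 + v3 * w3 := by linarith
  have e3 : w1 ^ 2 + w2 ^ 2 + w3 ^ 2 ≤ w0 ^ 2 := by nlinarith
  have e4 : (v0 * w0) ^ 2 ≤ (v1 ^ 2 + v2 ^ 2 + v3 ^ 2) * (w1 ^ 2 + w2 ^ 2 + w3 ^ 2) := by
    rw [e2]
    nlinarith [sq_nonneg (v1 * w2 - v2 * w1), sq_nonneg (v1 * w3 - v3 * w1),
      sq_nonneg (v2 * w3 - v3 * w2)]
  have e5 : (v1 ^ 2 + v2 ^ 2 + v3 ^ 2) * (w1 ^ 2 + w2 ^ 2 + w3 ^ 2)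
      ≤ (v1 ^ 2 + v2 ^ 2 + v3 ^ 2) * w0 ^ 2 := by gcongr
  have e6 : w0 = 0 := by
    by_contra hw
    have : 0 < w0 ^ 2 := by positivity
    nlinarith
  subst e6
  exact h4 ⟨rfl, by nlinarith [sq_nonneg w1, sq_nonneg w2, sq_nonneg w3],
    by nlinarith [sq_nonneg w1, sq_nonneg w2, sq_nonneg w3],
    by nlinarith [sq_nonneg w1, sq_nonneg w2, sq_nonneg w3]⟩

theorem exists_diagonalForm (hg : IsSphericallySymmetric t₀ t₁ r₀ r₁ g) :
    ∃ a b, HasDiagonalForm t₀ t₁ r₀ r₁ g a b := by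
  obtain ⟨p, hp⟩ : ∃ p : E3, ‖p‖ = 1 := exists_norm_eq E3 zero_le_one
  let p : S2 := ⟨p, by simpa using hp⟩
  have hA := contDiffOn_slice hg.smooth p (1, 0)
  have hB := contDiffOn_slice hg.smooth p (0, 1)
  have hApos : ∀ q ∈ between t₀ t₁ ×ˢ between r₀ r₁,
      0 < -metricAt g (q, p) ((1, 0), 0) ((1, 0), 0) :=
    fun q hq => neg_pos.2 (hg.timelike (q, p) hq)
  have hBpos : ∀ q ∈ between t₀ t₁ ×ˢ between r₀ r₁,
      0 < metricAt g (q, p) ((0, 1), 0) ((0, 1), 0) :=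
    fun q hq => hg.radial_pos (x := (q, p)) hq
  refine ⟨fun q => Real.log (-metricAt g (q, p) ((1, 0), 0) ((1, 0), 0)) / 2,
    fun q => Real.log (metricAt g (q, p) ((0, 1), 0) ((0, 1), 0)) / 2, ?_, ?_, ?_⟩
  · exact (hA.neg.log fun q hq => (hApos q hq).ne').div_const 2
  · exact (hB.log fun q hq => (hBpos q hq).ne').div_const 2
  · intro x hx v w
    have hq : x.1 ∈ between t₀ t₁ ×ˢ between r₀ r₁ := hx
    have e1 : ∀ y : ℝ, 2 * (y / 2) = y := fun y => by ring
    simp only [e1]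
    rw [Real.exp_log (hApos x.1 hq), Real.exp_log (hBpos x.1 hq),
      ← hg.base_apply_eq hq p x.2, ← hg.base_apply_eq hq p x.2]
    have hsymm : ∀ v w, metricAt g x v w = metricAt g x w v := (hg.lorentzian x hx).1
    have h1 : metricAt g x ((1, 0), 0) ((0, 1), 0) = 0 := hg.orthogonal x hx
    have h5 : metricAt g x (0, v.2) (0, w.2) = x.1.2 ^ 2 * inner ℝ v.2 w.2 := by
      have h := hg.orbit_metric x hx ((0, v.2) : EX) ((0, w.2) : EX) (differential_tCoord _ _)
        (differential_rCoord _ _) (differential_tCoord _ _) (differential_rCoord _ _)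
      rw [roundMetric_apply] at h
      exact h
    rw [bilin_expand (metricAt g x) v w, hsymm ((0, 1), 0) ((1, 0), 0), h1,
      hg.mixed_apply_eq_zero hx, hsymm (0, v.2) (w.1, 0), hg.mixed_apply_eq_zero hx, h5]
    ring

end IsSphericallySymmetric

/-! ### Christoffel symbols and Ricci tensor of a diagonal metric -/

/-- The partial derivative with respect to the first variable. -/
def dt (f : ℝ × ℝ → ℝ) (q : ℝ × ℝ) : ℝ := fderiv ℝ f q (1, 0)

/-- The partial derivative with respect to the second variable. -/
def dr (f : ℝ × ℝ → ℝ) (q : ℝ × ℝ) : ℝ := fderiv ℝ f q (0, 1)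

theorem fderiv_eq_dt_add_dr (f : ℝ × ℝ → ℝ) (q z : ℝ × ℝ) :
    fderiv ℝ f q z = dt f q * z.1 + dr f q * z.2 := by
  have h : z = z.1 • (1, 0) + z.2 • (0, 1) := by simp
  conv_lhs => rw [h]
  simp only [map_add, map_smul, smul_eq_mul, dt, dr]
  ring

theorem contDiffOn_dt {f : ℝ × ℝ → ℝ} {O : Set (ℝ × ℝ)} (hO : IsOpen O)
    (hf : ContDiffOn ℝ ∞ f O) : ContDiffOn ℝ ∞ (dt f) O :=
  (hf.fderiv_of_isOpen hO (m := ∞) (by simp)).clm_apply contDiffOn_const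

theorem contDiffOn_dr {f : ℝ × ℝ → ℝ} {O : Set (ℝ × ℝ)} (hO : IsOpen O)
    (hf : ContDiffOn ℝ ∞ f O) : ContDiffOn ℝ ∞ (dr f) O :=
  (hf.fderiv_of_isOpen hO (m := ∞) (by simp)).clm_apply contDiffOn_const

theorem dr_dt_eq_dt_dr {f : ℝ × ℝ → ℝ} {O : Set (ℝ × ℝ)} (hO : IsOpen O)
    (hf : ContDiffOn ℝ ∞ f O) {q : ℝ × ℝ} (hq : q ∈ O) : dr (dt f) q = dt (dr f) q := by
  have h1 : DifferentiableAt ℝ (fderiv ℝ f) q :=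
    ((hf.fderiv_of_isOpen hO (m := ∞) (by simp)).contDiffAt (hO.mem_nhds hq)).differentiableAt
      (by simp)
  have h2 : IsSymmSndFDerivAt ℝ f q :=
    (hf.contDiffAt (hO.mem_nhds hq)).isSymmSndFDerivAt (by simpa using ENat.LEInfty.out)
  have h3 : ∀ d e : ℝ × ℝ, fderiv ℝ (fun q => fderiv ℝ f q d) q e = fderiv ℝ (fderiv ℝ f) q e d := by
    intro d e
    rw [fderiv_clm_apply h1 (differentiableAt_const d)]
    simp
  exact (h3 _ _).trans ((h2 _ _).trans (h3 _ _).symm)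

/-- The diagonal metric `-e^{2a} dt² + e^{2b} dr² + r² F |du|²` in a coordinate domain, where `F`
is the conformal factor of the stereographic chart. -/
structure IsDiagonalOn (G : EX → EX →L[ℝ] EX →L[ℝ] ℝ) (a b : ℝ × ℝ → ℝ) (O : Set (ℝ × ℝ)) :
    Prop where
  isOpen : IsOpen O
  smooth_a : ContDiffOn ℝ ∞ a O
  smooth_b : ContDiffOn ℝ ∞ b O
  radius_ne : ∀ q ∈ O, q.2 ≠ 0
  apply_eq : ∀ y : EX, y.1 ∈ O → ∀ v w, G y v w =
    -Real.exp (2 * a y.1) * (v.1.1 * w.1.1) + Real.exp (2 * b y.1) * (v.1.2 * w.1.2)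
      + y.1.2 ^ 2 * conformalFactor y.2 * inner ℝ v.2 w.2

theorem contDiff_conformalFactor : ContDiff ℝ ∞ conformalFactor := by
  have h₀ : ContDiff ℝ ∞ fun w : E2 => ‖w‖ ^ 2 := contDiff_norm_sq ℝ
  exact contDiff_const.div ((h₀.add contDiff_const).pow 2) fun x => by positivity

theorem hasFDerivAt_conformalFactor (u : E2) :
    HasFDerivAt conformalFactor ((-64 / (‖u‖ ^ 2 + 4) ^ 3) • innerSL ℝ u) u := by
  have h0 : HasFDerivAt (fun w : E2 => ‖w‖ ^ 2) _ u := (hasStrictFDerivAt_norm_sq u).hasFDerivAt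
  have hne : ‖u‖ ^ 2 + 4 ≠ 0 := by positivity
  have h1 : HasDerivAt (fun s : ℝ => 16 / (s + 4) ^ 2) (-32 / (‖u‖ ^ 2 + 4) ^ 3) (‖u‖ ^ 2) := by
    have h2 := ((((hasDerivAt_id (‖u‖ ^ 2)).add_const 4).pow 2).inv (by simpa using hne)).const_mul 16
    simp only [id] at h2
    refine (h2.congr_deriv ?_).congr_of_eventuallyEq (Filter.Eventually.of_forall fun s => ?_)
    · simp
      field_simp
      norm_num
    · simp [div_eq_mul_inv]
  refine (h1.comp_hasFDerivAt u h0).congr_fderiv ?_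
  ext z
  simp
  ring

namespace IsDiagonalOn

variable {G : EX → EX →L[ℝ] EX →L[ℝ] ℝ} {a b : ℝ × ℝ → ℝ} {O : Set (ℝ × ℝ)}

theorem isOpen_preimage (hG : IsDiagonalOn G a b O) : IsOpen {y : EX | y.1 ∈ O} :=
  hG.isOpen.preimage continuous_fst

theorem contDiffOn (hG : IsDiagonalOn G a b O) : ContDiffOn ℝ ∞ G {y : EX | y.1 ∈ O} := by
  rw [contDiffOn_clm_apply]
  intro v
  rw [contDiffOn_clm_apply]
  intro w
  have h1 : ContDiffOn ℝ ∞ (fun y : EX => a y.1) {y : EX | y.1 ∈ O} :=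
    hG.smooth_a.comp contDiffOn_fst fun y hy => hy
  have h2 : ContDiffOn ℝ ∞ (fun y : EX => b y.1) {y : EX | y.1 ∈ O} :=
    hG.smooth_b.comp contDiffOn_fst fun y hy => hy
  have h3 : ContDiffOn ℝ ∞ (fun y : EX => conformalFactor y.2) {y : EX | y.1 ∈ O} :=
    (contDiff_conformalFactor.comp contDiff_snd).contDiffOn
  refine ContDiffOn.congr ?_ fun y hy => hG.apply_eq y hy v w
  exact (((contDiffOn_const.mul h1).exp.neg.mul contDiffOn_const).add
    ((contDiffOn_const.mul h2).exp.mul contDiffOn_const)).add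
    (((contDiff_snd.comp contDiff_fst).contDiffOn.pow 2).mul h3 |>.mul contDiffOn_const)

theorem differentiableAt_fst {f : ℝ × ℝ → ℝ} (hO : IsOpen O) (hf : ContDiffOn ℝ ∞ f O) {q : ℝ × ℝ}
    (hq : q ∈ O) : DifferentiableAt ℝ f q :=
  (hf.contDiffAt (hO.mem_nhds hq)).differentiableAt (by simp)

theorem fderiv_apply (hG : IsDiagonalOn G a b O) {y : EX} (hy : y.1 ∈ O) (z v w : EX) :
    fderiv ℝ G y z v w =
      -(2 * (dt a y.1 * z.1.1 + dr a y.1 * z.1.2)) * Real.exp (2 * a y.1) * (v.1.1 * w.1.1)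
      + 2 * (dt b y.1 * z.1.1 + dr b y.1 * z.1.2) * Real.exp (2 * b y.1) * (v.1.2 * w.1.2)
      + (2 * y.1.2 * z.1.2 * conformalFactor y.2
        - y.1.2 ^ 2 * (64 * inner ℝ y.2 z.2 / (‖y.2‖ ^ 2 + 4) ^ 3)) * inner ℝ v.2 w.2 := by
  have hd : DifferentiableAt ℝ G y :=
    (hG.contDiffOn.contDiffAt (hG.isOpen_preimage.mem_nhds hy)).differentiableAt (by simp)
  have h0 : fderiv ℝ G y z v w = fderiv ℝ (fun y => G y v w) y z := by
    have h1 : fderiv ℝ (fun y => G y v) y z = fderiv ℝ G y z v := by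
      rw [fderiv_clm_apply hd (differentiableAt_const v)]
      simp
    rw [fderiv_clm_apply (hd.clm_apply (differentiableAt_const v)) (differentiableAt_const w)]
    simp [h1]
  have ha := ((differentiableAt_fst hG.isOpen hG.smooth_a hy).hasFDerivAt.comp y
    (hasFDerivAt_fst (𝕜 := ℝ) (E := ℝ × ℝ) (F := E2))).const_mul 2
  have hb := ((differentiableAt_fst hG.isOpen hG.smooth_b hy).hasFDerivAt.comp y
    (hasFDerivAt_fst (𝕜 := ℝ) (E := ℝ × ℝ) (F := E2))).const_mul 2
  have hF := (hasFDerivAt_conformalFactor y.2).comp y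
    (hasFDerivAt_snd (𝕜 := ℝ) (E := ℝ × ℝ) (F := E2))
  have hr : HasFDerivAt (fun y : EX => y.1.2)
      ((ContinuousLinearMap.snd ℝ ℝ ℝ).comp (ContinuousLinearMap.fst ℝ (ℝ × ℝ) E2)) y :=
    hasFDerivAt_snd.comp y hasFDerivAt_fst
  have h2 := ((ha.exp.neg.mul_const (v.1.1 * w.1.1)).add (hb.exp.mul_const (v.1.2 * w.1.2))).add
    (((hr.pow 2).mul hF).mul_const (inner ℝ v.2 w.2))
  have h3 : HasFDerivAt (fun y => G y v w) _ y := h2.congr_of_eventuallyEq (by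
    filter_upwards [hG.isOpen_preimage.mem_nhds hy] with y' hy'
    rw [hG.apply_eq y' hy']
    rfl)
  rw [h0, h3.fderiv]
  simp [fderiv_eq_dt_add_dr]
  ring

end IsDiagonalOn

theorem isInvertible_of_injective {B : EX →L[ℝ] EX →L[ℝ] ℝ} (hB : Function.Injective B) :
    B.IsInvertible := by
  have hdim : Module.finrank ℝ EX = Module.finrank ℝ (EX →L[ℝ] ℝ) := by
    rw [(LinearMap.toContinuousLinearMap : (EX →ₗ[ℝ] ℝ) ≃ₗ[ℝ] (EX →L[ℝ] ℝ)).symm.finrank_eq]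
    exact (Subspace.dual_finrank_eq (K := ℝ) (V := EX)).symm
  exact ⟨(LinearMap.linearEquivOfInjective (B : EX →ₗ[ℝ] EX →L[ℝ] ℝ) hB
    hdim).toContinuousLinearEquiv, ContinuousLinearMap.ext fun _ => rfl⟩

/-- `inverse` is zero by convention on non-invertible maps, so non-degeneracy must be established
first. After that an index is raised by guessing the vector and checking it, without inverting a
matrix. -/
theorem inverse_apply_eq {B : EX →L[ℝ] EX →L[ℝ] ℝ} (hB : Function.Injective B) {l : EX →L[ℝ] ℝ}
    {v : EX} (h : ∀ w, B v w = l w) : B.inverse l = v := by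
  obtain ⟨e, he⟩ := isInvertible_of_injective hB
  have h1 : B v = l := ContinuousLinearMap.ext h
  rw [← h1, ← he, ContinuousLinearMap.inverse_equiv]
  exact e.symm_apply_apply v

theorem injective_of_diagonal {B : EX →L[ℝ] EX →L[ℝ] ℝ} {α β ρ : ℝ} (hα : 0 < α) (hβ : 0 < β)
    (hρ : 0 < ρ) (h : ∀ v w, B v w = -α * (v.1.1 * w.1.1) + β * (v.1.2 * w.1.2)
      + ρ * inner ℝ v.2 w.2) : Function.Injective B := by
  rw [injective_iff_map_eq_zero]
  intro v hv
  -- Pairing with the time-reversed vector turns the Lorentzian form into a sum of three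
  -- non-negative terms.
  have h1 := h v ((-v.1.1, v.1.2), v.2)
  rw [hv] at h1
  simp only [zero_apply, real_inner_self_eq_norm_sq] at h1
  have e1 : 0 ≤ α * v.1.1 ^ 2 := by positivity
  have e2 : 0 ≤ β * v.1.2 ^ 2 := by positivity
  have e3 : 0 ≤ ρ * ‖v.2‖ ^ 2 := by positivity
  have f1 : v.1.1 = 0 := by
    have : α * v.1.1 ^ 2 = 0 := by nlinarith
    simpa [hα.ne'] using this
  have f2 : v.1.2 = 0 := by
    have : β * v.1.2 ^ 2 = 0 := by nlinarith
    simpa [hβ.ne'] using this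
  have f3 : v.2 = 0 := by
    have : ρ * ‖v.2‖ ^ 2 = 0 := by nlinarith
    simpa [hρ.ne'] using this
  exact Prod.ext (Prod.ext f1 f2) f3

/-- The Christoffel symbols of the metric `-e^{2a} dt² + e^{2b} dr² + r² F |du|²`. -/
def diagChristoffel (a b : ℝ × ℝ → ℝ) (y v w : EX) : EX :=
  ((dt a y.1 * (v.1.1 * w.1.1) + dr a y.1 * (v.1.1 * w.1.2 + v.1.2 * w.1.1)
      + dt b y.1 * Real.exp (2 * (b y.1 - a y.1)) * (v.1.2 * w.1.2),
    dr a y.1 * Real.exp (2 * (a y.1 - b y.1)) * (v.1.1 * w.1.1)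
      + dt b y.1 * (v.1.1 * w.1.2 + v.1.2 * w.1.1) + dr b y.1 * (v.1.2 * w.1.2)
      - y.1.2 * Real.exp (-2 * b y.1) * conformalFactor y.2 * inner ℝ v.2 w.2),
    (y.1.2)⁻¹ • (v.1.2 • w.2 + w.1.2 • v.2)
      - (2 / (‖y.2‖ ^ 2 + 4)) • (inner ℝ y.2 v.2 • w.2 + inner ℝ y.2 w.2 • v.2
        - inner ℝ v.2 w.2 • y.2))

namespace IsDiagonalOn

variable {G : EX → EX →L[ℝ] EX →L[ℝ] ℝ} {a b : ℝ × ℝ → ℝ} {O : Set (ℝ × ℝ)}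

theorem injective (hG : IsDiagonalOn G a b O) {y : EX} (hy : y.1 ∈ O) :
    Function.Injective (G y) := by
  have h1 := hG.radius_ne y.1 hy
  have h2 := conformalFactor_pos y.2
  exact injective_of_diagonal (Real.exp_pos _) (Real.exp_pos _) (by positivity) (hG.apply_eq y hy)

theorem christoffel_eq (hG : IsDiagonalOn G a b O) {y : EX} (hy : y.1 ∈ O) (v w : EX) :
    christoffel G y v w = diagChristoffel a b y v w := by
  rw [christoffel_apply]
  refine inverse_apply_eq (hG.injective hy) fun z => ?_
  rw [hG.apply_eq y hy, christoffelLower_apply, hG.fderiv_apply hy, hG.fderiv_apply hy,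
    hG.fderiv_apply hy]
  have h1 := hG.radius_ne y.1 hy
  have hne : ‖y.2‖ ^ 2 + 4 ≠ 0 := by positivity
  have ea : Real.exp (2 * a y.1) ≠ 0 := (Real.exp_pos _).ne'
  have eb : Real.exp (2 * b y.1) ≠ 0 := (Real.exp_pos _).ne'
  simp only [diagChristoffel, inner_sub_left, inner_add_left, inner_smul_left, mul_sub, neg_mul,
    Real.exp_sub, Real.exp_neg, RCLike.conj_to_real, conformalFactor]
  generalize inner ℝ v.2 w.2 = i1, inner ℝ v.2 z.2 = i2, inner ℝ w.2 z.2 = i3,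
    inner ℝ y.2 v.2 = i4, inner ℝ y.2 w.2 = i5, inner ℝ y.2 z.2 = i6
  generalize Real.exp (2 * a y.1) = A at *
  generalize Real.exp (2 * b y.1) = B at *
  field_simp
  ring

theorem contDiffOn_comp_fst {f : ℝ × ℝ → ℝ} (hf : ContDiffOn ℝ ∞ f O) :
    ContDiffOn ℝ ∞ (fun y : EX => f y.1) {y : EX | y.1 ∈ O} :=
  hf.comp contDiffOn_fst fun _ hy => hy

theorem contDiffOn_christoffel (hG : IsDiagonalOn G a b O) :
    ContDiffOn ℝ ∞ (christoffel G) {y : EX | y.1 ∈ O} := by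
  rw [contDiffOn_clm_apply]
  intro v
  rw [contDiffOn_clm_apply]
  intro w
  refine ContDiffOn.congr ?_ fun y hy => hG.christoffel_eq hy v w
  have ha := contDiffOn_comp_fst hG.smooth_a
  have hb := contDiffOn_comp_fst hG.smooth_b
  have hat := contDiffOn_comp_fst (contDiffOn_dt hG.isOpen hG.smooth_a)
  have har := contDiffOn_comp_fst (contDiffOn_dr hG.isOpen hG.smooth_a)
  have hbt := contDiffOn_comp_fst (contDiffOn_dt hG.isOpen hG.smooth_b)
  have hbr := contDiffOn_comp_fst (contDiffOn_dr hG.isOpen hG.smooth_b)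
  have hr : ContDiffOn ℝ ∞ (fun y : EX => y.1.2) {y : EX | y.1 ∈ O} :=
    (contDiff_snd.comp contDiff_fst).contDiffOn
  have hF : ContDiffOn ℝ ∞ (fun y : EX => conformalFactor y.2) {y : EX | y.1 ∈ O} :=
    (contDiff_conformalFactor.comp contDiff_snd).contDiffOn
  have hu : ContDiffOn ℝ ∞ (fun y : EX => y.2) {y : EX | y.1 ∈ O} := contDiff_snd.contDiffOn
  have hn : ContDiffOn ℝ ∞ (fun y : EX => 2 / (‖y.2‖ ^ 2 + 4)) {y : EX | y.1 ∈ O} :=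
    contDiffOn_const.div ((hu.norm_sq ℝ).add contDiffOn_const) fun y _ => by positivity
  refine ((((hat.mul contDiffOn_const).add (har.mul contDiffOn_const)).add
    ((hbt.mul (contDiffOn_const.mul (hb.sub ha)).exp).mul contDiffOn_const)).prodMk
    (((((har.mul (contDiffOn_const.mul (ha.sub hb)).exp).mul contDiffOn_const).add
      (hbt.mul contDiffOn_const)).add (hbr.mul contDiffOn_const)).sub
      (((hr.mul (contDiffOn_const.mul hb).exp).mul hF).mul contDiffOn_const))).prodMk ?_
  exact ((hr.inv fun y hy => hG.radius_ne _ hy).smul contDiffOn_const).sub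
    (hn.smul (((((hu.inner ℝ contDiffOn_const).smul contDiffOn_const)).add
      ((hu.inner ℝ contDiffOn_const).smul contDiffOn_const)).sub (hu.const_smul (inner ℝ v.2 w.2))))

theorem hasFDerivAt_comp_fst {f : ℝ × ℝ → ℝ} (hO : IsOpen O) (hf : ContDiffOn ℝ ∞ f O) {y : EX}
    (hy : y.1 ∈ O) : HasFDerivAt (fun y : EX => f y.1)
      ((fderiv ℝ f y.1).comp (ContinuousLinearMap.fst ℝ (ℝ × ℝ) E2)) y :=
  (differentiableAt_fst hO hf hy).hasFDerivAt.comp y hasFDerivAt_fst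

/-- The derivative is needed only at sphere coordinate 0, the point at which `ricci` is evaluated.
There the conformal factor is 1 with zero differential, which keeps the formula finite in size. -/
theorem fderiv_christoffel (hG : IsDiagonalOn G a b O) {q : ℝ × ℝ} (hq : q ∈ O) (z v w : EX) :
    fderiv ℝ (christoffel G) (q, 0) z v w =
    (((dt (dt a) q * z.1.1 + dr (dt a) q * z.1.2) * (v.1.1 * w.1.1)
        + (dt (dr a) q * z.1.1 + dr (dr a) q * z.1.2) * (v.1.1 * w.1.2 + v.1.2 * w.1.1)
        + ((dt (dt b) q * z.1.1 + dr (dt b) q * z.1.2) + dt b q * (2 *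
            ((dt b q * z.1.1 + dr b q * z.1.2) - (dt a q * z.1.1 + dr a q * z.1.2))))
          * Real.exp (2 * (b q - a q)) * (v.1.2 * w.1.2),
      ((dt (dr a) q * z.1.1 + dr (dr a) q * z.1.2) + dr a q * (2 *
            ((dt a q * z.1.1 + dr a q * z.1.2) - (dt b q * z.1.1 + dr b q * z.1.2))))
          * Real.exp (2 * (a q - b q)) * (v.1.1 * w.1.1)
        + (dt (dt b) q * z.1.1 + dr (dt b) q * z.1.2) * (v.1.1 * w.1.2 + v.1.2 * w.1.1)
        + (dt (dr b) q * z.1.1 + dr (dr b) q * z.1.2) * (v.1.2 * w.1.2)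
        - (z.1.2 - 2 * q.2 * (dt b q * z.1.1 + dr b q * z.1.2)) * Real.exp (-2 * b q)
          * inner ℝ v.2 w.2),
      -(z.1.2 / q.2 ^ 2) • (v.1.2 • w.2 + w.1.2 • v.2)
        - (1 / 2 : ℝ) • (inner ℝ z.2 v.2 • w.2 + inner ℝ z.2 w.2 • v.2
          - inner ℝ v.2 w.2 • z.2)) := by
  have hy : ((q, 0) : EX).1 ∈ O := hq
  have hd : DifferentiableAt ℝ (christoffel G) (q, 0) :=
    (hG.contDiffOn_christoffel.contDiffAt (hG.isOpen_preimage.mem_nhds hy)).differentiableAt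
      (by simp)
  have h0 : fderiv ℝ (christoffel G) (q, 0) z v w =
      fderiv ℝ (fun y => christoffel G y v w) (q, 0) z := by
    have h1 : fderiv ℝ (fun y => christoffel G y v) (q, 0) z
        = fderiv ℝ (christoffel G) (q, 0) z v := by
      rw [fderiv_clm_apply hd (differentiableAt_const v)]
      simp
    rw [fderiv_clm_apply (hd.clm_apply (differentiableAt_const v)) (differentiableAt_const w)]
    simp [h1]
  have ha := hasFDerivAt_comp_fst hG.isOpen hG.smooth_a hy
  have hb := hasFDerivAt_comp_fst hG.isOpen hG.smooth_b hy
  have hat := hasFDerivAt_comp_fst hG.isOpen (contDiffOn_dt hG.isOpen hG.smooth_a) hy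
  have har := hasFDerivAt_comp_fst hG.isOpen (contDiffOn_dr hG.isOpen hG.smooth_a) hy
  have hbt := hasFDerivAt_comp_fst hG.isOpen (contDiffOn_dt hG.isOpen hG.smooth_b) hy
  have hbr := hasFDerivAt_comp_fst hG.isOpen (contDiffOn_dr hG.isOpen hG.smooth_b) hy
  have hF : HasFDerivAt (fun y : EX => conformalFactor y.2) _ (q, 0) :=
    HasFDerivAt.comp (g := conformalFactor) ((q, 0) : EX) (hasFDerivAt_conformalFactor 0)
      hasFDerivAt_snd
  have hr : HasFDerivAt (fun y : EX => y.1.2)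
      ((ContinuousLinearMap.snd ℝ ℝ ℝ).comp (ContinuousLinearMap.fst ℝ (ℝ × ℝ) E2)) (q, 0) :=
    hasFDerivAt_snd.comp ((q, 0) : EX) hasFDerivAt_fst
  have hu : HasFDerivAt (fun y : EX => y.2) (ContinuousLinearMap.snd ℝ (ℝ × ℝ) E2) (q, 0) :=
    hasFDerivAt_snd
  have hne : ‖((q, 0) : EX).2‖ ^ 2 + 4 ≠ 0 := by positivity
  have hn : HasFDerivAt (fun y : EX => 2 * (‖y.2‖ ^ 2 + 4)⁻¹) _ (q, 0) :=
    ((hasDerivAt_inv hne).comp_hasFDerivAt (q, 0) ((hu.norm_sq).add_const 4)).const_mul 2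
  have hri : HasFDerivAt (fun y : EX => (y.1.2)⁻¹) _ (q, 0) :=
    (hasDerivAt_inv (hG.radius_ne q hq)).comp_hasFDerivAt (q, 0) hr
  have hv := hu.inner ℝ (hasFDerivAt_const v.2 ((q, 0) : EX))
  have hw := hu.inner ℝ (hasFDerivAt_const w.2 ((q, 0) : EX))
  have h2 := ((((hat.mul_const (v.1.1 * w.1.1)).add
      (har.mul_const (v.1.1 * w.1.2 + v.1.2 * w.1.1))).add
    ((hbt.mul ((hb.sub ha).const_mul 2).exp).mul_const (v.1.2 * w.1.2))).prodMk
    (((((har.mul ((ha.sub hb).const_mul 2).exp).mul_const (v.1.1 * w.1.1)).add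
      (hbt.mul_const (v.1.1 * w.1.2 + v.1.2 * w.1.1))).add (hbr.mul_const (v.1.2 * w.1.2))).sub
      (((hr.mul (hb.const_mul (-2)).exp).mul hF).mul_const (inner ℝ v.2 w.2)))).prodMk
    ((hri.smul_const (v.1.2 • w.2 + w.1.2 • v.2)).sub
      (hn.smul (((hv.smul_const w.2).add (hw.smul_const v.2)).sub
        (hu.const_smul (inner ℝ v.2 w.2)))))
  have h3 : HasFDerivAt (fun y => christoffel G y v w) _ (q, 0) := h2.congr_of_eventuallyEq (by
    filter_upwards [hG.isOpen_preimage.mem_nhds hy] with y' hy'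
    rw [hG.christoffel_eq hy']
    rfl)
  rw [h0, h3.fderiv]
  refine Prod.ext (Prod.ext ?_ ?_) ?_
  · simp [fderiv_eq_dt_add_dr]
    ring
  · simp [fderiv_eq_dt_add_dr, conformalFactor_zero]
    ring
  · simp
    module

end IsDiagonalOn

/-- The coordinate basis of the model space. -/
def basisEX : Module.Basis ((Unit ⊕ Unit) ⊕ Fin 2) ℝ EX :=
  ((Module.Basis.singleton Unit ℝ).prod (Module.Basis.singleton Unit ℝ)).prod
    (EuclideanSpace.basisFun (Fin 2) ℝ).toBasis

theorem trace_EX (f : EX →ₗ[ℝ] EX) :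
    LinearMap.trace ℝ EX f = (f ((1, 0), 0)).1.1 + (f ((0, 1), 0)).1.2
      + (f (0, EuclideanSpace.single 0 1)).2 0 + (f (0, EuclideanSpace.single 1 1)).2 1 := by
  rw [LinearMap.trace_eq_matrix_trace ℝ basisEX, Matrix.trace]
  simp [basisEX, LinearMap.toMatrix_apply, Fintype.sum_sum_type, Fin.sum_univ_two]
  ring

theorem ricciCoord_apply (G : EX → EX →L[ℝ] EX →L[ℝ] ℝ) (y v w : EX) :
    ricciCoord G y v w = LinearMap.trace ℝ EX (curvature G y v w : EX →ₗ[ℝ] EX) := rfl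

theorem inner_E2 (u v : E2) : inner ℝ u v = u 0 * v 0 + u 1 * v 1 := by
  simp [PiLp.inner_apply, Fin.sum_univ_two]
  ring

namespace IsDiagonalOn

variable {G : EX → EX →L[ℝ] EX →L[ℝ] ℝ} {a b : ℝ × ℝ → ℝ} {O : Set (ℝ × ℝ)}

/-- The trace is taken over the coordinate basis. The mixed term 2 b_t / r is what later forces b to
be independent of time; equality of mixed second derivatives removes the remaining cross terms. -/
theorem ricciCoord_eq (hG : IsDiagonalOn G a b O) {q : ℝ × ℝ} (hq : q ∈ O) (v w : EX) :
    ricciCoord G (q, 0) v w =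
      (Real.exp (2 * (a q - b q)) *
          (dr (dr a) q + dr a q ^ 2 - dr a q * dr b q + 2 * dr a q / q.2)
        - (dt (dt b) q + dt b q ^ 2 - dt a q * dt b q)) * (v.1.1 * w.1.1)
      + 2 * dt b q / q.2 * (v.1.1 * w.1.2 + v.1.2 * w.1.1)
      + (Real.exp (2 * (b q - a q)) * (dt (dt b) q + dt b q ^ 2 - dt a q * dt b q)
        - (dr (dr a) q + dr a q ^ 2 - dr a q * dr b q - 2 * dr b q / q.2)) * (v.1.2 * w.1.2)
      + (Real.exp (-2 * b q) * (q.2 * (dr b q - dr a q) - 1) + 1) * inner ℝ v.2 w.2 := by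
  have hy : ((q, 0) : EX).1 ∈ O := hq
  rw [ricciCoord_apply, trace_EX]
  simp only [ContinuousLinearMap.coe_coe, curvature_apply, hG.fderiv_christoffel hq]
  simp only [hG.christoffel_eq hy, diagChristoffel]
  have h1 := hG.radius_ne q hq
  have ea : Real.exp (2 * a q) ≠ 0 := (Real.exp_pos _).ne'
  have eb : Real.exp (2 * b q) ≠ 0 := (Real.exp_pos _).ne'
  have hA := dr_dt_eq_dt_dr hG.isOpen hG.smooth_a hq
  have hB := dr_dt_eq_dt_dr hG.isOpen hG.smooth_b hq
  simp only [inner_E2, conformalFactor_zero, mul_sub, neg_mul, Real.exp_sub, Real.exp_neg, hA, hB]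
  simp
  generalize Real.exp (2 * a q) = A at *
  generalize Real.exp (2 * b q) = B at *
  field_simp
  ring

end IsDiagonalOn

/-! ### The stress-energy tensor in Birkhoff frames -/

theorem pos_of_mem_between {r₀ r₁ : EReal} (hr₀ : 0 ≤ r₀) {r : ℝ} (hr : r ∈ between r₀ r₁) :
    0 < r := by
  have h := lt_of_le_of_lt hr₀ hr.1
  exact_mod_cast h

/-- The Ricci tensor at `x`, on the model space. -/
def ricciAt (g : BilinField modelX Event) (x : Event) : EX →ₗ[ℝ] EX →ₗ[ℝ] ℝ := ricci g x

namespace HasDiagonalForm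

variable {t₀ t₁ r₀ r₁ : EReal} {g : BilinField modelX Event} {a b : ℝ × ℝ → ℝ}

theorem isDiagonalOn (hg : HasDiagonalForm t₀ t₁ r₀ r₁ g a b) (hr₀ : 0 ≤ r₀) (x : Event) :
    IsDiagonalOn (chartMetric g x) a b (between t₀ t₁ ×ˢ between r₀ r₁) where
  isOpen := isOpen_rectangle _ _ _ _
  smooth_a := hg.smooth_a
  smooth_b := hg.smooth_b
  radius_ne q hq := (pos_of_mem_between hr₀ hq.2).ne'
  apply_eq y hy v w := by
    have h1 : ((extChartAt modelX x).symm y).1 = y.1 := by rw [extChartAt_event_symm]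
    have hx : (extChartAt modelX x).symm y ∈ region t₀ t₁ r₀ r₁ := by
      have : ((extChartAt modelX x).symm y).1 ∈ between t₀ t₁ ×ˢ between r₀ r₁ := by rwa [h1]
      exact this
    have h2 := hg.apply_eq _ hx (chartInvDeriv x y v) (chartInvDeriv x y w)
    rw [inner_chartInvDeriv, chartInvDeriv_fst, chartInvDeriv_fst, h1] at h2
    rw [chartMetric_apply]
    refine Eq.trans h2 ?_
    ring

theorem ricciAt_eq (hg : HasDiagonalForm t₀ t₁ r₀ r₁ g a b) (hr₀ : 0 ≤ r₀) {x : Event}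
    (hx : x ∈ region t₀ t₁ r₀ r₁) (v w : EX) :
    ricciAt g x v w =
      (Real.exp (2 * (a x.1 - b x.1)) * (dr (dr a) x.1 + dr a x.1 ^ 2 - dr a x.1 * dr b x.1
          + 2 * dr a x.1 / x.1.2)
        - (dt (dt b) x.1 + dt b x.1 ^ 2 - dt a x.1 * dt b x.1)) * (v.1.1 * w.1.1)
      + 2 * dt b x.1 / x.1.2 * (v.1.1 * w.1.2 + v.1.2 * w.1.1)
      + (Real.exp (2 * (b x.1 - a x.1)) * (dt (dt b) x.1 + dt b x.1 ^ 2 - dt a x.1 * dt b x.1)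
        - (dr (dr a) x.1 + dr a x.1 ^ 2 - dr a x.1 * dr b x.1 - 2 * dr b x.1 / x.1.2))
          * (v.1.2 * w.1.2)
      + (Real.exp (-2 * b x.1) * (x.1.2 * (dr b x.1 - dr a x.1) - 1) + 1) * inner ℝ v.2 w.2 := by
  have hq : x.1 ∈ between t₀ t₁ ×ˢ between r₀ r₁ := hx
  have h := (hg.isDiagonalOn hr₀ x).ricciCoord_eq hq v w
  have h1 : ricciAt g x v w = ricciCoord (chartMetric g x) (extChartAt modelX x x) v w := rfl
  rw [h1, extChartAt_event_self]
  exact h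

theorem inverse_metricAt (hg : HasDiagonalForm t₀ t₁ r₀ r₁ g a b) (hr₀ : 0 ≤ r₀) {x : Event}
    (hx : x ∈ region t₀ t₁ r₀ r₁) (l : EX →L[ℝ] ℝ) :
    (metricAt g x).inverse l = ((-Real.exp (-2 * a x.1) * l ((1, 0), 0),
      Real.exp (-2 * b x.1) * l ((0, 1), 0)), (x.1.2 ^ 2)⁻¹ •
        (l (0, EuclideanSpace.single 0 1) • EuclideanSpace.single 0 1
          + l (0, EuclideanSpace.single 1 1) • EuclideanSpace.single 1 1)) := by
  have hr := pos_of_mem_between hr₀ hx.2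
  refine inverse_apply_eq (injective_of_diagonal (Real.exp_pos _) (Real.exp_pos _)
    (sq_pos_of_pos hr) (hg.apply_eq x hx)) fun w => ?_
  have hw : w = w.1.1 • ((1, 0), 0) + w.1.2 • ((0, 1), 0)
      + w.2 0 • (0, EuclideanSpace.single 0 1) + w.2 1 • (0, EuclideanSpace.single 1 1) := by
    refine Prod.ext (Prod.ext ?_ ?_) ?_
    · simp
    · simp
    · ext i; fin_cases i <;> simp
  have hl : l w = w.1.1 * l ((1, 0), 0) + w.1.2 * l ((0, 1), 0)
      + w.2 0 * l (0, EuclideanSpace.single 0 1) + w.2 1 * l (0, EuclideanSpace.single 1 1) := by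
    conv_lhs => rw [hw]
    simp only [map_add, map_smul, smul_eq_mul]
  rw [hg.apply_eq x hx, hl]
  simp only [inner_E2, neg_mul, Real.exp_neg]
  have ea : Real.exp (2 * a x.1) ≠ 0 := (Real.exp_pos _).ne'
  have eb : Real.exp (2 * b x.1) ≠ 0 := (Real.exp_pos _).ne'
  have hr' := hr.ne'
  simp
  field_simp
  ring

theorem scalarCurvature_eq (hg : HasDiagonalForm t₀ t₁ r₀ r₁ g a b) (hr₀ : 0 ≤ r₀) {x : Event}
    (hx : x ∈ region t₀ t₁ r₀ r₁) :
    scalarCurvature g x = -Real.exp (-2 * a x.1) * ricciAt g x ((1, 0), 0) ((1, 0), 0)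
      + Real.exp (-2 * b x.1) * ricciAt g x ((0, 1), 0) ((0, 1), 0)
      + 2 * (x.1.2 ^ 2)⁻¹ * (Real.exp (-2 * b x.1) * (x.1.2 * (dr b x.1 - dr a x.1) - 1) + 1) := by
  have h : scalarCurvature g x = LinearMap.trace ℝ EX
      (((metricAt g x).inverse : (EX →L[ℝ] ℝ) →ₗ[ℝ] EX) ∘ₗ
      (LinearMap.toContinuousLinearMap : (EX →ₗ[ℝ] ℝ) ≃ₗ[ℝ] (EX →L[ℝ] ℝ)).toLinearMap ∘ₗ
      ricciAt g x) := rfl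
  rw [h, trace_EX]
  simp only [LinearMap.comp_apply, ContinuousLinearMap.coe_coe, LinearEquiv.coe_coe,
    hg.inverse_metricAt hr₀ hx, LinearMap.coe_toContinuousLinearMap']
  have h0 : ∀ i : Fin 2, ricciAt g x (0, EuclideanSpace.single i 1) (0, EuclideanSpace.single i 1)
      = Real.exp (-2 * b x.1) * (x.1.2 * (dr b x.1 - dr a x.1) - 1) + 1 := by
    intro i
    rw [hg.ricciAt_eq hr₀ hx]
    simp
  simp [h0]
  ring

/-- Subtracting half the scalar curvature cancels all second derivatives in the (t, t) and (r, r)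
components. Density and radial pressure are thus first-order expressions in b and a; only the
angular component stays of second order. -/
theorem stressEnergy_eq (hg : HasDiagonalForm t₀ t₁ r₀ r₁ g a b) (hr₀ : 0 ≤ r₀) {x : Event}
    (hx : x ∈ region t₀ t₁ r₀ r₁) (v w : EX) :
    stressEnergy g x v w = (8 * Real.pi)⁻¹ *
      (Real.exp (2 * a x.1) * (Real.exp (-2 * b x.1) * (2 * dr b x.1 / x.1.2 - 1 / x.1.2 ^ 2)
          + 1 / x.1.2 ^ 2) * (v.1.1 * w.1.1)
        + 2 * dt b x.1 / x.1.2 * (v.1.1 * w.1.2 + v.1.2 * w.1.1)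
        + (2 * dr a x.1 / x.1.2 - (Real.exp (2 * b x.1) - 1) / x.1.2 ^ 2) * (v.1.2 * w.1.2)
        + x.1.2 ^ 2 * (Real.exp (-2 * b x.1) * (dr (dr a) x.1 + dr a x.1 ^ 2 - dr a x.1 * dr b x.1
              + (dr a x.1 - dr b x.1) / x.1.2)
            - Real.exp (-2 * a x.1) * (dt (dt b) x.1 + dt b x.1 ^ 2 - dt a x.1 * dt b x.1))
          * inner ℝ v.2 w.2) := by
  have h : stressEnergy g x v w = (8 * Real.pi)⁻¹ *
      (ricciAt g x v w - (1 / 2) * scalarCurvature g x * metricAt g x v w) := rfl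
  rw [h, hg.scalarCurvature_eq hr₀ hx, hg.apply_eq x hx, hg.ricciAt_eq hr₀ hx,
    hg.ricciAt_eq hr₀ hx, hg.ricciAt_eq hr₀ hx]
  have hr := (pos_of_mem_between hr₀ hx.2).ne'
  have ea : Real.exp (2 * a x.1) ≠ 0 := (Real.exp_pos _).ne'
  have eb : Real.exp (2 * b x.1) ≠ 0 := (Real.exp_pos _).ne'
  simp only [mul_sub, neg_mul, Real.exp_sub, Real.exp_neg]
  simp
  generalize Real.exp (2 * a x.1) = A at *
  generalize Real.exp (2 * b x.1) = B at *
  field_simp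
  ring

/-- The stress-energy tensor at `x` is the diagonal form with eigenvalues `μ₀`, `μ₁`, `l`. -/
theorem birkhoff_apply_eq (hg : HasDiagonalForm t₀ t₁ r₀ r₁ g a b) {x : Event}
    (hx : x ∈ region t₀ t₁ r₀ r₁) {e : Module.Basis (Fin 4) ℝ (TX x)}
    (he : IsBirkhoffFrame g x e) (μ₀ μ₁ l : ℝ) (v w : EX) :
    -μ₀ * (g x (e 0) v * e.coord 0 w) + μ₁ * (g x (e 1) v * e.coord 1 w)
        + l * (g x (e 2) v * e.coord 2 w + g x (e 3) v * e.coord 3 w)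
      = μ₀ * (Real.exp (2 * a x.1) * (v.1.1 * w.1.1))
        + μ₁ * (Real.exp (2 * b x.1) * (v.1.2 * w.1.2)) + l * (x.1.2 ^ 2 * inner ℝ v.2 w.2) := by
  obtain ⟨ho, ⟨k, hk⟩, ⟨m, hm⟩⟩ := he
  have hsum : metricAt g x v w = _ := ho.sum_eq v w
  have h0 : ∀ v : EX, e.coord 0 v = k * (Real.exp (2 * a x.1) * v.1.1) := by
    intro v
    have h1 : metricAt g x (k • ((1, 0), 0)) v = lorentzSign 0 * e.coord 0 v := by
      have := ho.apply_eq 0 v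
      rw [hk] at this
      exact this
    rw [hg.apply_eq x hx] at h1
    simp [lorentzSign] at h1
    linarith
  have h1 : ∀ v : EX, e.coord 1 v = m * (Real.exp (2 * b x.1) * v.1.2) := by
    intro v
    have h1 : metricAt g x (m • ((0, 1), 0)) v = lorentzSign 1 * e.coord 1 v := by
      have := ho.apply_eq 1 v
      rw [hm] at this
      exact this
    rw [hg.apply_eq x hx] at h1
    simp [lorentzSign] at h1
    linarith
  have hk2 : k ^ 2 * Real.exp (2 * a x.1) = 1 := by
    have h2 : metricAt g x (k • ((1, 0), 0)) (k • ((1, 0), 0)) = -1 := by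
      have := ho 0 0
      rw [hk] at this
      exact this.trans (by simp [lorentzSign])
    rw [hg.apply_eq x hx] at h2
    simp at h2
    linarith
  have hm2 : m ^ 2 * Real.exp (2 * b x.1) = 1 := by
    have h2 : metricAt g x (m • ((0, 1), 0)) (m • ((0, 1), 0)) = 1 := by
      have := ho 1 1
      rw [hm] at this
      exact this.trans (by simp [lorentzSign])
    rw [hg.apply_eq x hx] at h2
    simp at h2
    linarith
  rw [hg.apply_eq x hx, h0, h0, h1, h1] at hsum
  have hi : ∀ i, g x (e i) v = lorentzSign i * e.coord i v := fun i => ho.apply_eq i v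
  rw [hi 0, hi 1, hi 2, hi 3, h0, h0, h1, h1]
  simp only [lorentzSign, Fin.isValue, one_ne_zero, Fin.reduceEq, if_true, if_false, one_mul]
  generalize e.coord 2 v = c2, e.coord 2 w = d2, e.coord 3 v = c3, e.coord 3 w = d3 at *
  generalize Real.exp (2 * a x.1) = A at *
  generalize Real.exp (2 * b x.1) = B at *
  -- The angular part of the frame is the metric minus its `e 0` and `e 1` parts, so nothing about
  -- `e 2`, `e 3` individually is needed. The normalizations `hk2` and `hm2` remove the factors k
  -- and m.
  linear_combination (-l) * hsum + (μ₀ + l) * A * v.1.1 * w.1.1 * hk2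
    + (μ₁ - l) * B * v.1.2 * w.1.2 * hm2

/-- The basis obtained from the coordinate basis by dividing by `α`, `β`, `ρ`, `ρ`. -/
def scaledBasis (α β ρ : ℝ) (hα : α ≠ 0) (hβ : β ≠ 0) (hρ : ρ ≠ 0) :
    Module.Basis (Fin 4) ℝ EX :=
  Module.Basis.ofEquivFun
    { toFun := fun v => ![α * v.1.1, β * v.1.2, ρ * v.2 0, ρ * v.2 1]
      invFun := fun c => ((α⁻¹ * c 0, β⁻¹ * c 1), !₂[ρ⁻¹ * c 2, ρ⁻¹ * c 3])
      map_add' := fun v w => by ext i; fin_cases i <;> simp [mul_add]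
      map_smul' := fun c w => by ext i; fin_cases i <;> simp [mul_left_comm]
      left_inv := fun v => by
        refine Prod.ext (Prod.ext ?_ ?_) ?_
        · simp [hα]
        · simp [hβ]
        · ext i; fin_cases i <;> simp [hρ]
      right_inv := fun c => by ext i; fin_cases i <;> simp [hα, hβ, hρ] }

theorem scaledBasis_apply (α β ρ : ℝ) (hα : α ≠ 0) (hβ : β ≠ 0) (hρ : ρ ≠ 0) (i : Fin 4) :
    scaledBasis α β ρ hα hβ hρ i = ![((α⁻¹, 0), 0), ((0, β⁻¹), 0),
      (0, !₂[ρ⁻¹, 0]), (0, !₂[0, ρ⁻¹])] i := by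
  have h : ((0 : E2)) = !₂[0, 0] := by ext i; fin_cases i <;> rfl
  fin_cases i <;> simp [scaledBasis, h]

theorem exists_birkhoffFrame (hg : HasDiagonalForm t₀ t₁ r₀ r₁ g a b) (hr₀ : 0 ≤ r₀) {x : Event}
    (hx : x ∈ region t₀ t₁ r₀ r₁) : ∃ e, IsBirkhoffFrame g x e := by
  have hr := (pos_of_mem_between hr₀ hx.2).ne'
  let e : Module.Basis (Fin 4) ℝ EX :=
    scaledBasis (Real.exp (a x.1)) (Real.exp (b x.1)) x.1.2 (Real.exp_pos _).ne'
      (Real.exp_pos _).ne' hr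
  have he : ∀ i, e i = _ := scaledBasis_apply _ _ _ _ _ _
  have h1 : ∀ i j, metricAt g x (e i) (e j) = if i = j then lorentzSign i else 0 := by
    have ea : Real.exp (2 * a x.1) = Real.exp (a x.1) ^ 2 := by rw [← Real.exp_nat_mul]; simp
    have eb : Real.exp (2 * b x.1) = Real.exp (b x.1) ^ 2 := by rw [← Real.exp_nat_mul]; simp
    intro i j
    rw [he, he, hg.apply_eq x hx, ea, eb, inner_E2]
    have ea' := (Real.exp_pos (a x.1)).ne'
    have eb' := (Real.exp_pos (b x.1)).ne'
    fin_cases i <;> fin_cases j <;> simp [lorentzSign] <;> field_simp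
  refine ⟨e, h1, ⟨(Real.exp (a x.1))⁻¹, ?_⟩, ⟨(Real.exp (b x.1))⁻¹, ?_⟩⟩
  · have h : e 0 = (Real.exp (a x.1))⁻¹ • (((1, 0), 0) : EX) := by rw [he]; simp
    exact h
  · have h : e 1 = (Real.exp (b x.1))⁻¹ • (((0, 1), 0) : EX) := by rw [he]; simp
    exact h

/-- Both tensors are diagonal in the coordinate directions apart from the (t, r)-term of the
Einstein tensor. Comparing the coefficients on coordinate vectors therefore loses nothing, and the
choice of Birkhoff frame does not matter. -/
theorem hasDiagonalStress_iff (hg : HasDiagonalForm t₀ t₁ r₀ r₁ g a b) (hr₀ : 0 ≤ r₀)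
    {μ₀ μ₁ l : Event → ℝ} : HasDiagonalStress t₀ t₁ r₀ r₁ g μ₀ μ₁ l ↔
      ∀ x ∈ region t₀ t₁ r₀ r₁, dt b x.1 = 0 ∧
        8 * Real.pi * μ₀ x = Real.exp (-2 * b x.1) * (2 * dr b x.1 / x.1.2 - 1 / x.1.2 ^ 2)
          + 1 / x.1.2 ^ 2 ∧
        8 * Real.pi * μ₁ x = Real.exp (-2 * b x.1) * (2 * dr a x.1 / x.1.2 + 1 / x.1.2 ^ 2)
          - 1 / x.1.2 ^ 2 ∧
        8 * Real.pi * l x = Real.exp (-2 * b x.1) * (dr (dr a) x.1 + dr a x.1 ^ 2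
              - dr a x.1 * dr b x.1 + (dr a x.1 - dr b x.1) / x.1.2)
            - Real.exp (-2 * a x.1) * (dt (dt b) x.1 + dt b x.1 ^ 2 - dt a x.1 * dt b x.1) := by
  refine forall₂_congr fun x hx => ?_
  have hr := (pos_of_mem_between hr₀ hx.2).ne'
  have ea := (Real.exp_pos (2 * a x.1)).ne'
  have eb := (Real.exp_pos (2 * b x.1)).ne'
  have eb' : Real.exp (-2 * b x.1) = (Real.exp (2 * b x.1))⁻¹ := by rw [neg_mul, Real.exp_neg]
  have hpi := Real.pi_pos.ne'
  constructor
  · rintro ⟨e, he, hT⟩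
    have h : ∀ v w : EX, _ := fun v w => (hg.stressEnergy_eq hr₀ hx v w).symm.trans
      ((hT v w).trans (hg.birkhoff_apply_eq hx he (μ₀ x) (μ₁ x) (l x) v w))
    have h1 := h ((1, 0), 0) ((1, 0), 0)
    have h2 := h ((1, 0), 0) ((0, 1), 0)
    have h3 := h ((0, 1), 0) ((0, 1), 0)
    have h4 := h (0, EuclideanSpace.single 0 1) (0, EuclideanSpace.single 0 1)
    simp [hpi, hr] at h2
    simp at h1 h3 h4
    refine ⟨h2, ?_, ?_, ?_⟩
    · field_simp at h1 ⊢
      linarith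
    · rw [eb']
      field_simp at h3 ⊢
      linarith
    · field_simp at h4 ⊢
      linarith
  · rintro ⟨h1, h2, h3, h4⟩
    obtain ⟨e, he⟩ := hg.exists_birkhoffFrame hr₀ hx
    refine ⟨e, he, fun v w => ?_⟩
    refine (hg.stressEnergy_eq hr₀ hx v w).trans (Eq.trans ?_
      (hg.birkhoff_apply_eq hx he (μ₀ x) (μ₁ x) (l x) v w).symm)
    have e0 : μ₀ x = (8 * Real.pi)⁻¹ * (8 * Real.pi * μ₀ x) := by field_simp
    have e1 : μ₁ x = (8 * Real.pi)⁻¹ * (8 * Real.pi * μ₁ x) := by field_simp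
    have e2 : l x = (8 * Real.pi)⁻¹ * (8 * Real.pi * l x) := by field_simp
    rw [e0, e1, e2, h2, h3, h4, h1, eb']
    field_simp
    ring

end HasDiagonalForm

/-! ### The radial equations of a static metric -/

theorem ordConnected_between (a b : EReal) : (between a b).OrdConnected :=
  ⟨fun _ hx _ hy _ hz => ⟨hx.1.trans_le (EReal.coe_le_coe_iff.2 hz.1),
    (EReal.coe_le_coe_iff.2 hz.2).trans_lt hy.2⟩⟩

theorem between_nonempty {a b : EReal} (h : a < b) : (between a b).Nonempty := by
  obtain ⟨q, hq1, hq2⟩ := EReal.lt_iff_exists_rat_btwn.1 h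
  exact ⟨(q : ℝ), hq1, hq2⟩

theorem contDiffOn_deriv {f : ℝ → ℝ} {J : Set ℝ} (hJ : IsOpen J) (hf : ContDiffOn ℝ ∞ f J) :
    ContDiffOn ℝ ∞ (deriv f) J :=
  hf.deriv_of_isOpen hJ (by simp)

theorem hasDerivAt_of_contDiffOn {f : ℝ → ℝ} {J : Set ℝ} (hJ : IsOpen J) (hf : ContDiffOn ℝ ∞ f J)
    {r : ℝ} (hr : r ∈ J) : HasDerivAt f (deriv f r) r :=
  ((hf.contDiffAt (hJ.mem_nhds hr)).differentiableAt (by simp)).hasDerivAt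

theorem uIcc_subset_between {a b : EReal} {x y : ℝ} (hx : x ∈ between a b) (hy : y ∈ between a b) :
    uIcc x y ⊆ between a b :=
  (ordConnected_between a b).uIcc_subset hx hy

/-- The energy density and the radial pressure of the static metric
`-e^{2α} dt² + e^{2β} dr² + r² dσ²`. -/
structure IsStaticProfile (r₀ r₁ : EReal) (α β m₀ m₁ : ℝ → ℝ) : Prop where
  nonneg : 0 ≤ r₀
  smooth_α : ContDiffOn ℝ ∞ α (between r₀ r₁)
  smooth_β : ContDiffOn ℝ ∞ β (between r₀ r₁)
  density : ∀ r ∈ between r₀ r₁, 8 * Real.pi * m₀ r =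
    Real.exp (-2 * β r) * (2 * deriv β r / r - 1 / r ^ 2) + 1 / r ^ 2
  pressure : ∀ r ∈ between r₀ r₁, 8 * Real.pi * m₁ r =
    Real.exp (-2 * β r) * (2 * deriv α r / r + 1 / r ^ 2) - 1 / r ^ 2

namespace IsStaticProfile

variable {r₀ r₁ : EReal} {α β m₀ m₁ : ℝ → ℝ}

theorem contDiffOn_density (h : IsStaticProfile r₀ r₁ α β m₀ m₁) :
    ContDiffOn ℝ ∞ m₀ (between r₀ r₁) := by
  have hpos : ∀ r ∈ between r₀ r₁, r ≠ 0 := fun r hr => (pos_of_mem_between h.nonneg hr).ne'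
  have hid : ContDiffOn ℝ ∞ (fun r : ℝ => r) (between r₀ r₁) := contDiffOn_id
  have hβ' := contDiffOn_deriv (isOpen_between r₀ r₁) h.smooth_β
  have h1 : ContDiffOn ℝ ∞ (fun r : ℝ => 1 / r ^ 2) (between r₀ r₁) :=
    contDiffOn_const.div (hid.pow 2) fun r hr => pow_ne_zero 2 (hpos r hr)
  have h2 := ((contDiffOn_const (c := -2)).mul h.smooth_β).exp.mul
    ((((contDiffOn_const (c := (2 : ℝ))).mul hβ').div hid hpos).sub h1) |>.add h1
  refine (contDiffOn_const (c := (8 * Real.pi)⁻¹) |>.mul h2).congr fun r hr => ?_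
  have := Real.pi_pos.ne'
  simp only [Pi.div_apply]
  rw [← h.density r hr]
  field_simp

theorem contDiffOn_pressure (h : IsStaticProfile r₀ r₁ α β m₀ m₁) :
    ContDiffOn ℝ ∞ m₁ (between r₀ r₁) := by
  have hpos : ∀ r ∈ between r₀ r₁, r ≠ 0 := fun r hr => (pos_of_mem_between h.nonneg hr).ne'
  have hid : ContDiffOn ℝ ∞ (fun r : ℝ => r) (between r₀ r₁) := contDiffOn_id
  have hα' := contDiffOn_deriv (isOpen_between r₀ r₁) h.smooth_α
  have h1 : ContDiffOn ℝ ∞ (fun r : ℝ => 1 / r ^ 2) (between r₀ r₁) :=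
    contDiffOn_const.div (hid.pow 2) fun r hr => pow_ne_zero 2 (hpos r hr)
  have h2 := ((contDiffOn_const (c := -2)).mul h.smooth_β).exp.mul
    ((((contDiffOn_const (c := (2 : ℝ))).mul hα').div hid hpos).add h1) |>.sub h1
  refine (contDiffOn_const (c := (8 * Real.pi)⁻¹) |>.mul h2).congr fun r hr => ?_
  have := Real.pi_pos.ne'
  simp only [Pi.div_apply]
  rw [← h.pressure r hr]
  field_simp

/-- By the density equation, (x - x e^{-2β}) / 2 is an antiderivative of 4π x² μ₀. -/
theorem massIntegral_eq (h : IsStaticProfile r₀ r₁ α β m₀ m₁) {rs r : ℝ}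
    (hrs : rs ∈ between r₀ r₁) (hr : r ∈ between r₀ r₁) :
    massIntegral m₀ rs r =
      (r + rs * (Real.exp (-2 * β rs) - 1) - r * Real.exp (-2 * β r)) / 2 := by
  have hsub := uIcc_subset_between hrs hr
  have hder : ∀ x ∈ uIcc rs r, HasDerivAt (fun x => (x - x * Real.exp (-2 * β x)) / 2)
      (4 * Real.pi * x ^ 2 * m₀ x) x := by
    intro x hx
    have hβ := hasDerivAt_of_contDiffOn (isOpen_between r₀ r₁) h.smooth_β (hsub hx)
    have h1 := (((hasDerivAt_id x).sub ((hasDerivAt_id x).mul (hβ.const_mul (-2)).exp))).div_const 2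
    refine h1.congr_deriv ?_
    have h2 := h.density x (hsub hx)
    have hx0 := (pos_of_mem_between h.nonneg (hsub hx)).ne'
    have h3 : 4 * Real.pi * x ^ 2 * m₀ x = x ^ 2 / 2 * (8 * Real.pi * m₀ x) := by ring
    rw [h3, h2]
    simp only [id]
    field_simp
    ring
  have hintegral : IntervalIntegrable (fun x => 4 * Real.pi * x ^ 2 * m₀ x) MeasureTheory.volume rs r :=
    ContinuousOn.intervalIntegrable
      ((continuousOn_const.mul (continuousOn_id.pow 2)).mul
        (h.contDiffOn_density.continuousOn.mono hsub))
  rw [massIntegral, intervalIntegral.integral_eq_sub_of_hasDerivAt hder hintegral]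
  ring

/-- The constant c = r_* (e^{-2β(r_*)} - 1) is dictated by the value at r_*, where the integral
vanishes and h = (r_* + c) / r_*. -/
theorem hFun_eq (h : IsStaticProfile r₀ r₁ α β m₀ m₁) {rs r : ℝ}
    (hrs : rs ∈ between r₀ r₁) (hr : r ∈ between r₀ r₁) :
    hFun m₀ (rs * (Real.exp (-2 * β rs) - 1)) rs r = Real.exp (-2 * β r) := by
  have hr0 := (pos_of_mem_between h.nonneg hr).ne'
  rw [hFun, h.massIntegral_eq hrs hr]
  field_simp
  ring

/-- The slack in the inequality is r e^{-2β} / 2. -/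
theorem massBound (h : IsStaticProfile r₀ r₁ α β m₀ m₁) {rs : ℝ} (hrs : rs ∈ between r₀ r₁) :
    MassBound r₀ r₁ m₀ (rs * (Real.exp (-2 * β rs) - 1)) rs := by
  intro r hr
  rw [h.massIntegral_eq hrs hr]
  have := mul_pos (pos_of_mem_between h.nonneg hr) (Real.exp_pos (-2 * β r))
  linarith

/-- Adding density and pressure gives 4π x² (μ₀ + μ₁) = x e^{-2β} (α' + β'), and the denominator in
p is exactly x e^{-2β}. -/
theorem pFun_eq (h : IsStaticProfile r₀ r₁ α β m₀ m₁) {rs r : ℝ}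
    (hrs : rs ∈ between r₀ r₁) (hr : r ∈ between r₀ r₁) :
    pFun m₀ m₁ (rs * (Real.exp (-2 * β rs) - 1)) rs r =
      Real.exp (α r + β r - (α rs + β rs)) := by
  have hsub := uIcc_subset_between hrs hr
  have hJ := isOpen_between r₀ r₁
  have h1 : ∀ x ∈ uIcc rs r, 4 * Real.pi * x ^ 2 * (m₀ x + m₁ x) /
      (x + rs * (Real.exp (-2 * β rs) - 1) - 2 * massIntegral m₀ rs x) = deriv α x + deriv β x := by
    intro x hx
    have hx0 := (pos_of_mem_between h.nonneg (hsub hx)).ne'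
    have he := (Real.exp_pos (-2 * β x)).ne'
    have h2 := h.density x (hsub hx)
    have h3 := h.pressure x (hsub hx)
    have h4 : 4 * Real.pi * x ^ 2 * (m₀ x + m₁ x)
        = x ^ 2 / 2 * (8 * Real.pi * m₀ x + 8 * Real.pi * m₁ x) := by ring
    have h5 : x + rs * (Real.exp (-2 * β rs) - 1) - 2 * massIntegral m₀ rs x
        = x * Real.exp (-2 * β x) := by
      rw [h.massIntegral_eq hrs (hsub hx)]; ring
    rw [h4, h2, h3, h5]
    field_simp
    ring
  rw [pFun, intervalIntegral.integral_congr h1]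
  have hder : ∀ x ∈ uIcc rs r, HasDerivAt (fun x => α x + β x) (deriv α x + deriv β x) x :=
    fun x hx => (hasDerivAt_of_contDiffOn hJ h.smooth_α (hsub hx)).add
      (hasDerivAt_of_contDiffOn hJ h.smooth_β (hsub hx))
  rw [intervalIntegral.integral_eq_sub_of_hasDerivAt hder
    (((contDiffOn_deriv hJ h.smooth_α).continuousOn.add
      (contDiffOn_deriv hJ h.smooth_β).continuousOn).mono hsub).intervalIntegrable]

/-- The right-hand side of (4) contains μ₁', and differentiating the pressure equation expresses it
through α''. Substituting all three expressions leaves the angular component of the Einstein tensor.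
-/
theorem tovRHS_eq (h : IsStaticProfile r₀ r₁ α β m₀ m₁) {rs r : ℝ}
    (hrs : rs ∈ between r₀ r₁) (hr : r ∈ between r₀ r₁) :
    8 * Real.pi * tovRHS m₀ m₁ (rs * (Real.exp (-2 * β rs) - 1)) rs r =
      Real.exp (-2 * β r) * (deriv (deriv α) r + deriv α r ^ 2 - deriv α r * deriv β r
        + (deriv α r - deriv β r) / r) := by
  have hJ := isOpen_between r₀ r₁
  have hr0 := (pos_of_mem_between h.nonneg hr).ne'
  have hpi := Real.pi_pos.ne'
  have hα' := hasDerivAt_of_contDiffOn hJ (contDiffOn_deriv hJ h.smooth_α) hr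
  have hβ := hasDerivAt_of_contDiffOn hJ h.smooth_β hr
  have hinv : HasDerivAt (fun r : ℝ => 1 / r ^ 2) (-2 / r ^ 3) r := by
    have h1 := ((hasDerivAt_id r).pow 2).inv (by simpa using hr0)
    refine (h1.congr_deriv ?_).congr_of_eventuallyEq
      (Filter.Eventually.of_forall fun s => ?_)
    · simp; field_simp
    · simp
  have h1 := ((hβ.const_mul (-2)).exp.mul (((hα'.const_mul 2).div (hasDerivAt_id r) hr0).add
    hinv)).sub hinv |>.const_mul (8 * Real.pi)⁻¹
  have h2 : HasDerivAt m₁ _ r := h1.congr_of_eventuallyEq (by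
    filter_upwards [hJ.mem_nhds hr] with s hs
    have h3 := h.pressure s hs
    simp only [Pi.sub_apply, Pi.mul_apply, Pi.add_apply, Pi.div_apply, id]
    rw [← h3]
    field_simp)
  rw [tovRHS, h.hFun_eq hrs hr, h2.deriv]
  have e0 : m₀ r = (8 * Real.pi)⁻¹ * (8 * Real.pi * m₀ r) := by field_simp
  have e1 : m₁ r = (8 * Real.pi)⁻¹ * (8 * Real.pi * m₁ r) := by field_simp
  rw [e0, e1, h.density r hr, h.pressure r hr]
  have he := (Real.exp_pos (-2 * β r)).ne'
  simp
  simp only [neg_mul] at he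
  generalize Real.exp (-(2 * β r)) = H at *
  field_simp
  ring

end IsStaticProfile

theorem hasDerivAt_integral_of_contDiffOn {a b : EReal} {f : ℝ → ℝ}
    (hf : ContDiffOn ℝ ∞ f (between a b)) {s r : ℝ} (hs : s ∈ between a b) (hr : r ∈ between a b) :
    HasDerivAt (fun r => ∫ x in s..r, f x) (f r) r := by
  have hsub := uIcc_subset_between hs hr
  have hnhds := (isOpen_between a b).mem_nhds hr
  exact intervalIntegral.integral_hasDerivAt_right
    (hf.continuousOn.mono hsub).intervalIntegrable
    (hf.continuousOn.stronglyMeasurableAtFilter (isOpen_between a b) r hr)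
    (hf.continuousOn.continuousAt hnhds)

theorem contDiffOn_integral {a b : EReal} {f : ℝ → ℝ}
    (hf : ContDiffOn ℝ ∞ f (between a b)) {s : ℝ} (hs : s ∈ between a b) :
    ContDiffOn ℝ ∞ (fun r => ∫ x in s..r, f x) (between a b) := by
  rw [contDiffOn_infty_iff_deriv_of_isOpen (isOpen_between a b)]
  refine ⟨fun r hr =>
    (hasDerivAt_integral_of_contDiffOn hf hs hr).differentiableAt.differentiableWithinAt, ?_⟩
  exact hf.congr fun r hr => (hasDerivAt_integral_of_contDiffOn hf hs hr).deriv

/-- Inversion of the preceding formulas: β = -(log h) / 2, and α is the exponent of p plus (log h) /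
2. The mass bound makes h positive, so that both are smooth. -/
theorem exists_staticProfile {r₀ r₁ : EReal} (hr₀ : 0 ≤ r₀) {m₀ m₁ : ℝ → ℝ} {c rs : ℝ}
    (hrs : rs ∈ between r₀ r₁) (hm₀ : ContDiffOn ℝ ∞ m₀ (between r₀ r₁))
    (hm₁ : ContDiffOn ℝ ∞ m₁ (between r₀ r₁)) (hbound : MassBound r₀ r₁ m₀ c rs) :
    ∃ α β, IsStaticProfile r₀ r₁ α β m₀ m₁ ∧ c = rs * (Real.exp (-2 * β rs) - 1) ∧
      ∀ r ∈ between r₀ r₁, 0 < hFun m₀ c rs r ∧ Real.exp (2 * β r) = (hFun m₀ c rs r)⁻¹ ∧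
        Real.exp (2 * α r) = pFun m₀ m₁ c rs r ^ 2 * hFun m₀ c rs r := by
  have hJ := isOpen_between r₀ r₁
  have hpos : ∀ r ∈ between r₀ r₁, 0 < r := fun r hr => pos_of_mem_between hr₀ hr
  have hid : ContDiffOn ℝ ∞ (fun r : ℝ => r) (between r₀ r₁) := contDiffOn_id
  have hf : ContDiffOn ℝ ∞ (fun x : ℝ => 4 * Real.pi * x ^ 2 * m₀ x) (between r₀ r₁) :=
    (contDiffOn_const.mul (hid.pow 2)).mul hm₀
  have hM : ContDiffOn ℝ ∞ (massIntegral m₀ rs) (between r₀ r₁) := contDiffOn_integral hf hrs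
  have hden : ∀ r ∈ between r₀ r₁, 0 < r + c - 2 * massIntegral m₀ rs r := fun r hr => by
    have := hbound r hr; linarith
  have hk : ContDiffOn ℝ ∞ (fun x => 4 * Real.pi * x ^ 2 * (m₀ x + m₁ x) /
      (x + c - 2 * massIntegral m₀ rs x)) (between r₀ r₁) :=
    ((contDiffOn_const.mul (hid.pow 2)).mul (hm₀.add hm₁)).div
      ((hid.add contDiffOn_const).sub (contDiffOn_const.mul hM)) fun r hr => (hden r hr).ne'
  set k := fun x => 4 * Real.pi * x ^ 2 * (m₀ x + m₁ x) /
      (x + c - 2 * massIntegral m₀ rs x) with hkdef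
  have hh : ∀ r ∈ between r₀ r₁, hFun m₀ c rs r = (r + c - 2 * massIntegral m₀ rs r) / r :=
    fun r hr => by
      have := (hpos r hr).ne'
      rw [hFun]; field_simp
  have hhpos : ∀ r ∈ between r₀ r₁, 0 < hFun m₀ c rs r := fun r hr => by
    rw [hh r hr]; exact div_pos (hden r hr) (hpos r hr)
  have hhs : ContDiffOn ℝ ∞ (hFun m₀ c rs) (between r₀ r₁) :=
    (((hid.add contDiffOn_const).sub (contDiffOn_const.mul hM)).div hid
      fun r hr => (hpos r hr).ne').congr hh
  -- This is (r h)' = 1 - 8π r² μ₀, the density equation for β = -(log h) / 2.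
  have hhder : ∀ r ∈ between r₀ r₁, HasDerivAt (hFun m₀ c rs)
      ((1 - 8 * Real.pi * r ^ 2 * m₀ r) / r - hFun m₀ c rs r / r) r := by
    intro r hr
    have hr0 := (hpos r hr).ne'
    have h1 : HasDerivAt (massIntegral m₀ rs) (4 * Real.pi * r ^ 2 * m₀ r) r :=
      hasDerivAt_integral_of_contDiffOn hf hrs hr
    have h2 := (((hasDerivAt_id r).add_const c).sub (h1.const_mul 2)).div (hasDerivAt_id r) hr0
    refine (h2.congr_of_eventuallyEq ?_).congr_deriv ?_
    · filter_upwards [hJ.mem_nhds hr] with s hs using hh s hs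
    · rw [hh r hr]
      simp only [id, Pi.sub_apply]
      field_simp
      ring
  have hP : ContDiffOn ℝ ∞ (fun r => ∫ x in rs..r, k x) (between r₀ r₁) :=
    contDiffOn_integral hk hrs
  have hβexp : ∀ r ∈ between r₀ r₁,
      Real.exp (-2 * (-Real.log (hFun m₀ c rs r) / 2)) = hFun m₀ c rs r := fun r hr => by
    rw [show -2 * (-Real.log (hFun m₀ c rs r) / 2) = Real.log (hFun m₀ c rs r) by ring,
      Real.exp_log (hhpos r hr)]
  have hβder : ∀ r ∈ between r₀ r₁, HasDerivAt (fun r => -Real.log (hFun m₀ c rs r) / 2)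
      (-(((1 - 8 * Real.pi * r ^ 2 * m₀ r) / r - hFun m₀ c rs r / r) / hFun m₀ c rs r) / 2) r :=
    fun r hr => ((hhder r hr).log (hhpos r hr).ne').neg.div_const 2
  have hαder : ∀ r ∈ between r₀ r₁,
      HasDerivAt (fun r => (∫ x in rs..r, k x) + Real.log (hFun m₀ c rs r) / 2)
      (k r + ((1 - 8 * Real.pi * r ^ 2 * m₀ r) / r - hFun m₀ c rs r / r) / hFun m₀ c rs r / 2) r :=
    fun r hr => (hasDerivAt_integral_of_contDiffOn hk hrs hr).add
      (((hhder r hr).log (hhpos r hr).ne').div_const 2)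
  refine ⟨fun r => (∫ x in rs..r, k x) + Real.log (hFun m₀ c rs r) / 2,
    fun r => -Real.log (hFun m₀ c rs r) / 2, ⟨hr₀, ?_, ?_, ?_, ?_⟩, ?_, ?_⟩
  · exact hP.add ((hhs.log fun r hr => (hhpos r hr).ne').div_const 2)
  · exact (hhs.log fun r hr => (hhpos r hr).ne').neg.div_const 2
  · intro r hr
    rw [hβexp r hr, (hβder r hr).deriv]
    have hr0 := (hpos r hr).ne'
    have hh0 := (hhpos r hr).ne'
    field_simp
    ring
  · intro r hr
    rw [hβexp r hr, (hαder r hr).deriv]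
    have hr0 := (hpos r hr).ne'
    have hh0 := (hhpos r hr).ne'
    have hd : r + c - 2 * massIntegral m₀ rs r = r * hFun m₀ c rs r := by
      rw [hh r hr]; field_simp
    simp only [hkdef, hd]
    field_simp
    ring
  · rw [hβexp rs hrs, hh rs hrs]
    have hr0 := (hpos rs hrs).ne'
    simp only [massIntegral, intervalIntegral.integral_same]
    field_simp
    ring
  · intro r hr
    refine ⟨hhpos r hr, ?_, ?_⟩
    · rw [show 2 * (-Real.log (hFun m₀ c rs r) / 2) = -Real.log (hFun m₀ c rs r) by ring,
        Real.exp_neg, Real.exp_log (hhpos r hr)]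
    · rw [pFun, ← Real.exp_nat_mul, mul_add, Real.exp_add,
        show 2 * (Real.log (hFun m₀ c rs r) / 2) = Real.log (hFun m₀ c rs r) by ring,
        Real.exp_log (hhpos r hr)]
      simp [hkdef]

/-! ### The converse: symmetry, the static Killing field and the stress -/

namespace HasDiagonalForm

variable {t₀ t₁ r₀ r₁ : EReal} {g : BilinField modelX Event} {a b : ℝ × ℝ → ℝ}

theorem isSphericallySymmetric (hg : HasDiagonalForm t₀ t₁ r₀ r₁ g a b) (hr₀ : 0 ≤ r₀) :
    IsSphericallySymmetric t₀ t₁ r₀ r₁ g where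
  smooth := by
    refine smoothMetricOn_of_chartMetric fun x hx => ?_
    have h := hg.isDiagonalOn hr₀ x
    rw [extChartAt_event_self]
    exact h.contDiffOn.contDiffAt (h.isOpen_preimage.mem_nhds (x := ((x.1, 0) : EX)) hx)
  lorentzian x hx := by
    obtain ⟨e, he⟩ := hg.exists_birkhoffFrame hr₀ hx
    refine ⟨fun v w => ?_, e, he.1⟩
    have h : ∀ v w, metricAt g x v w = metricAt g x w v := by
      intro v w
      rw [hg.apply_eq x hx, hg.apply_eq x hx, real_inner_comm]
      ring
    exact h v w
  rotation_invariant A _ x hx v w := by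
    have hx' : rotate A x ∈ region t₀ t₁ r₀ r₁ := hx
    have h : ∀ v w : EX, metricAt g (rotate A x) (rotateDeriv A x v) (rotateDeriv A x w)
        = metricAt g x v w := by
      intro v w
      rw [hg.apply_eq _ hx', hg.apply_eq x hx, rotateDeriv_fst, rotateDeriv_fst,
        ← (sphereFrame (rotate A x).2).inner_map_map, sphereFrame_rotateDeriv,
        sphereFrame_rotateDeriv, A.inner_map_map, (sphereFrame x.2).inner_map_map]
      rfl
    exact h v w
  orbit_metric x hx v w h1 h2 h3 h4 := by
    have h : ∀ v w : EX, differential tCoord x v = 0 → differential rCoord x v = 0 →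
        differential tCoord x w = 0 → differential rCoord x w = 0 →
        metricAt g x v w = rCoord x ^ 2 * roundMetric x v w := by
      intro v w h1 h2 h3 h4
      rw [differential_tCoord] at h1 h3
      rw [differential_rCoord] at h2 h4
      rw [hg.apply_eq x hx, h1, h2, roundMetric_apply]
      simp [rCoord]
    exact h v w h1 h2 h3 h4
  orthogonal x hx := by
    have h : metricAt g x ((1, 0), 0) ((0, 1), 0) = 0 := by rw [hg.apply_eq x hx]; simp
    exact h
  timelike x hx := by
    have h : metricAt g x ((1, 0), 0) ((1, 0), 0) < 0 := by
      rw [hg.apply_eq x hx]; simp [Real.exp_pos]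
    exact h

end HasDiagonalForm

theorem chartInvDeriv_injective (x : Event) (y : EX) : Function.Injective (chartInvDeriv x y) := by
  obtain ⟨e, he⟩ := chartInvDeriv_isInvertible x y
  rw [← he]
  exact e.injective

theorem chartInvDeriv_base (x : Event) (y : EX) (d : ℝ × ℝ) :
    chartInvDeriv x y (d, 0) = (d, 0) := by
  refine Prod.ext (chartInvDeriv_fst x y _) ?_
  apply (sphereFrame ((extChartAt modelX x).symm y).2).injective
  rw [sphereFrame_chartInvDeriv]
  simp

theorem hasDerivAt_dt {f : ℝ × ℝ → ℝ} {O : Set (ℝ × ℝ)} (hO : IsOpen O) (hf : ContDiffOn ℝ ∞ f O)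
    {q : ℝ × ℝ} (hq : q ∈ O) : HasDerivAt (fun s => f (s, q.2)) (dt f q) q.1 := by
  have h1 : HasFDerivAt f (fderiv ℝ f q) (q.1, q.2) :=
    (IsDiagonalOn.differentiableAt_fst hO hf hq).hasFDerivAt
  have h2 : HasDerivAt (fun s : ℝ => (s, q.2)) (1, 0) q.1 :=
    (hasDerivAt_id q.1).prodMk (hasDerivAt_const q.1 q.2)
  exact h1.comp_hasDerivAt q.1 h2

theorem hasDerivAt_dr {f : ℝ × ℝ → ℝ} {O : Set (ℝ × ℝ)} (hO : IsOpen O) (hf : ContDiffOn ℝ ∞ f O)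
    {q : ℝ × ℝ} (hq : q ∈ O) : HasDerivAt (fun s => f (q.1, s)) (dr f q) q.2 := by
  have h1 : HasFDerivAt f (fderiv ℝ f q) (q.1, q.2) :=
    (IsDiagonalOn.differentiableAt_fst hO hf hq).hasFDerivAt
  have h2 : HasDerivAt (fun s : ℝ => (q.1, s)) (0, 1) q.2 :=
    (hasDerivAt_const q.2 q.1).prodMk (hasDerivAt_id q.2)
  exact h1.comp_hasDerivAt q.2 h2

theorem dt_eq_deriv {f : ℝ × ℝ → ℝ} {O : Set (ℝ × ℝ)} (hO : IsOpen O) (hf : ContDiffOn ℝ ∞ f O)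
    {q : ℝ × ℝ} (hq : q ∈ O) : dt f q = deriv (fun s => f (s, q.2)) q.1 :=
  (hasDerivAt_dt hO hf hq).deriv.symm

theorem dr_eq_deriv {f : ℝ × ℝ → ℝ} {O : Set (ℝ × ℝ)} (hO : IsOpen O) (hf : ContDiffOn ℝ ∞ f O)
    {q : ℝ × ℝ} (hq : q ∈ O) : dr f q = deriv (fun s => f (q.1, s)) q.2 :=
  (hasDerivAt_dr hO hf hq).deriv.symm

/-- Under the splitting of the tangent bundle of a product, the field is a smooth field on the plane
paired with the zero section over the sphere. -/
theorem contMDiffOn_timeField {ρ : ℝ → ℝ} {t₀ t₁ r₀ r₁ : EReal}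
    (hρ : ContDiffOn ℝ ∞ ρ (between t₀ t₁)) :
    ContMDiffOn modelX modelX.tangent ∞
      (fun x => (⟨x, (((ρ x.1.1, 0), 0) : EX)⟩ : TangentBundle modelX Event))
      (region t₀ t₁ r₀ r₁) := by
  have h1 : ContMDiffOn 𝓘(ℝ, ℝ × ℝ) (𝓘(ℝ, ℝ × ℝ).tangent) ∞
      (fun q : ℝ × ℝ => (⟨q, (ρ q.1, 0)⟩ : TangentBundle 𝓘(ℝ, ℝ × ℝ) (ℝ × ℝ)))
      {q | q.1 ∈ between t₀ t₁} :=
    contMDiffOn_vectorSpace_iff_contDiffOn.2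
      ((hρ.comp contDiffOn_fst fun q hq => hq).prodMk contDiffOn_const)
  have h2 : ContMDiffOn modelX (𝓘(ℝ, ℝ × ℝ).tangent) ∞
      (fun x : Event => (⟨x.1, (ρ x.1.1, 0)⟩ : TangentBundle 𝓘(ℝ, ℝ × ℝ) (ℝ × ℝ)))
      (region t₀ t₁ r₀ r₁) :=
    h1.comp contMDiff_fst_event.contMDiffOn fun x hx => hx.1
  have h3 : ContMDiff modelX ((𝓡 2).tangent) ∞
      (fun x : Event => (⟨x.2, 0⟩ : TangentBundle (𝓡 2) S2)) :=
    (Bundle.contMDiff_zeroSection ℝ (TangentSpace (𝓡 2) : S2 → Type _)).comp contMDiff_snd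
  exact (contMDiff_equivTangentBundleProd_symm (n := ∞)).comp_contMDiffOn
    (h2.prodMk h3.contMDiffOn)

namespace HasDiagonalForm

variable {t₀ t₁ r₀ r₁ : EReal} {g : BilinField modelX Event} {a b : ℝ × ℝ → ℝ}

/-- At the centre of the chart the conformal factor contributes no derivative, so the sphere enters
only through r² and the derivative `D` of the field. -/
theorem isKillingAt_iff (hg : HasDiagonalForm t₀ t₁ r₀ r₁ g a b) (hr₀ : 0 ≤ r₀)
    (K : (x : Event) → TX x) {x : Event} (hx : x ∈ region t₀ t₁ r₀ r₁) {D : EX →L[ℝ] EX}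
    (hD : HasFDerivAt (chartField K x) D (x.1, 0)) {X : EX} (hX : chartField K x (x.1, 0) = X) :
    IsKillingAt g K x ↔ ∀ v w : EX,
      -(2 * (dt a x.1 * X.1.1 + dr a x.1 * X.1.2)) * Real.exp (2 * a x.1) * (v.1.1 * w.1.1)
      + 2 * (dt b x.1 * X.1.1 + dr b x.1 * X.1.2) * Real.exp (2 * b x.1) * (v.1.2 * w.1.2)
      + 2 * x.1.2 * X.1.2 * inner ℝ v.2 w.2
      - Real.exp (2 * a x.1) * ((D v).1.1 * w.1.1 + v.1.1 * (D w).1.1)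
      + Real.exp (2 * b x.1) * ((D v).1.2 * w.1.2 + v.1.2 * (D w).1.2)
      + x.1.2 ^ 2 * (inner ℝ (D v).2 w.2 + inner ℝ v.2 (D w).2) = 0 := by
  have hG := hg.isDiagonalOn hr₀ x
  have hy : ((x.1, 0) : EX).1 ∈ between t₀ t₁ ×ˢ between r₀ r₁ := hx
  unfold IsKillingAt
  rw [extChartAt_event_self]
  refine forall₂_congr fun v w => ?_
  have e1 := hG.fderiv_apply hy X v w
  have e2 := hG.apply_eq _ hy (D v) w
  have e3 := hG.apply_eq _ hy v (D w)
  rw [hD.fderiv, hX]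
  rw [e1, e2, e3]
  simp only [conformalFactor_zero, inner_zero_left]
  ring_nf

end HasDiagonalForm

theorem eq_of_deriv_eq_zero_between {a b : EReal} {f : ℝ → ℝ}
    (hf : ∀ s ∈ between a b, HasDerivAt f 0 s) {x y : ℝ} (hx : x ∈ between a b)
    (hy : y ∈ between a b) : f x = f y :=
  (isOpen_between a b).is_const_of_deriv_eq_zero (ordConnected_between a b).isPreconnected
    (fun s hs => (hf s hs).differentiableAt.differentiableWithinAt) (fun s hs => (hf s hs).deriv)
    hx hy

theorem nonempty_S2 : Nonempty S2 := by
  obtain ⟨p, hp⟩ : ∃ p : E3, ‖p‖ = 1 := exists_norm_eq E3 zero_le_one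
  exact ⟨⟨p, by simpa using hp⟩⟩

section Converse

variable {t₀ t₁ r₀ r₁ : EReal} {g : BilinField modelX Event} {h p τ α β : ℝ → ℝ}

theorem hasDiagonalForm_of_static (hτ : ContDiffOn ℝ ∞ τ (between t₀ t₁))
    (hτ' : ∀ t ∈ between t₀ t₁, 0 < deriv τ t)
    (hg : ∀ x ∈ region t₀ t₁ r₀ r₁, ∀ v w : TX x, g x v w =
        -(p (rCoord x) ^ 2 * h (rCoord x)) *
            (differential (fun z => τ (tCoord z)) x v * differential (fun z => τ (tCoord z)) x w)
          + (h (rCoord x))⁻¹ * (differential rCoord x v * differential rCoord x w)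
          + rCoord x ^ 2 * roundMetric x v w)
    (hα : ContDiffOn ℝ ∞ α (between r₀ r₁)) (hβ : ContDiffOn ℝ ∞ β (between r₀ r₁))
    (hαβ : ∀ r ∈ between r₀ r₁, Real.exp (2 * β r) = (h r)⁻¹ ∧ Real.exp (2 * α r) = p r ^ 2 * h r) :
    HasDiagonalForm t₀ t₁ r₀ r₁ g (fun q => α q.2 + Real.log (deriv τ q.1)) (fun q => β q.2) where
  smooth_a := (hα.comp contDiffOn_snd fun q hq => hq.2).add
    (((contDiffOn_deriv (isOpen_between t₀ t₁) hτ).log fun t ht => (hτ' t ht).ne').comp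
      contDiffOn_fst fun q hq => hq.1)
  smooth_b := hβ.comp contDiffOn_snd fun q hq => hq.2
  apply_eq x hx v w := by
    have h1 : metricAt g x v w = _ := hg x hx v w
    have hd : DifferentiableAt ℝ τ x.1.1 :=
      (hasDerivAt_of_contDiffOn (isOpen_between t₀ t₁) hτ hx.1).differentiableAt
    rw [h1, differential_comp_tCoord x v hd, differential_comp_tCoord x w hd,
      differential_rCoord, differential_rCoord, roundMetric_apply]
    obtain ⟨e1, e2⟩ := hαβ x.1.2 hx.2
    have hlog : Real.exp (2 * Real.log (deriv τ x.1.1)) = deriv τ x.1.1 ^ 2 := by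
      rw [mul_comm, Real.exp_mul, Real.exp_log (hτ' _ hx.1)]
      norm_cast
    rw [mul_add, Real.exp_add, e1, e2, hlog]
    simp only [rCoord]
    ring

theorem dr_add_comp {φ ψ : ℝ → ℝ} {O : Set (ℝ × ℝ)} (hO : IsOpen O)
    (hf : ContDiffOn ℝ ∞ (fun q : ℝ × ℝ => φ q.2 + ψ q.1) O) {q : ℝ × ℝ} (hq : q ∈ O) :
    dr (fun q : ℝ × ℝ => φ q.2 + ψ q.1) q = deriv φ q.2 := by
  rw [dr_eq_deriv hO hf hq]
  simp

theorem dt_add_comp {φ ψ : ℝ → ℝ} {O : Set (ℝ × ℝ)} (hO : IsOpen O)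
    (hf : ContDiffOn ℝ ∞ (fun q : ℝ × ℝ => φ q.2 + ψ q.1) O) {q : ℝ × ℝ} (hq : q ∈ O) :
    dt (fun q : ℝ × ℝ => φ q.2 + ψ q.1) q = deriv ψ q.1 := by
  rw [dt_eq_deriv hO hf hq]
  simp

theorem dr_congr {f f' : ℝ × ℝ → ℝ} {O : Set (ℝ × ℝ)} (hO : IsOpen O) (h : EqOn f f' O)
    {q : ℝ × ℝ} (hq : q ∈ O) : dr f q = dr f' q := by
  have : f =ᶠ[𝓝 q] f' := by filter_upwards [hO.mem_nhds hq] with s hs using h hs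
  rw [dr, dr, this.fderiv_eq]

theorem dt_congr {f f' : ℝ × ℝ → ℝ} {O : Set (ℝ × ℝ)} (hO : IsOpen O) (h : EqOn f f' O)
    {q : ℝ × ℝ} (hq : q ∈ O) : dt f q = dt f' q := by
  have : f =ᶠ[𝓝 q] f' := by filter_upwards [hO.mem_nhds hq] with s hs using h hs
  rw [dt, dt, this.fderiv_eq]

theorem dr_comp_snd {φ : ℝ → ℝ} {q : ℝ × ℝ} (hφ : DifferentiableAt ℝ φ q.2) :
    dr (fun q : ℝ × ℝ => φ q.2) q = deriv φ q.2 := by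
  have hs : HasFDerivAt (fun q : ℝ × ℝ => q.2) (ContinuousLinearMap.snd ℝ ℝ ℝ) q := hasFDerivAt_snd
  have h : HasFDerivAt (fun q : ℝ × ℝ => φ q.2) _ q :=
    HasDerivAt.comp_hasFDerivAt (h₂ := φ) q hφ.hasDerivAt hs
  rw [dr, h.fderiv]
  simp

theorem dt_zero (q : ℝ × ℝ) : dt (fun _ => 0) q = 0 := by simp [dt]

/-- The field is e^{-ψ} ∂_t; for ψ = log τ' it is ∂_τ. The factor e^{-ψ} cancels a_t = ψ' in the
Killing equation. -/
theorem isStaticOn_of_separated {ψ : ℝ → ℝ} (hr₀ : 0 ≤ r₀)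
    (hg : HasDiagonalForm t₀ t₁ r₀ r₁ g (fun q => α q.2 + ψ q.1) (fun q => β q.2))
    (hψ : ContDiffOn ℝ ∞ ψ (between t₀ t₁)) : IsStaticOn g (region t₀ t₁ r₀ r₁) := by
  have hO := isOpen_rectangle t₀ t₁ r₀ r₁
  set a : ℝ × ℝ → ℝ := fun q => α q.2 + ψ q.1 with ha
  have hρ : ContDiffOn ℝ ∞ (fun t => Real.exp (-ψ t)) (between t₀ t₁) := hψ.neg.exp
  let K : (x : Event) → TX x := fun x => (((Real.exp (-ψ x.1.1), 0), 0) : EX)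
  have hK : ∀ x y, chartField K x y = ((Real.exp (-ψ y.1.1), 0), 0) := by
    intro x y
    apply chartInvDeriv_injective x y
    rw [chartInvDeriv_chartField, chartInvDeriv_base]
    have h1 : ((extChartAt modelX x).symm y).1 = y.1 := by rw [extChartAt_event_symm]
    have h2 : (K ((extChartAt modelX x).symm y) : EX) =
      ((Real.exp (-ψ ((extChartAt modelX x).symm y).1.1), 0), 0) := rfl
    rw [h2, h1]
  refine ⟨K, contMDiffOn_timeField hρ, fun x hx => ⟨?_, ?_, ?_⟩⟩
  · have h : metricAt g x ((Real.exp (-ψ x.1.1), 0), 0) ((Real.exp (-ψ x.1.1), 0), 0) < 0 := by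
      rw [hg.apply_eq x hx]
      simp only [mul_zero, add_zero, inner_zero_left]
      have h1 := Real.exp_pos (2 * a x.1)
      have h2 := Real.exp_pos (-ψ x.1.1)
      nlinarith [mul_pos h1 (mul_pos h2 h2)]
    exact h
  · have hψd := hasDerivAt_of_contDiffOn (isOpen_between t₀ t₁) hψ hx.1
    have hfst : HasFDerivAt (fun y : EX => y.1.1)
        ((ContinuousLinearMap.fst ℝ ℝ ℝ).comp (ContinuousLinearMap.fst ℝ (ℝ × ℝ) E2))
        ((x.1, 0) : EX) := hasFDerivAt_fst.comp ((x.1, 0) : EX) hasFDerivAt_fst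
    have h1 : HasFDerivAt (fun y : EX => Real.exp (-ψ y.1.1)) _ ((x.1, 0) : EX) :=
      HasDerivAt.comp_hasFDerivAt (h₂ := fun s => Real.exp (-ψ s)) ((x.1, 0) : EX)
        hψd.neg.exp hfst
    have hD : HasFDerivAt (chartField K x) _ ((x.1, 0) : EX) :=
      ((h1.prodMk (hasFDerivAt_const (0 : ℝ) _)).prodMk
        (hasFDerivAt_const (0 : E2) _)).congr_of_eventuallyEq
        (Filter.Eventually.of_forall fun y => hK x y)
    rw [hg.isKillingAt_iff hr₀ K hx hD (hK x (x.1, 0))]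
    intro v w
    have e1 : dt a x.1 = deriv ψ x.1.1 := dt_add_comp hO hg.smooth_a hx
    have e2 : dt (fun q : ℝ × ℝ => β q.2) x.1 = 0 := by
      rw [dt_eq_deriv hO hg.smooth_b hx]; simp
    rw [e1, e2]
    simp
    ring
  · intro v w hv hw
    have hG := hg.isDiagonalOn hr₀ x
    have hy : ((x.1, 0) : EX).1 ∈ between t₀ t₁ ×ˢ between r₀ r₁ := hx
    have hnhds := hG.isOpen_preimage.mem_nhds hy
    -- In the whole chart g(K, ·) is a multiple of dt. A constant vector w orthogonal to K at one
    -- point has no t-component, so g(K, w) vanishes nearby and so do its derivatives. Both sides of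
    -- the irrotationality condition are zero.
    have key : ∀ v w : EX, metricAt g x ((Real.exp (-ψ x.1.1), 0), 0) w = 0 →
        fderiv ℝ (fun y => chartMetric g x y (chartField K x y)) (extChartAt modelX x x) v w
          = 0 := by
      intro v w hw
      rw [hg.apply_eq x hx] at hw
      simp only [zero_mul, mul_zero, add_zero, inner_zero_left, mul_eq_zero, neg_eq_zero,
        Real.exp_ne_zero, false_or] at hw
      rw [extChartAt_event_self]
      have hψd : DifferentiableAt ℝ (fun y : EX => Real.exp (-ψ y.1.1)) (x.1, 0) := by
        have h1 := (hasDerivAt_of_contDiffOn (isOpen_between t₀ t₁) hψ hx.1).differentiableAt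
        exact DifferentiableAt.comp (g := fun s => Real.exp (-ψ s)) ((x.1, 0) : EX) h1.neg.exp
          (differentiableAt_fst.comp _ differentiableAt_fst)
      have hXd : DifferentiableAt ℝ (chartField K x) (x.1, 0) :=
        ((hψd.prodMk (differentiableAt_const (0 : ℝ))).prodMk
          (differentiableAt_const (0 : E2))).congr_of_eventuallyEq
          (Filter.Eventually.of_forall fun y => hK x y)
      have hGd : DifferentiableAt ℝ (chartMetric g x) (x.1, 0) :=
        (hG.contDiffOn.contDiffAt hnhds).differentiableAt (by simp)
      have h1 : fderiv ℝ (fun y => chartMetric g x y (chartField K x y) w) (x.1, 0) v =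
          fderiv ℝ (fun y => chartMetric g x y (chartField K x y)) (x.1, 0) v w := by
        rw [fderiv_clm_apply (hGd.clm_apply hXd) (differentiableAt_const w)]
        simp
      have h2 : (fun y => chartMetric g x y (chartField K x y) w) =ᶠ[𝓝 ((x.1, 0) : EX)]
          fun _ => 0 := by
        filter_upwards [hnhds] with y hy
        rw [hG.apply_eq y hy, hK]
        simp [hw]
      refine h1.symm.trans ?_
      rw [h2.fderiv_eq]
      simp
    exact (key v w hw).trans (key w v hv).symm

theorem HasStaticForm.converse (hr₀ : 0 ≤ r₀) {m₀ m₁ l : ℝ → ℝ} {c rs : ℝ}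
    (hrs : rs ∈ between r₀ r₁) (hm₀ : ContDiffOn ℝ ∞ m₀ (between r₀ r₁))
    (hm₁ : ContDiffOn ℝ ∞ m₁ (between r₀ r₁)) (hbound : MassBound r₀ r₁ m₀ c rs)
    (hl : ∀ r ∈ between r₀ r₁, l r = tovRHS m₀ m₁ c rs r)
    (hg : HasStaticForm t₀ t₁ r₀ r₁ g (hFun m₀ c rs) (pFun m₀ m₁ c rs)) :
    IsSphericallySymmetric t₀ t₁ r₀ r₁ g ∧ IsStaticOn g (region t₀ t₁ r₀ r₁) ∧
      HasDiagonalStress t₀ t₁ r₀ r₁ g (fun x => m₀ (rCoord x)) (fun x => m₁ (rCoord x))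
        (fun x => l (rCoord x)) := by
  obtain ⟨α, β, hp, rfl, hαβ⟩ := exists_staticProfile hr₀ hrs hm₀ hm₁ hbound
  obtain ⟨τ, hτ, hτ', hg⟩ := hg
  have hD := hasDiagonalForm_of_static hτ hτ' hg hp.smooth_α hp.smooth_β fun r hr => (hαβ r hr).2
  have hψ := (contDiffOn_deriv (isOpen_between t₀ t₁) hτ).log fun t ht => (hτ' t ht).ne'
  have hO := isOpen_rectangle t₀ t₁ r₀ r₁
  refine ⟨hD.isSphericallySymmetric hr₀,
    isStaticOn_of_separated (ψ := fun t => Real.log (deriv τ t)) hr₀ hD hψ, ?_⟩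
  rw [hD.hasDiagonalStress_iff hr₀]
  intro x hx
  have hx' : x.1 ∈ between t₀ t₁ ×ˢ between r₀ r₁ := hx
  have hJ := isOpen_between r₀ r₁
  have e1 : ∀ q ∈ between t₀ t₁ ×ˢ between r₀ r₁, dt (fun q : ℝ × ℝ => β q.2) q = 0 :=
    fun q hq => by rw [dt_eq_deriv hO hD.smooth_b hq]; simp
  have e2 : dt (dt (fun q : ℝ × ℝ => β q.2)) x.1 = 0 := by
    rw [dt_congr hO e1 hx', dt_zero]
  have e3 : dr (fun q : ℝ × ℝ => β q.2) x.1 = deriv β x.1.2 :=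
    dr_comp_snd (hasDerivAt_of_contDiffOn hJ hp.smooth_β hx.2).differentiableAt
  have e4 : EqOn (dr (fun q : ℝ × ℝ => α q.2 + Real.log (deriv τ q.1))) (fun q => deriv α q.2)
      (between t₀ t₁ ×ˢ between r₀ r₁) := fun q hq =>
    dr_add_comp (ψ := fun t => Real.log (deriv τ t)) hO hD.smooth_a hq
  have e5 : dr (dr (fun q : ℝ × ℝ => α q.2 + Real.log (deriv τ q.1))) x.1
      = deriv (deriv α) x.1.2 := by
    rw [dr_congr hO e4 hx']
    exact dr_comp_snd (hasDerivAt_of_contDiffOn hJ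
      (contDiffOn_deriv hJ hp.smooth_α) hx.2).differentiableAt
  refine ⟨e1 _ hx', ?_, ?_, ?_⟩
  · rw [e3]; exact hp.density _ hx.2
  · rw [e4 hx']; exact hp.pressure _ hx.2
  · rw [e5, e4 hx', e3, e2, e1 _ hx']
    have h1 : (l (rCoord x)) = _ := hl _ hx.2
    rw [h1]
    refine (hp.tovRHS_eq hrs hx.2).trans ?_
    ring

end Converse

/-! ### The direct part: separation of variables -/

section

namespace HasDiagonalForm

variable {t₀ t₁ r₀ r₁ : EReal} {g : BilinField modelX Event} {a b : ℝ × ℝ → ℝ} {tm rs : ℝ}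

theorem contDiffOn_radial {f : ℝ × ℝ → ℝ}
    (hf : ContDiffOn ℝ ∞ f (between t₀ t₁ ×ˢ between r₀ r₁)) (htm : tm ∈ between t₀ t₁) :
    ContDiffOn ℝ ∞ (fun r => f (tm, r)) (between r₀ r₁) :=
  hf.comp (contDiff_const.prodMk contDiff_id).contDiffOn fun _ hr => ⟨htm, hr⟩

theorem contDiffOn_temporal {f : ℝ × ℝ → ℝ}
    (hf : ContDiffOn ℝ ∞ f (between t₀ t₁ ×ˢ between r₀ r₁)) (hrs : rs ∈ between r₀ r₁) :
    ContDiffOn ℝ ∞ (fun t => f (t, rs)) (between t₀ t₁) :=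
  hf.comp (contDiff_id.prodMk contDiff_const).contDiffOn fun _ ht => ⟨ht, hrs⟩

theorem eq_of_dt_eq_zero {f : ℝ × ℝ → ℝ}
    (hf : ContDiffOn ℝ ∞ f (between t₀ t₁ ×ˢ between r₀ r₁))
    (h0 : ∀ q ∈ between t₀ t₁ ×ˢ between r₀ r₁, dt f q = 0) (htm : tm ∈ between t₀ t₁)
    {q : ℝ × ℝ} (hq : q ∈ between t₀ t₁ ×ˢ between r₀ r₁) : f q = f (tm, q.2) := by
  refine eq_of_deriv_eq_zero_between (f := fun s => f (s, q.2)) (fun s hs => ?_) hq.1 htm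
  have hs' : (s, q.2) ∈ between t₀ t₁ ×ˢ between r₀ r₁ := ⟨hs, hq.2⟩
  rw [← h0 _ hs']
  exact hasDerivAt_dt (isOpen_rectangle t₀ t₁ r₀ r₁) hf hs'

theorem eq_add_of_dr_eq (hg : HasDiagonalForm t₀ t₁ r₀ r₁ g a b) (htm : tm ∈ between t₀ t₁)
    (hrs : rs ∈ between r₀ r₁)
    (ha : ∀ q ∈ between t₀ t₁ ×ˢ between r₀ r₁, dr a q = dr a (tm, q.2))
    {q : ℝ × ℝ} (hq : q ∈ between t₀ t₁ ×ˢ between r₀ r₁) :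
    a q = a (tm, q.2) + (a (q.1, rs) - a (tm, rs)) := by
  have h := eq_of_deriv_eq_zero_between (a := r₀) (b := r₁)
    (f := fun s => a (q.1, s) - a (tm, s)) (fun s hs => ?_) hq.2 hrs
  · have : a q = a (q.1, q.2) := rfl
    linarith
  · have hO := isOpen_rectangle t₀ t₁ r₀ r₁
    have h1 : (q.1, s) ∈ between t₀ t₁ ×ˢ between r₀ r₁ := ⟨hq.1, hs⟩
    have h2 : (tm, s) ∈ between t₀ t₁ ×ˢ between r₀ r₁ := ⟨htm, hs⟩
    have h3 := (hasDerivAt_dr hO hg.smooth_a h1).fun_sub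
      (show HasDerivAt (fun s => a (tm, s)) (dr a (tm, s)) s from hasDerivAt_dr hO hg.smooth_a h2)
    rwa [ha _ h1, sub_self] at h3

theorem hasStaticForm (hg : HasDiagonalForm t₀ t₁ r₀ r₁ g a b) (htm : tm ∈ between t₀ t₁)
    (hrs : rs ∈ between r₀ r₁)
    (hb : ∀ q ∈ between t₀ t₁ ×ˢ between r₀ r₁, b q = b (tm, q.2))
    (ha : ∀ q ∈ between t₀ t₁ ×ˢ between r₀ r₁, a q = a (tm, q.2) + (a (q.1, rs) - a (tm, rs)))
    {h p : ℝ → ℝ} (hh : ∀ r ∈ between r₀ r₁, h r = Real.exp (-2 * b (tm, r)))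
    (hp : ∀ r ∈ between r₀ r₁,
      p r = Real.exp (a (tm, r) + b (tm, r) - (a (tm, rs) + b (tm, rs)))) :
    HasStaticForm t₀ t₁ r₀ r₁ g h p := by
  have hsm : ContDiffOn ℝ ∞ (fun t => Real.exp (a (t, rs) + b (tm, rs))) (between t₀ t₁) :=
    ((contDiffOn_temporal hg.smooth_a hrs).add contDiffOn_const).exp
  have hder := fun t (ht : t ∈ between t₀ t₁) => hasDerivAt_integral_of_contDiffOn hsm htm ht
  -- Since p = 1 and h = e^{-2b} at r = r_*, matching the time coefficient there requires τ' =
  -- e^{a(t, r_*) + b}; this explains the constant summand `b (tm, rs)`.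
  refine ⟨fun t => ∫ s in tm..t, Real.exp (a (s, rs) + b (tm, rs)),
    contDiffOn_integral hsm htm, fun t ht => ?_, fun x hx v w => ?_⟩
  · rw [(hder t ht).deriv]
    exact Real.exp_pos _
  · have h1 : metricAt g x v w = _ := hg.apply_eq x hx v w
    have hd := (hder x.1.1 hx.1)
    refine h1.trans ?_
    rw [differential_comp_tCoord x v hd.differentiableAt,
      differential_comp_tCoord x w hd.differentiableAt, hd.deriv,
      differential_rCoord x v, differential_rCoord x w, roundMetric_apply x v w]
    simp only [rCoord]
    rw [hh _ hx.2, hp _ hx.2, ha _ hx, hb _ hx, neg_mul 2, Real.exp_neg, inv_inv, ← Real.exp_neg]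
    have e : Real.exp (2 * (a (tm, x.1.2) + (a (x.1.1, rs) - a (tm, rs))))
        = Real.exp (a (tm, x.1.2) + b (tm, x.1.2) - (a (tm, rs) + b (tm, rs))) ^ 2
          * Real.exp (-(2 * b (tm, x.1.2))) * Real.exp (a (x.1.1, rs) + b (tm, rs)) ^ 2 := by
      rw [← Real.exp_nat_mul, ← Real.exp_nat_mul, ← Real.exp_add, ← Real.exp_add]
      congr 1
      push_cast
      ring
    rw [e]
    ring

end HasDiagonalForm

variable {t₀ t₁ r₀ r₁ : EReal} {g : BilinField modelX Event}

theorem IsSphericallySymmetric.exists_staticForm (ht : t₀ < t₁) (hr₀ : 0 ≤ r₀) (hr : r₀ < r₁)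
    {μ₀ μ₁ lam : Event → ℝ} {m₁ : ℝ → ℝ} (hg : IsSphericallySymmetric t₀ t₁ r₀ r₁ g)
    (hT : HasDiagonalStress t₀ t₁ r₀ r₁ g μ₀ μ₁ lam)
    (hμ₁ : ∀ x ∈ region t₀ t₁ r₀ r₁, μ₁ x = m₁ (rCoord x)) :
    ∃ m₀ : ℝ → ℝ,
      (∀ x ∈ region t₀ t₁ r₀ r₁, μ₀ x = m₀ (rCoord x)) ∧
      ContDiffOn ℝ ∞ m₀ (between r₀ r₁) ∧ ContDiffOn ℝ ∞ m₁ (between r₀ r₁) ∧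
      ∃ c : ℝ, ∃ rs ∈ between r₀ r₁,
        MassBound r₀ r₁ m₀ c rs ∧
        (∀ x ∈ region t₀ t₁ r₀ r₁, lam x = tovRHS m₀ m₁ c rs (rCoord x)) ∧
        HasStaticForm t₀ t₁ r₀ r₁ g (hFun m₀ c rs) (pFun m₀ m₁ c rs) := by
  obtain ⟨a, b, hD⟩ := hg.exists_diagonalForm
  rw [hD.hasDiagonalStress_iff hr₀] at hT
  obtain ⟨tm, htm⟩ := between_nonempty ht
  obtain ⟨rs, hrs⟩ := between_nonempty hr
  obtain ⟨p⟩ := nonempty_S2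
  have hO := isOpen_rectangle t₀ t₁ r₀ r₁
  have hJ := isOpen_between r₀ r₁
  have hpi := Real.pi_pos.ne'
  have hbt : ∀ q ∈ between t₀ t₁ ×ˢ between r₀ r₁, dt b q = 0 := fun q hq => (hT (q, p) hq).1
  have hb : ∀ q ∈ between t₀ t₁ ×ˢ between r₀ r₁, b q = b (tm, q.2) := fun q hq =>
    HasDiagonalForm.eq_of_dt_eq_zero hD.smooth_b hbt htm hq
  -- In the pressure equation everything except a_r is already known to depend on r only, so its
  -- values at times t and `tm` can be compared and a_r isolated.
  have hart : ∀ q ∈ between t₀ t₁ ×ˢ between r₀ r₁, dr a q = dr a (tm, q.2) := by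
    intro q hq
    have hq' : (tm, q.2) ∈ between t₀ t₁ ×ˢ between r₀ r₁ := ⟨htm, hq.2⟩
    have h1 := (hT (q, p) hq).2.2.1
    have h2 := (hT ((tm, q.2), p) hq').2.2.1
    rw [hμ₁ _ hq] at h1
    rw [hμ₁ _ hq'] at h2
    simp only [rCoord] at h1 h2
    rw [hb q hq, h2] at h1
    have he := (Real.exp_pos (-2 * b (tm, q.2))).ne'
    have hq0 := (pos_of_mem_between hr₀ hq.2).ne'
    have h3 := mul_left_cancel₀ he (sub_left_injective h1)
    have h4 := add_left_injective _ h3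
    field_simp at h4
    exact h4.symm
  have ha := fun q hq => hD.eq_add_of_dr_eq htm hrs hart (q := q) hq
  set α : ℝ → ℝ := fun r => a (tm, r) with hα
  set β : ℝ → ℝ := fun r => b (tm, r) with hβ
  have hα' : ∀ r ∈ between r₀ r₁, dr a (tm, r) = deriv α r := fun r hr =>
    dr_eq_deriv hO hD.smooth_a ⟨htm, hr⟩
  have hβs := HasDiagonalForm.contDiffOn_radial hD.smooth_b htm
  have hαs := HasDiagonalForm.contDiffOn_radial hD.smooth_a htm
  have ebr : ∀ q ∈ between t₀ t₁ ×ˢ between r₀ r₁, dr b q = deriv β q.2 := by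
    intro q hq
    rw [dr_congr hO (f' := fun q => β q.2) hb hq]
    exact dr_comp_snd (hasDerivAt_of_contDiffOn hJ hβs hq.2).differentiableAt
  have ear : EqOn (dr a) (fun q => deriv α q.2) (between t₀ t₁ ×ˢ between r₀ r₁) :=
    fun q hq => (hart q hq).trans (hα' _ hq.2)
  have earr : ∀ q ∈ between t₀ t₁ ×ˢ between r₀ r₁, dr (dr a) q = deriv (deriv α) q.2 := by
    intro q hq
    rw [dr_congr hO ear hq]
    exact dr_comp_snd (hasDerivAt_of_contDiffOn hJ (contDiffOn_deriv hJ hαs) hq.2).differentiableAt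
  have ebtt : ∀ q ∈ between t₀ t₁ ×ˢ between r₀ r₁, dt (dt b) q = 0 := by
    intro q hq
    rw [dt_congr hO (f' := fun _ => 0) hbt hq, dt_zero]
  -- The density is read off from β. The profile then gives smoothness of `m₀`, and also of `m₁`,
  -- about which only the pressure equation is known.
  let m₀ : ℝ → ℝ := fun r => (8 * Real.pi)⁻¹ *
    (Real.exp (-2 * β r) * (2 * deriv β r / r - 1 / r ^ 2) + 1 / r ^ 2)
  have hprof : IsStaticProfile r₀ r₁ α β m₀ m₁ := by
    refine ⟨hr₀, hαs, hβs, fun r hr => ?_, fun r hr => ?_⟩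
    · simp only [m₀]
      field_simp
    · have hx : (((tm, r), p) : Event) ∈ region t₀ t₁ r₀ r₁ := ⟨htm, hr⟩
      have h1 := (hT _ hx).2.2.1
      rw [hμ₁ _ hx] at h1
      dsimp only [rCoord] at h1
      rw [h1, hα' r hr]
  refine ⟨m₀, fun x hx => ?_, hprof.contDiffOn_density, hprof.contDiffOn_pressure,
    rs * (Real.exp (-2 * β rs) - 1), rs, hrs, hprof.massBound hrs, fun x hx => ?_,
    hD.hasStaticForm htm hrs hb ha (fun r hr => hprof.hFun_eq hrs hr)
      (fun r hr => hprof.pFun_eq hrs hr)⟩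
  · have h1 := (hT x hx).2.1
    have h2 := hprof.density x.1.2 hx.2
    rw [hb _ hx, ebr _ hx] at h1
    exact mul_left_cancel₀ (by positivity) (h1.trans h2.symm)
  · have h1 := (hT x hx).2.2.2
    have h2 := hprof.tovRHS_eq hrs hx.2
    rw [hb _ hx, ebr _ hx, earr _ hx, ear hx, ebtt _ hx, hbt _ hx] at h1
    refine mul_left_cancel₀ (a := 8 * Real.pi) (by positivity) (h1.trans (Eq.trans ?_ h2.symm))
    ring

end

/-! ### Great circles and differentiation along them -/

theorem hasDerivAt_parametric_integral {J : Set ℝ} (hJ : IsOpen J) {F : ℝ × ℝ → ℝ}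
    (hF : ContDiffOn ℝ ∞ F (J ×ˢ univ)) {s : ℝ} (hs : s ∈ J) {c d : ℝ} :
    HasDerivAt (fun s => ∫ θ in c..d, F (s, θ)) (∫ θ in c..d, dt F (s, θ)) s := by
  have hO : IsOpen (J ×ˢ (univ : Set ℝ)) := hJ.prod isOpen_univ
  have hF' := (contDiffOn_dt hO hF).continuousOn
  have hslice : ∀ x ∈ J, ∀ {H : ℝ × ℝ → ℝ}, ContinuousOn H (J ×ˢ univ) →
      Continuous fun θ => H (x, θ) := fun x hx H hH =>
    hH.comp_continuous (by fun_prop) fun θ => ⟨hx, mem_univ θ⟩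
  obtain ⟨ε, hε, hball⟩ := Metric.nhds_basis_closedBall.mem_iff.1 (hJ.mem_nhds hs)
  obtain ⟨C, hC⟩ := ((isCompact_closedBall s ε).prod
    (isCompact_uIcc (a := c) (b := d))).exists_bound_of_continuousOn
    (hF'.mono (prod_mono hball (subset_univ _)))
  refine (intervalIntegral.hasDerivAt_integral_of_dominated_loc_of_deriv_le
    (F := fun s θ => F (s, θ)) (F' := fun s θ => dt F (s, θ)) (bound := fun _ => C)
    (Metric.closedBall_mem_nhds s hε) ?_ ((hslice s hs hF.continuousOn).intervalIntegrable c d)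
    (hslice s hs hF').aestronglyMeasurable ?_ intervalIntegrable_const ?_).2
  · filter_upwards [hJ.mem_nhds hs] with x hx
    exact (hslice x hx hF.continuousOn).aestronglyMeasurable
  · exact Filter.Eventually.of_forall fun θ hθ x hx => hC (x, θ) ⟨hx, uIoc_subset_uIcc hθ⟩
  · exact Filter.Eventually.of_forall fun θ _ x hx =>
      hasDerivAt_dt hO hF (q := (x, θ)) ⟨hball hx, mem_univ θ⟩

section GreatCircle

variable {p q : S2}

/-- The great circle through the orthogonal points `p` and `q`. -/
def greatCircle (h : inner ℝ (p : E3) (q : E3) = 0) (θ : ℝ) : S2 :=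
  ⟨Real.cos θ • (p : E3) + Real.sin θ • (q : E3), by
    have hp : ‖(p : E3)‖ = 1 := by simp
    have hq : ‖(q : E3)‖ = 1 := by simp
    rw [mem_sphere_zero_iff_norm, ← sq_eq_sq₀ (norm_nonneg _) zero_le_one, norm_add_sq_real,
      norm_smul, norm_smul, inner_smul_left, inner_smul_right, h, hp, hq]
    simp⟩

/-- The velocity of the great circle through `p` and `q`. -/
def circleVelocity (p q : S2) (θ : ℝ) : E3 :=
  -Real.sin θ • (p : E3) + Real.cos θ • (q : E3)

theorem contMDiff_greatCircle (h : inner ℝ (p : E3) (q : E3) = 0) :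
    ContMDiff 𝓘(ℝ, ℝ) (𝓡 2) ∞ (greatCircle h) := by
  have := fact_finrank_E3
  refine ContMDiff.codRestrict_sphere (n := 2) (f := fun θ : ℝ =>
    Real.cos θ • (p : E3) + Real.sin θ • (q : E3)) ?_ _
  exact ((Real.contDiff_cos.smul contDiff_const).add
    (Real.contDiff_sin.smul contDiff_const)).contMDiff

theorem exists_sphereFrame_eq_circleVelocity (h : inner ℝ (p : E3) (q : E3) = 0) (θ : ℝ) :
    ∃ e : E2, ‖e‖ = 1 ∧ sphereFrame (greatCircle h θ) e = circleVelocity p q θ := by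
  have hp : ‖(p : E3)‖ = 1 := by simp
  have hq : ‖(q : E3)‖ = 1 := by simp
  obtain ⟨e, he⟩ := sphereFrame_surj (greatCircle h θ) (circleVelocity p q θ) (by
    simp only [greatCircle, circleVelocity, inner_add_left, inner_add_right, inner_smul_left,
      inner_smul_right, h, real_inner_comm (p : E3) (q : E3), real_inner_self_eq_norm_sq, hp, hq]
    simp
    ring)
  refine ⟨e, ?_, he⟩
  rw [← (sphereFrame (greatCircle h θ)).norm_map, he, ← sq_eq_sq₀ (norm_nonneg _) zero_le_one,
    circleVelocity, norm_add_sq_real, norm_smul, norm_smul, inner_smul_left, inner_smul_right, h,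
    hp, hq]
  simp

variable (h : inner ℝ (p : E3) (q : E3) = 0)

/-- In the chart centred at one of its points a great circle is a straight line through the origin;
arc length 2s corresponds to distance 2 tan s. -/
theorem stereoInv_greatCircle {θ s : ℝ} (hs : Real.cos s ≠ 0) {e : E2} (he : ‖e‖ = 1)
    (hv : sphereFrame (greatCircle h θ) e = circleVelocity p q θ) :
    stereoInv (greatCircle h θ) ((2 * Real.tan s) • e) = greatCircle h (θ + 2 * s) := by
  have h1 : ‖(2 * Real.tan s) • e‖ ^ 2 = 4 * Real.tan s ^ 2 := by
    rw [norm_smul, he, Real.norm_eq_abs, mul_one, sq_abs]; ring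
  have h2 : (4 * Real.tan s ^ 2 + 4)⁻¹ = Real.cos s ^ 2 / 4 := by
    rw [Real.tan_eq_sin_div_cos]
    field_simp
    rw [Real.sin_sq_add_cos_sq]
  rw [stereoInv, h1, h2, map_smul, hv, Real.tan_eq_sin_div_cos]
  simp only [greatCircle, circleVelocity]
  rw [Real.cos_add, Real.sin_add, Real.cos_two_mul', Real.sin_two_mul]
  match_scalars
  · field_simp
    ring
  · field_simp
    ring

/-- Derivative of the preceding parametrization in s, halved on both sides: the angle moves at speed
2 and 2 tan s at speed 2 / cos² s. -/
theorem fderiv_stereoInv_greatCircle {θ s : ℝ} (hs : Real.cos s ≠ 0) {e : E2} (he : ‖e‖ = 1)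
    (hv : sphereFrame (greatCircle h θ) e = circleVelocity p q θ) :
    fderiv ℝ (stereoInv (greatCircle h θ)) ((2 * Real.tan s) • e) ((Real.cos s ^ 2)⁻¹ • e)
      = circleVelocity p q (θ + 2 * s) := by
  have h1 : ‖(2 * Real.tan s) • e‖ ^ 2 = 4 * Real.tan s ^ 2 := by
    rw [norm_smul, he, Real.norm_eq_abs, mul_one, sq_abs]; ring
  have h2 : 4 * Real.tan s ^ 2 + 4 = 4 / Real.cos s ^ 2 := by
    rw [Real.tan_eq_sin_div_cos]
    field_simp
    rw [Real.sin_sq_add_cos_sq]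
  have h3 : Real.cos s ^ 2 = 1 - Real.sin s ^ 2 := Real.cos_sq' s
  rw [fderiv_stereoInv, h1, h2, map_smul, map_smul, hv, Real.tan_eq_sin_div_cos, inner_smul_left,
    inner_smul_right, real_inner_self_eq_norm_sq, he]
  simp only [greatCircle, circleVelocity]
  rw [Real.cos_add, Real.sin_add, Real.cos_two_mul', Real.sin_two_mul]
  match_scalars
  · simp
    field_simp
    grind
  · simp
    field_simp
    grind

/-- The tangential component of K along the circle is cos² times the chart component along `e`: the
conformal factor is cos⁴ and the chart velocity has length cos⁻². As cos² is stationary at the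
centre, only the derivative of the chart field remains. -/
theorem hasDerivAt_circle {K : (x : Event) → TX x} {z : ℝ × ℝ} {θ : ℝ} {D : EX →L[ℝ] EX}
    (hD : HasFDerivAt (chartField K (z, greatCircle h θ)) D (z, 0)) {e : E2} (he : ‖e‖ = 1)
    (hv : sphereFrame (greatCircle h θ) e = circleVelocity p q θ) :
    HasDerivAt (fun s => inner ℝ (sphereFrame (greatCircle h s) (K (z, greatCircle h s) : EX).2)
      (circleVelocity p q s)) (inner ℝ (D (0, e)).2 e) θ := by
  have hγ : HasDerivAt (fun s : ℝ => ((z, (2 * Real.tan ((s - θ) / 2)) • e) : EX)) (0, e) θ := by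
    have h1 : HasDerivAt (fun s : ℝ => (s - θ) / 2) (1 / 2) θ :=
      ((hasDerivAt_id θ).sub_const θ).div_const 2
    have h2 : HasDerivAt Real.tan (1 / Real.cos ((θ - θ) / 2) ^ 2) ((θ - θ) / 2) :=
      Real.hasDerivAt_tan (by simp)
    have h3 := (((h2.comp θ h1).const_mul 2).smul_const e)
    refine (hasDerivAt_const θ z).prodMk (h3.congr_deriv ?_)
    simp
  have hD' : HasFDerivAt (chartField K (z, greatCircle h θ)) D
      (z, (2 * Real.tan ((θ - θ) / 2)) • e) := by simpa using hD
  have h4 := hD'.comp_hasDerivAt θ hγ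
  have hcos : HasDerivAt (fun s : ℝ => Real.cos ((s - θ) / 2) ^ 2) 0 θ := by
    have h1 : HasDerivAt (fun s : ℝ => (s - θ) / 2) (1 / 2) θ :=
      ((hasDerivAt_id θ).sub_const θ).div_const 2
    refine (h1.cos.pow 2).congr_deriv ?_
    simp
  have h5 : HasDerivAt (fun s : ℝ => ((chartField K (z, greatCircle h θ)
      (z, (2 * Real.tan ((s - θ) / 2)) • e)).2 : E2)) (D (0, e)).2 θ :=
    ((ContinuousLinearMap.snd ℝ (ℝ × ℝ) E2).hasFDerivAt).comp_hasDerivAt θ h4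
  have h6 := hcos.mul (h5.inner ℝ (hasDerivAt_const θ e))
  refine (h6.congr_deriv (by simp)).congr_of_eventuallyEq ?_
  have hev : ∀ᶠ s in 𝓝 θ, Real.cos ((s - θ) / 2) ≠ 0 := by
    have hc : ContinuousAt (fun s : ℝ => Real.cos ((s - θ) / 2)) θ := by fun_prop
    exact hc.eventually_ne (by simp)
  filter_upwards [hev] with s hs
  have hs2 : θ + 2 * ((s - θ) / 2) = s := by ring
  set x : Event := (z, greatCircle h θ)
  set y : EX := (z, (2 * Real.tan ((s - θ) / 2)) • e) with hy
  have hsymm : (extChartAt modelX x).symm y = (z, greatCircle h s) := by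
    rw [extChartAt_event_symm]
    refine Prod.ext rfl (Subtype.ext ?_)
    refine (coe_extChartAt_symm _ _).trans ?_
    refine (stereoInv_greatCircle h hs he hv).trans ?_
    rw [hs2]
  have e1 : sphereFrame (greatCircle h s) (K (z, greatCircle h s) : EX).2 =
      fderiv ℝ (stereoInv (greatCircle h θ)) y.2 (chartField K x y).2 := by
    have h7 := sphereFrame_chartInvDeriv x y (chartField K x y)
    rw [chartInvDeriv_chartField, hsymm] at h7
    exact h7
  have e2 := fderiv_stereoInv_greatCircle h hs he hv
  rw [hs2] at e2
  rw [e1, ← e2, inner_fderiv_stereoInv, inner_smul_right]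
  have hn : ‖y.2‖ ^ 2 = 4 * Real.tan ((s - θ) / 2) ^ 2 := by
    rw [hy, norm_smul, he, Real.norm_eq_abs, mul_one, sq_abs]; ring
  have h2 : 4 * Real.tan ((s - θ) / 2) ^ 2 + 4 = 4 / Real.cos ((s - θ) / 2) ^ 2 := by
    rw [Real.tan_eq_sin_div_cos]
    field_simp
    rw [Real.sin_sq_add_cos_sq]
  simp only [conformalFactor, Pi.mul_apply]
  rw [hn, h2]
  field_simp
  norm_num
  rfl

end GreatCircle

/-! ### Averaging a Killing field over a great circle -/

section

theorem integral_ne_zero_of_forall_ne_zero {f : ℝ → ℝ} (hf : Continuous f) (h0 : ∀ θ, f θ ≠ 0)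
    {c d : ℝ} (hcd : c < d) : ∫ θ in c..d, f θ ≠ 0 := by
  have hsign : (∀ θ, 0 < f θ) ∨ ∀ θ, f θ < 0 := by
    by_contra! h
    obtain ⟨θ, hθ⟩ := mem_range_of_exists_le_of_exists_ge hf h.1 h.2
    exact h0 θ hθ
  rcases hsign with h | h
  · exact (intervalIntegral.intervalIntegral_pos_of_pos (hf.intervalIntegrable c d) h hcd).ne'
  · have := intervalIntegral.intervalIntegral_pos_of_pos (hf.neg.intervalIntegrable c d)
      (fun θ => neg_pos.2 (h θ)) hcd
    simp only [Pi.neg_apply, intervalIntegral.integral_neg] at this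
    exact (neg_pos.1 this).ne

theorem exists_orthogonal_S2 : ∃ p q : S2, inner ℝ (p : E3) (q : E3) = 0 :=
  ⟨⟨EuclideanSpace.single 0 1, by simp⟩, ⟨EuclideanSpace.single 1 1, by simp⟩, by
    simp [EuclideanSpace.inner_single_left]⟩

theorem extChartAt_event_symm_zero (x : Event) (d : ℝ × ℝ) :
    (extChartAt modelX x).symm ((d, 0) : EX) = (d, x.2) := by
  rw [extChartAt_event_symm]
  refine Prod.ext rfl (Subtype.ext ?_)
  refine (coe_extChartAt_symm _ _).trans ?_
  simp [stereoInv]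

theorem chartField_base (K : (x : Event) → TX x) (x : Event) :
    chartField K x ((x.1, 0) : EX) = (K x : EX) := by
  have h1 := chartInvDeriv_chartField K x (extChartAt modelX x x)
  rw [chartInvDeriv_self, extChartAt_event_self, extChartAt_event_symm_zero] at h1
  exact h1

theorem chartField_fst (K : (x : Event) → TX x) (x : Event) (d : ℝ × ℝ) :
    (chartField K x ((d, 0) : EX)).1 = (K (d, x.2) : EX).1 := by
  have h1 := chartInvDeriv_chartField K x ((d, 0) : EX)
  rw [extChartAt_event_symm_zero] at h1
  have h2 := chartInvDeriv_fst x ((d, 0) : EX) (chartField K x ((d, 0) : EX))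
  rw [h1] at h2
  exact h2.symm

/-- Moving in t and r keeps the sphere coordinate at the centre of the chart, so the coordinate
derivative `D` is the ordinary derivative of the (t, r)-components of K. -/
theorem hasDerivAt_field_fst {K : (x : Event) → TX x} {x : Event} {D : EX →L[ℝ] EX}
    (hD : HasFDerivAt (chartField K x) D (x.1, 0)) {c : ℝ → ℝ × ℝ} {c' : ℝ × ℝ} {s : ℝ}
    (hc : HasDerivAt c c' s) (hs : c s = x.1) :
    HasDerivAt (fun s => (K (c s, x.2) : EX).1) (D (c', 0)).1 s := by
  have h1 : HasDerivAt (fun s => ((c s, 0) : EX)) (c', 0) s := hc.prodMk (hasDerivAt_const s 0)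
  rw [← hs] at hD
  have h2 := ((ContinuousLinearMap.fst ℝ (ℝ × ℝ) E2).hasFDerivAt).comp_hasDerivAt s
    (hD.comp_hasDerivAt s h1)
  refine h2.congr_of_eventuallyEq (Filter.Eventually.of_forall fun u => ?_)
  exact (chartField_fst K x (c u)).symm

namespace HasDiagonalForm

variable {t₀ t₁ r₀ r₁ : EReal} {g : BilinField modelX Event} {a b : ℝ × ℝ → ℝ}

theorem killing_equations (hg : HasDiagonalForm t₀ t₁ r₀ r₁ g a b) (hr₀ : 0 ≤ r₀)
    {K : (x : Event) → TX x} {x : Event} (hx : x ∈ region t₀ t₁ r₀ r₁) {D : EX →L[ℝ] EX}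
    (hD : HasFDerivAt (chartField K x) D (x.1, 0)) (hK : IsKillingAt g K x)
    {X : EX} (hX : (K x : EX) = X) :
    (D ((1, 0), 0)).1.1 = -(dt a x.1 * X.1.1 + dr a x.1 * X.1.2) ∧
    (D ((0, 1), 0)).1.2 = -(dt b x.1 * X.1.1 + dr b x.1 * X.1.2) ∧
    (D ((0, 1), 0)).1.1 = Real.exp (2 * b x.1 - 2 * a x.1) * (D ((1, 0), 0)).1.2 ∧
    ∀ e : E2, ‖e‖ = 1 → inner ℝ (D (0, e)).2 e = -(X.1.2 / x.1.2) := by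
  have hr := (pos_of_mem_between hr₀ hx.2).ne'
  have ea := (Real.exp_pos (2 * a x.1)).ne'
  have eb := (Real.exp_pos (2 * b x.1)).ne'
  have h := (hg.isKillingAt_iff hr₀ K hx hD ((chartField_base K x).trans hX)).1 hK
  refine ⟨?_, ?_, ?_, fun e he => ?_⟩
  · have h1 := h ((1, 0), 0) ((1, 0), 0)
    simp only [mul_one, mul_zero, one_mul, zero_mul, inner_zero_left, inner_zero_right,
      add_zero] at h1
    refine mul_left_cancel₀ ea ?_
    linarith
  · have h1 := h ((0, 1), 0) ((0, 1), 0)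
    simp only [mul_one, mul_zero, one_mul, zero_mul, inner_zero_left, inner_zero_right,
      add_zero] at h1
    refine mul_left_cancel₀ eb ?_
    linarith
  · have h1 := h ((1, 0), 0) ((0, 1), 0)
    simp only [mul_one, mul_zero, one_mul, zero_mul, inner_zero_left, inner_zero_right,
      add_zero, zero_add] at h1
    rw [Real.exp_sub]
    field_simp
    linarith
  · have h1 := h (0, e) (0, e)
    simp only [Prod.fst_zero, Prod.snd_zero, mul_zero, zero_mul, add_zero, zero_add, sub_zero,
      real_inner_self_eq_norm_sq, he, real_inner_comm (D (0, e)).2 e] at h1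
    field_simp
    refine mul_left_cancel₀ hr ?_
    linarith

theorem ne_zero_of_timelike (hg : HasDiagonalForm t₀ t₁ r₀ r₁ g a b) {x : Event}
    (hx : x ∈ region t₀ t₁ r₀ r₁) {X : EX} (hX : metricAt g x X X < 0) : X.1.1 ≠ 0 := by
  intro h0
  rw [hg.apply_eq x hx, h0, real_inner_self_eq_norm_sq] at hX
  have h1 := mul_nonneg (Real.exp_pos (2 * b x.1)).le (mul_self_nonneg X.1.2)
  have h2 := mul_nonneg (sq_nonneg x.1.2) (sq_nonneg ‖X.2‖)
  linarith

/-- Integrating over a closed great circle removes the dependence of K on the sphere point and kills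
the radial component, while the time component survives because it never changes sign. -/
theorem static_of_killing (hg : HasDiagonalForm t₀ t₁ r₀ r₁ g a b) (hr₀ : 0 ≤ r₀)
    {K : (x : Event) → TX x}
    (hsmooth : ContMDiffOn modelX modelX.tangent ∞
      (fun x => (⟨x, K x⟩ : TangentBundle modelX Event)) (region t₀ t₁ r₀ r₁))
    (htime : ∀ x ∈ region t₀ t₁ r₀ r₁, g x (K x) (K x) < 0)
    (hkill : ∀ x ∈ region t₀ t₁ r₀ r₁, IsKillingAt g K x) {z : ℝ × ℝ}
    (hz : z ∈ between t₀ t₁ ×ˢ between r₀ r₁) : dt b z = 0 ∧ dt (dr a) z = 0 := by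
  obtain ⟨p, q, hpq⟩ := exists_orthogonal_S2
  have hO := isOpen_rectangle t₀ t₁ r₀ r₁
  have hI := isOpen_between t₀ t₁
  have hJ := isOpen_between r₀ r₁
  set γ := greatCircle hpq with hγ
  let κ : ℝ × ℝ → ℝ → ℝ × ℝ := fun z θ => (K (z, γ θ) : EX).1
  let D : ℝ × ℝ → ℝ → EX →L[ℝ] EX := fun z θ => fderiv ℝ (chartField K (z, γ θ)) ((z, 0) : EX)
  have hκ : ContDiffOn ℝ ∞ (fun y : (ℝ × ℝ) × ℝ => κ y.1 y.2)
      ((between t₀ t₁ ×ˢ between r₀ r₁) ×ˢ univ) := by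
    have h1 := contMDiffOn_mfderiv_apply contMDiff_fst_event hsmooth
    have h2 : ContMDiff 𝓘(ℝ, (ℝ × ℝ) × ℝ) modelX ∞
        (fun y : (ℝ × ℝ) × ℝ => ((y.1, γ y.2) : Event)) :=
      contDiff_fst.contMDiff.prodMk ((contMDiff_greatCircle hpq).comp contDiff_snd.contMDiff)
    have h3 := (h1.comp (h2.contMDiffOn (s := (between t₀ t₁ ×ˢ between r₀ r₁) ×ˢ univ))
      fun y hy => hy.1).contDiffOn
    exact h3.congr fun y _ => (mfderiv_fst_apply (y.1, γ y.2) (K (y.1, γ y.2))).symm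
  have hcont : ∀ z ∈ between t₀ t₁ ×ˢ between r₀ r₁, Continuous (κ z) := fun z hz =>
    hκ.continuousOn.comp_continuous (continuous_const.prodMk continuous_id)
      fun θ => ⟨hz, mem_univ θ⟩
  have hD : ∀ z ∈ between t₀ t₁ ×ˢ between r₀ r₁, ∀ θ,
      HasFDerivAt (chartField K (z, γ θ)) (D z θ) ((z, 0) : EX) := by
    intro z hz θ
    have h1 := contDiffAt_chartField (isOpen_region t₀ t₁ r₀ r₁) hsmooth (x := (z, γ θ)) hz
    rw [extChartAt_event_self] at h1
    exact (h1.differentiableAt (by simp)).hasFDerivAt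
  have hkil := fun z (hz : z ∈ between t₀ t₁ ×ˢ between r₀ r₁) θ =>
    hg.killing_equations hr₀ (x := (z, γ θ)) hz (hD z hz θ) (hkill _ hz) rfl
  let A : ℝ × ℝ → ℝ := fun z => ∫ θ in (0 : ℝ)..2 * Real.pi, (κ z θ).1
  -- The integrand is -r times the derivative of the tangential component of K along the circle, and
  -- that component returns to its initial value after a full turn.
  have hR : ∀ z ∈ between t₀ t₁ ×ˢ between r₀ r₁, ∫ θ in (0 : ℝ)..2 * Real.pi, (κ z θ).2 = 0 := by
    intro z hz
    have hz0 := (pos_of_mem_between hr₀ hz.2).ne'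
    have hder : ∀ θ : ℝ, HasDerivAt (fun s => inner ℝ (sphereFrame (γ s) (K (z, γ s) : EX).2)
        (circleVelocity p q s)) (-((κ z θ).2 / z.2)) θ := by
      intro θ
      obtain ⟨e, he, hv⟩ := exists_sphereFrame_eq_circleVelocity hpq θ
      rw [← (hkil z hz θ).2.2.2 e he]
      exact hasDerivAt_circle hpq (hD z hz θ) he hv
    have hintegral := intervalIntegral.integral_eq_sub_of_hasDerivAt (a := 0) (b := 2 * Real.pi)
      (fun θ _ => hder θ)
      (Continuous.intervalIntegrable (((hcont z hz).snd.div_const _).neg) _ _)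
    have hper : γ (2 * Real.pi) = γ 0 := Subtype.ext (by simp [hγ, greatCircle])
    rw [hper] at hintegral
    simp only [circleVelocity, Real.sin_two_pi, Real.cos_two_pi, Real.sin_zero, Real.cos_zero,
      sub_self, intervalIntegral.integral_neg, intervalIntegral.integral_div, neg_eq_zero,
      div_eq_zero_iff, hz0, or_false] at hintegral
    exact hintegral
  have hlin : ∀ z ∈ between t₀ t₁ ×ˢ between r₀ r₁, ∀ c d : ℝ,
      ∫ θ in (0 : ℝ)..2 * Real.pi, -(c * (κ z θ).1 + d * (κ z θ).2) = -(c * A z) := by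
    intro z hz c d
    have h1 : Continuous fun θ => c * (κ z θ).1 := continuous_const.mul (hcont z hz).fst
    have h2 : Continuous fun θ => d * (κ z θ).2 := continuous_const.mul (hcont z hz).snd
    rw [intervalIntegral.integral_neg,
      intervalIntegral.integral_add (h1.intervalIntegrable _ _) (h2.intervalIntegrable _ _),
      intervalIntegral.integral_const_mul, intervalIntegral.integral_const_mul, hR z hz]
    simp [A]
  have hderT : ∀ (L : ℝ × ℝ →L[ℝ] ℝ), ∀ z ∈ between t₀ t₁ ×ˢ between r₀ r₁,
      HasDerivAt (fun s => ∫ θ in (0 : ℝ)..2 * Real.pi, L (κ (s, z.2) θ))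
        (∫ θ in (0 : ℝ)..2 * Real.pi, L (D z θ ((1, 0), 0)).1) z.1 := by
    intro L z hz
    have hF : ContDiffOn ℝ ∞ (fun y : ℝ × ℝ => L (κ (y.1, z.2) y.2)) (between t₀ t₁ ×ˢ univ) :=
      L.contDiff.comp_contDiffOn (hκ.comp
        ((contDiff_fst.prodMk contDiff_const).prodMk contDiff_snd).contDiffOn
        fun y hy => ⟨⟨hy.1, hz.2⟩, mem_univ _⟩)
    refine (hasDerivAt_parametric_integral hI hF hz.1).congr_deriv
      (intervalIntegral.integral_congr fun θ _ => ?_)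
    have h1 := hasDerivAt_dt (hI.prod isOpen_univ) hF (q := (z.1, θ)) ⟨hz.1, mem_univ θ⟩
    have h2 := hasDerivAt_field_fst (hD z hz θ) (c := fun s => (s, z.2)) (s := z.1)
      ((hasDerivAt_id z.1).prodMk (hasDerivAt_const z.1 z.2)) rfl
    exact h1.unique (L.hasFDerivAt.comp_hasDerivAt z.1 h2)
  have hderR : ∀ (L : ℝ × ℝ →L[ℝ] ℝ), ∀ z ∈ between t₀ t₁ ×ˢ between r₀ r₁,
      HasDerivAt (fun s => ∫ θ in (0 : ℝ)..2 * Real.pi, L (κ (z.1, s) θ))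
        (∫ θ in (0 : ℝ)..2 * Real.pi, L (D z θ ((0, 1), 0)).1) z.2 := by
    intro L z hz
    have hF : ContDiffOn ℝ ∞ (fun y : ℝ × ℝ => L (κ (z.1, y.1) y.2)) (between r₀ r₁ ×ˢ univ) :=
      L.contDiff.comp_contDiffOn (hκ.comp
        ((contDiff_const.prodMk contDiff_fst).prodMk contDiff_snd).contDiffOn
        fun y hy => ⟨⟨hz.1, hy.1⟩, mem_univ _⟩)
    refine (hasDerivAt_parametric_integral hJ hF hz.2).congr_deriv
      (intervalIntegral.integral_congr fun θ _ => ?_)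
    have h1 := hasDerivAt_dt (hJ.prod isOpen_univ) hF (q := (z.2, θ)) ⟨hz.2, mem_univ θ⟩
    have h2 := hasDerivAt_field_fst (hD z hz θ) (c := fun s => (z.1, s)) (s := z.2)
      ((hasDerivAt_const z.2 z.1).prodMk (hasDerivAt_id z.2)) rfl
    exact h1.unique (L.hasFDerivAt.comp_hasDerivAt z.2 h2)
  have hRt : ∀ z ∈ between t₀ t₁ ×ˢ between r₀ r₁,
      ∫ θ in (0 : ℝ)..2 * Real.pi, (D z θ ((1, 0), 0)).1.2 = 0 := by
    intro z hz
    refine (hderT (ContinuousLinearMap.snd ℝ ℝ ℝ) z hz).unique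
      ((hasDerivAt_const z.1 (0 : ℝ)).congr_of_eventuallyEq ?_)
    filter_upwards [hI.mem_nhds hz.1] with s hs using hR (s, z.2) ⟨hs, hz.2⟩
  have hRr : ∀ z ∈ between t₀ t₁ ×ˢ between r₀ r₁,
      ∫ θ in (0 : ℝ)..2 * Real.pi, (D z θ ((0, 1), 0)).1.2 = 0 := by
    intro z hz
    refine (hderR (ContinuousLinearMap.snd ℝ ℝ ℝ) z hz).unique
      ((hasDerivAt_const z.2 (0 : ℝ)).congr_of_eventuallyEq ?_)
    filter_upwards [hJ.mem_nhds hz.2] with s hs using hR (z.1, s) ⟨hz.1, hs⟩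
  have hA0 : ∀ z ∈ between t₀ t₁ ×ˢ between r₀ r₁, A z ≠ 0 := fun z hz =>
    integral_ne_zero_of_forall_ne_zero (hcont z hz).fst
      (fun θ => hg.ne_zero_of_timelike (x := (z, γ θ)) hz (htime _ hz)) Real.two_pi_pos
  -- The (t, r) Killing equation makes A_r a multiple of the t-derivative of the integral of K^r,
  -- which is zero.
  have hAr : ∀ z ∈ between t₀ t₁ ×ˢ between r₀ r₁,
      HasDerivAt (fun s => A (z.1, s)) 0 z.2 := by
    intro z hz
    refine (hderR (ContinuousLinearMap.fst ℝ ℝ ℝ) z hz).congr_deriv ?_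
    refine (intervalIntegral.integral_congr fun θ _ => (hkil z hz θ).2.2.1).trans ?_
    dsimp only
    rw [intervalIntegral.integral_const_mul, hRt z hz, mul_zero]
  have hAt : ∀ z ∈ between t₀ t₁ ×ˢ between r₀ r₁,
      HasDerivAt (fun s => A (s, z.2)) (-(dt a z * A z)) z.1 := by
    intro z hz
    refine (hderT (ContinuousLinearMap.fst ℝ ℝ ℝ) z hz).congr_deriv ?_
    rw [← hlin z hz _ (dr a z)]
    exact intervalIntegral.integral_congr fun θ _ => (hkil z hz θ).1
  have hAconst : ∀ t ∈ between t₀ t₁, ∀ r ∈ between r₀ r₁, ∀ s ∈ between r₀ r₁,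
      A (t, r) = A (t, s) := fun t ht r hr s hs =>
    eq_of_deriv_eq_zero_between (f := fun s => A (t, s)) (fun s hs => hAr (t, s) ⟨ht, hs⟩) hr hs
  constructor
  · have h1 : -(dt b z * A z) = 0 := by
      rw [← hlin z hz _ (dr b z)]
      refine Eq.trans ?_ (hRr z hz)
      exact intervalIntegral.integral_congr fun θ _ => ((hkil z hz θ).2.1).symm
    simpa [hA0 z hz] using h1
  -- Since A does not depend on r, the equation A_t = -a_t A gives the same a_t at every radius.
  · rw [← dr_dt_eq_dt_dr hO hg.smooth_a hz]
    refine (hasDerivAt_dr hO (contDiffOn_dt hO hg.smooth_a) hz).unique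
      ((hasDerivAt_const z.2 (dt a z)).congr_of_eventuallyEq ?_)
    filter_upwards [hJ.mem_nhds hz.2] with s hs
    have h1 := hAt (z.1, s) ⟨hz.1, hs⟩
    have h2 : HasDerivAt (fun u => A (u, s)) (-(dt a z * A z)) z.1 := by
      refine (hAt z hz).congr_of_eventuallyEq ?_
      filter_upwards [hI.mem_nhds hz.1] with u hu using hAconst u hu s hs z.2 hz.2
    have h3 := neg_injective (h1.unique h2)
    rw [hAconst z.1 hz.1 s hs z.2 hz.2] at h3
    exact mul_right_cancel₀ (hA0 z hz) h3

end HasDiagonalForm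

variable {t₀ t₁ r₀ r₁ : EReal} {g : BilinField modelX Event}

theorem IsSphericallySymmetric.exists_staticForm_of_static (ht : t₀ < t₁) (hr₀ : 0 ≤ r₀)
    (hr : r₀ < r₁) (hg : IsSphericallySymmetric t₀ t₁ r₀ r₁ g)
    (hs : IsStaticOn g (region t₀ t₁ r₀ r₁)) :
    ∃ m₀ m₁ l : ℝ → ℝ,
      ContDiffOn ℝ ∞ m₀ (between r₀ r₁) ∧ ContDiffOn ℝ ∞ m₁ (between r₀ r₁) ∧
      HasDiagonalStress t₀ t₁ r₀ r₁ g (fun x => m₀ (rCoord x))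
        (fun x => m₁ (rCoord x)) (fun x => l (rCoord x)) ∧
      ∃ c : ℝ, ∃ rs ∈ between r₀ r₁,
        MassBound r₀ r₁ m₀ c rs ∧
        (∀ r ∈ between r₀ r₁, l r = tovRHS m₀ m₁ c rs r) ∧
        HasStaticForm t₀ t₁ r₀ r₁ g (hFun m₀ c rs) (pFun m₀ m₁ c rs) := by
  obtain ⟨a, b, hD⟩ := hg.exists_diagonalForm
  obtain ⟨K, hK, hK'⟩ := hs
  have hO := isOpen_rectangle t₀ t₁ r₀ r₁
  have hstat := fun z hz => hD.static_of_killing hr₀ hK (fun x hx => (hK' x hx).1)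
    (fun x hx => (hK' x hx).2.1) (z := z) hz
  obtain ⟨tm, htm⟩ := between_nonempty ht
  have hpi := Real.pi_pos.ne'
  -- The pressure is evaluated at the fixed time `tm`; because b and a_r do not depend on t, this is
  -- the pressure at all times, as the direct part requires.
  let m₁ : ℝ → ℝ := fun r => (8 * Real.pi)⁻¹ *
    (Real.exp (-2 * b (tm, r)) * (2 * dr a (tm, r) / r + 1 / r ^ 2) - 1 / r ^ 2)
  let μ₀ : Event → ℝ := fun x => (8 * Real.pi)⁻¹ *
    (Real.exp (-2 * b x.1) * (2 * dr b x.1 / x.1.2 - 1 / x.1.2 ^ 2) + 1 / x.1.2 ^ 2)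
  let l : Event → ℝ := fun x => (8 * Real.pi)⁻¹ *
    (Real.exp (-2 * b x.1) * (dr (dr a) x.1 + dr a x.1 ^ 2
        - dr a x.1 * dr b x.1 + (dr a x.1 - dr b x.1) / x.1.2)
      - Real.exp (-2 * a x.1) * (dt (dt b) x.1 + dt b x.1 ^ 2 - dt a x.1 * dt b x.1))
  have hT : HasDiagonalStress t₀ t₁ r₀ r₁ g μ₀ (fun x => m₁ (rCoord x)) l := by
    rw [hD.hasDiagonalStress_iff hr₀]
    intro x hx
    refine ⟨(hstat _ hx).1, mul_inv_cancel_left₀ (by positivity) _, ?_,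
      mul_inv_cancel_left₀ (by positivity) _⟩
    refine (mul_inv_cancel_left₀ (a := 8 * Real.pi) (by positivity) _).trans ?_
    rw [HasDiagonalForm.eq_of_dt_eq_zero hD.smooth_b (fun z hz => (hstat z hz).1) htm hx,
      HasDiagonalForm.eq_of_dt_eq_zero (contDiffOn_dr hO hD.smooth_a)
        (fun z hz => (hstat z hz).2) htm hx]
    rfl
  obtain ⟨m₀, hμ₀, hm₀, hm₁, c, rs, hrs, hbound, hl, hform⟩ :=
    hg.exists_staticForm ht hr₀ hr hT fun x _ => rfl
  refine ⟨m₀, m₁, tovRHS m₀ m₁ c rs, hm₀, hm₁, fun x hx => ?_, c, rs, hrs, hbound,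
    fun r _ => rfl, hform⟩
  beta_reduce
  rw [← hμ₀ x hx, ← hl x hx]
  exact hT x hx

end

end GR

end

theorem theorem2 (t₀ t₁ r₀ r₁ : EReal) (ht : t₀ < t₁) (hr₀ : 0 ≤ r₀) (hr : r₀ < r₁)
    (g : GR.BilinField GR.modelX GR.Event) :
    -- the direct part
    (∀ (μ₀ μ₁ lam : GR.Event → ℝ) (m₁ : ℝ → ℝ),
      GR.IsSphericallySymmetric t₀ t₁ r₀ r₁ g →
      GR.HasDiagonalStress t₀ t₁ r₀ r₁ g μ₀ μ₁ lam →
      (∀ x ∈ GR.region t₀ t₁ r₀ r₁, μ₁ x = m₁ (GR.rCoord x)) →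
      ∃ m₀ : ℝ → ℝ,
        (∀ x ∈ GR.region t₀ t₁ r₀ r₁, μ₀ x = m₀ (GR.rCoord x)) ∧
        ContDiffOn ℝ ∞ m₀ (GR.between r₀ r₁) ∧ ContDiffOn ℝ ∞ m₁ (GR.between r₀ r₁) ∧
        ∃ c : ℝ, ∃ rs ∈ GR.between r₀ r₁,
          GR.MassBound r₀ r₁ m₀ c rs ∧
          (∀ x ∈ GR.region t₀ t₁ r₀ r₁, lam x = GR.tovRHS m₀ m₁ c rs (GR.rCoord x)) ∧
          GR.HasStaticForm t₀ t₁ r₀ r₁ g (GR.hFun m₀ c rs) (GR.pFun m₀ m₁ c rs)) ∧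
    -- the converse
    (∀ (m₀ m₁ l : ℝ → ℝ) (c rs : ℝ), rs ∈ GR.between r₀ r₁ →
      ContDiffOn ℝ ∞ m₀ (GR.between r₀ r₁) → ContDiffOn ℝ ∞ m₁ (GR.between r₀ r₁) →
      GR.MassBound r₀ r₁ m₀ c rs →
      (∀ r ∈ GR.between r₀ r₁, l r = GR.tovRHS m₀ m₁ c rs r) →
      GR.HasStaticForm t₀ t₁ r₀ r₁ g (GR.hFun m₀ c rs) (GR.pFun m₀ m₁ c rs) →
      GR.IsSphericallySymmetric t₀ t₁ r₀ r₁ g ∧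
      GR.IsStaticOn g (GR.region t₀ t₁ r₀ r₁) ∧
      GR.HasDiagonalStress t₀ t₁ r₀ r₁ g (fun x => m₀ (GR.rCoord x)) (fun x => m₁ (GR.rCoord x))
        (fun x => l (GR.rCoord x))) ∧
    -- every static spherically symmetric space-time arises
    (GR.IsSphericallySymmetric t₀ t₁ r₀ r₁ g → GR.IsStaticOn g (GR.region t₀ t₁ r₀ r₁) →
      ∃ m₀ m₁ l : ℝ → ℝ,
        ContDiffOn ℝ ∞ m₀ (GR.between r₀ r₁) ∧ ContDiffOn ℝ ∞ m₁ (GR.between r₀ r₁) ∧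
        GR.HasDiagonalStress t₀ t₁ r₀ r₁ g (fun x => m₀ (GR.rCoord x))
          (fun x => m₁ (GR.rCoord x)) (fun x => l (GR.rCoord x)) ∧
        ∃ c : ℝ, ∃ rs ∈ GR.between r₀ r₁,
          GR.MassBound r₀ r₁ m₀ c rs ∧
          (∀ r ∈ GR.between r₀ r₁, l r = GR.tovRHS m₀ m₁ c rs r) ∧
          GR.HasStaticForm t₀ t₁ r₀ r₁ g (GR.hFun m₀ c rs) (GR.pFun m₀ m₁ c rs)) := by
  exact ⟨fun _ _ _ _ hg hT hμ₁ => hg.exists_staticForm ht hr₀ hr hT hμ₁,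
    fun _ _ _ _ _ hrs hm₀ hm₁ hbound hl hg => hg.converse hr₀ hrs hm₀ hm₁ hbound hl,
    fun hg hs => hg.exists_staticForm_of_static ht hr₀ hr hs⟩
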